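/- **Networks.** A time-dependent network is a directed graph on $n$ vertices in which every arc $uv$ has a positive, continuous, $T$-periodic, piecewise linear delay function $D[uv]:\mathbb R\to\mathbb R_{>0}$, represented by its breakpoints in $[0,T)$, such that the arc-arrival function $t\mapsto t+D[uv](t)$ is nondecreasing (FIFO). The arrival time of a path is the composition of the arrival functions of its arcs, and $D[o,d](t)$ is the minimum, over all $od$-paths, of the arrival time at $d$ when leaving $o$ at time $t$, minus $t$. Let $K_{\max}$ be the largest number of breakpoints of an arc-delay function and $K^*$ the total number of concavity-spoiling breakpoints, i.e. of breakpoints in $[0,T)$ at which the slope of a (periodic) arc-delay function increases. Put $\lg x=\max\{1,\log_2x\}$ and $\operatorname{lglg}k=\max\{1,\log_2\log_2k\}$ (read as $1$ for $k\le 2$). Assume: * (sparsity) every out-degree is at most a constant $\Delta$; the graph is strongly connected; * (bounded travel-time slopes) there are $\Lambda_{\min}\in[0,1)$, $\Lambda_{\max}\ge0$ with $\frac{D[o,d](t_1)-D[o,d](t_2)}{t_1-t_2}\in[-\Lambda_{\min},\Lambda_{\max}]$ for all $o,d$ and $t_1<t_2$; * (bounded opposite trips) there is $\zeta\ge1$ with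 $D[o,d](t)\le\zeta D[d,o](t)$ for all $o,d$ and $t\in[0,T)$. **Cost model.** Elementary operations on reals and memory cost $1$, an operation on a priority queue with $k$ entries costs $1+\lfloor\log_2k\rfloor$, and an operation on a predecessor-search structure with $k$ keys, in particular the evaluation of a piecewise linear function (its value, one-sided slopes, or inverse) with $k$ breakpoints, costs $\operatorname{lglg}k$. Space is the number of stored breakpoints of the summaries. Preprocessing starts from the given network, with its concavity-spoiling breakpoints, and the given landmark set. **The oracle.** Let $\varepsilon>0$, $\rho\in(0,1)$, $r\in\mathbb N$. A set $L$ of landmarks contains every vertex independently with probability $\rho$; everything else is deterministic. *Preprocessing.* If $L\neq\emptyset$, reverse Dijkstra runs from the concavity-spoiling breakpoints give their images, i.e. the corresponding departure times (mod $T$) from each landmark $\ell$. These divide $[0,T]$ into at most $K^*+1$ intervals. On each of them a bisection is run concurrently for all destinations $v$: a time-dependent shortest-path probe (a full Dijkstra run from $\ell$) at each end of an interval $[t_s,t_f]$ gives $D[\ell,v]$ and its one-sided slopes $\Lambda^+$ at $t_s$ and $\Lambda^-$ at $t_f$. If the two tangents do not have the same slope ($\Lambda^+>\Lambda^-$), let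 $m$ be the abscissa of their intersection and let the error be the vertical distance $(\Lambda^+-\Lambda^-)\frac{(m-t_s)(t_f-m)}{t_f-t_s}$ at $m$ between the tangents and the chord; otherwise let the error be $0$. The destination $v$ is active if the error exceeds $\varepsilon\min\{D[\ell,v](t_s),D[\ell,v](t_f)\}$. While some destination is active the interval is halved, and the active destinations are treated on both halves. For an inactive destination the breakpoints at $t_s$, $t_f$ and (if $\Lambda^+>\Lambda^-$) at the intersection of the tangents are stored. The resulting piecewise linear function is the summary $\Delta[\ell,v]$. Let $U$ be the largest number of breakpoints that this produces for one destination on one of the intervals between consecutive images, and $TDP$ the largest number of probes that it uses on one of them, both over all vertices $\ell$ as possible landmarks. *Query $(w,d,t)$ with budget $r$.* If $w\in L$, return $\Delta[w,d](t)$. Otherwise grow a Dijkstra ball from $(w,t)$ until $d$ or a landmark is settled. If $d$ is settled, return the exact value. If a landmark $\ell$ is settled, at distance $R$, then $R+\Delta[\ell,d](t+R)$ is a candidate; if $r\ge1$, every vertex $x$ on the boundary of the ball (outside the ball, reached by an arc from it, with tentative arrival time $t_x$) gives the further candidate $t_x-t$ plus the answer to the query $(x,d,t_x)$ with budget $r-1$.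 Return the smallest candidate. **Theorem.** There are a constant $C$ depending only on $\Delta$ and constants $C_q(r,c)$ depending only on $\Delta$, $r$, $c$ such that for all such networks and parameters: * every summary of a landmark is a $(1+\varepsilon)$-approximation: $D[\ell,v](t)\le\Delta[\ell,v](t)\le(1+\varepsilon)D[\ell,v](t)$ for all $v$ and $t\in[0,T)$; * (i) the expected preprocessing space is at most $C\,\rho n^2(1+K^*)\,U$; * (ii) the expected preprocessing time is at most $C\,\rho n^2(1+K^*)\,\lg n\;\operatorname{lglg}(K_{\max})\,TDP$; * (iii) for every $c$ with $\operatorname{lglg}((K^*+1)U)\le c\,\frac1\rho\lg\frac1\rho$, the expected time of every query $(o,d,t_o)$, $t_o\in[0,T)$, is at most $C_q(r,c)\left(\frac1\rho\right)^{r+1}\lg\frac1\rho\;\operatorname{lglg}(K_{\max})$; * (stretch) for every $L$ and every query $(o,d,t_o)$ with $t_o\in[0,T)$, the answer lies between $D[o,d](t_o)$ and $\left(1+\varepsilon\frac{(1+\varepsilon/\psi)^{r+1}}{(1+\varepsilon/\psi)^{r+1}-1}\right)D[o,d](t_o)$, where $\psi=1+\Lambda_{\max}(1+\varepsilon)(1+2\zeta+\Lambda_{\max}\zeta)+(1+\varepsilon)\zeta$.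 -/

import Mathlib

noncomputable section

/-! ### Time-dependent networks -/

/-- A time-dependent FIFO network on the vertex set `V`.  The arcs are the pairs `(u, v)` with
`v ∈ out u`; the values of `delay u v` and `bp u v` matter for arcs only.  The arc-delay functions
are positive, periodic with period `T`, continuous and piecewise linear; `bp u v` is the set of
breakpoints in `[0, T)` by which the delay function of the arc `uv` is represented. -/
structure TDNetwork (V : Type*) [Fintype V] [DecidableEq V] where
  T : ℝ
  T_pos : 0 < T
  out : V → Finset V
  delay : V → V → ℝ → ℝ
  bp : V → V → Finset ℝ
  bp_mem : ∀ u, ∀ v ∈ out u, ∀ p ∈ bp u v, p ∈ Set.Ico 0 T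
  delay_pos : ∀ u, ∀ v ∈ out u, ∀ t, 0 < delay u v t
  delay_periodic : ∀ u, ∀ v ∈ out u, Function.Periodic (delay u v) T
  delay_continuous : ∀ u, ∀ v ∈ out u, Continuous (delay u v)
  delay_affine : ∀ u, ∀ v ∈ out u, ∀ a b : ℝ, a < b →
    (∀ s ∈ Set.Ioo a b, ∀ p ∈ bp u v, ∀ k : ℤ, s ≠ p + k * T) →
    ∃ m c : ℝ, ∀ s ∈ Set.Icc a b, delay u v s = m * s + c
  fifo : ∀ u, ∀ v ∈ out u, Monotone fun t => t + delay u v t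

/-- The left derivative of a real function. -/
def leftSlope (f : ℝ → ℝ) (t : ℝ) : ℝ := derivWithin f (Set.Iio t) t

/-- The right derivative of a real function. -/
def rightSlope (f : ℝ → ℝ) (t : ℝ) : ℝ := derivWithin f (Set.Ioi t) t

namespace TDNetwork

variable {V : Type*} [Fintype V] [DecidableEq V] (N : TDNetwork V)

/-- The arc-arrival function of the arc `uv`. -/
def arr (u v : V) (t : ℝ) : ℝ := t + N.delay u v t

/-- `N.IsPath o p d`: starting in `o` and then visiting the vertices of the list `p` one after the
other is a path along arcs that ends in `d`. -/
def IsPath : V → List V → V → Prop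
  | o, [], d => o = d
  | o, v :: p, d => v ∈ N.out o ∧ IsPath v p d

/-- The path-arrival function: the composition of the arc-arrival functions along the path. -/
def pathArr : V → List V → ℝ → ℝ
  | _, [], t => t
  | o, v :: p, t => pathArr v p (N.arr o v t)

/-- The earliest arrival time at `d` when departing from `o` at time `t`. -/
def earliest (o d : V) (t : ℝ) : ℝ := sInf {a | ∃ p, N.IsPath o p d ∧ a = N.pathArr o p t}

/-- The shortest travel time from `o` to `d` for departure time `t`. -/
def dist (o d : V) (t : ℝ) : ℝ := N.earliest o d t - t

/-- Every vertex can be reached from every other one. -/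
def StronglyConnected : Prop := ∀ o d, ∃ p, N.IsPath o p d

/-- Bounded travel-time slopes. -/
def BoundedSlopes (lmin lmax : ℝ) : Prop :=
  ∀ o d : V, ∀ t₁ t₂ : ℝ, t₁ < t₂ →
    (N.dist o d t₁ - N.dist o d t₂) / (t₁ - t₂) ∈ Set.Icc (-lmin) lmax

/-- Bounded opposite trips. -/
def BoundedOppositeTrips (ζ : ℝ) : Prop :=
  ∀ o d : V, ∀ t ∈ Set.Ico 0 N.T, N.dist o d t ≤ ζ * N.dist d o t

/-- The largest number of breakpoints of an arc-delay function. -/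
def Kmax : ℕ := Finset.univ.sup fun u => (N.out u).sup fun v => (N.bp u v).card

/-- The concavity-spoiling breakpoints `((u, v), p)`: `p` is a breakpoint in `[0, T)` of the
(periodic) delay function of the arc `uv`, and the slope of this function increases at `p`. -/
def spoiling : Finset ((V × V) × ℝ) :=
  Finset.univ.biUnion fun u => (N.out u).biUnion fun v =>
    ((N.bp u v).filter fun p =>
      leftSlope (N.delay u v) p < rightSlope (N.delay u v) p).image fun p => ((u, v), p)

/-- The number of concavity-spoiling breakpoints. -/
def Kstar : ℕ := N.spoiling.card

end TDNetwork

/-! ### The cost model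

Algorithms are written as functions that return a value together with the number of steps spent.
Elementary operations (arithmetic and comparisons of reals, memory access) cost one step. -/

/-- A value together with the cost of computing it. -/
structure Timed (α : Type*) where
  val : α
  cost : ℝ

/-- `max {1, log₂ x}`. -/
def lg (x : ℝ) : ℝ := max 1 (Real.logb 2 x)

/-- `max {1, log₂ log₂ k}`: the cost charged for one operation on a predecessor-search structure
with `k` keys, in particular for one evaluation (of the value and the slopes, or of the inverse) of
a piecewise linear function that is represented by `k` breakpoints. -/
def lglg (k : ℕ) : ℝ := max 1 (Real.logb 2 (Real.logb 2 k))

/-- `1 + ⌊log₂ k⌋`: the cost charged for one operation on a priority queue with `k` entries. -/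
def pqCost (k : ℕ) : ℝ := 1 + Nat.log 2 k

/-! ### The time-dependent algorithm of Dijkstra -/

/-- A label of a vertex: the arrival time there, and the left and the right derivative of the
arrival time with respect to the departure time. -/
structure Label where
  key : ℝ
  left : ℝ
  right : ℝ

/-- The label of the pointwise minimum of two arrival-time functions. -/
def Label.merge (x y : Label) : Label :=
  if x.key < y.key then x
  else if y.key < x.key then y
  else ⟨x.key, max x.left y.left, min x.right y.right⟩

/-- What Dijkstra's algorithm has to know of a network: the neighbours of a vertex, the label
that an arc transports from its tail to its head, and the cost of computing that label. -/
structure SearchGraph (V : Type*) where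
  nbr : V → Finset V
  relax : V → V → Label → Label
  evalCost : V → V → ℝ

/-- The state of Dijkstra's algorithm; `label` is meaningful on `settled ∪ queue`. -/
structure SearchState (V : Type*) where
  settled : Finset V
  queue : Finset V
  label : V → Label

namespace SearchGraph

variable {V : Type*} [Fintype V] [DecidableEq V] (G : SearchGraph V)

/-- A vertex of the queue with the smallest key. -/
def minVertex (s : SearchState V) (h : s.queue.Nonempty) : V :=
  (s.queue.exists_min_image (fun v => (s.label v).key) h).choose

/-- Settle the vertex `u` of the queue and relax the arcs that leave it. -/
def settle (s : SearchState V) (u : V) : Timed (SearchState V) :=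
  let settled := insert u s.settled
  let fresh := G.nbr u \ settled
  let queue := s.queue.erase u ∪ fresh
  { val :=
      { settled := settled
        queue := queue
        label := fun v =>
          if v ∈ fresh then
            if v ∈ s.queue then (s.label v).merge (G.relax u v (s.label u))
            else G.relax u v (s.label u)
          else s.label v }
    cost := pqCost s.queue.card +
      ∑ v ∈ G.nbr u, (1 + G.evalCost u v + pqCost queue.card) }

/-- Settle at most `k` further vertices, stopping as soon as a vertex of `goals` has been settled
(this vertex is returned) or the queue is empty. -/
def loop (goals : Finset V) : ℕ → SearchState V → Timed (SearchState V × Option V)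
  | 0, s => ⟨(s, none), 1⟩
  | k + 1, s =>
    if h : s.queue.Nonempty then
      let u := minVertex s h
      let s' := G.settle s u
      if u ∈ goals then ⟨(s'.val, some u), 1 + s'.cost⟩
      else
        let res := loop goals k s'.val
        ⟨res.val, 1 + s'.cost + res.cost⟩
    else ⟨(s, none), 1⟩

/-- Dijkstra's algorithm from `o` at time `t`, until a vertex of `goals` has been settled.  As every
round settles a new vertex, the bound on the number of rounds is not a restriction. -/
def search (goals : Finset V) (o : V) (t : ℝ) : Timed (SearchState V × Option V) :=
  G.loop goals (Fintype.card V) ⟨∅, {o}, fun _ => ⟨t, 1, 1⟩⟩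

end SearchGraph

namespace TDNetwork

variable {V : Type*} [Fintype V] [DecidableEq V] (N : TDNetwork V)

/-- The network as it is searched forward in time. -/
def forward : SearchGraph V where
  nbr := N.out
  relax u v x :=
    ⟨N.arr u v x.key, x.left * (1 + leftSlope (N.delay u v) x.key),
      x.right * (1 + rightSlope (N.delay u v) x.key)⟩
  evalCost u v := lglg (N.bp u v).card

/-- The latest departure time from `u` for which the arc `uv` leads to `v` not after time `τ`. -/
def latest (u v : V) (τ : ℝ) : ℝ := sSup {s | N.arr u v s ≤ τ}

/-- The reverse network, searched backward in time: the keys are the negatives of the latest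
departure times.  The slopes are not used. -/
def backward : SearchGraph V where
  nbr v := Finset.univ.filter fun u => v ∈ N.out u
  relax v u x := ⟨-N.latest u v (-x.key), 0, 0⟩
  evalCost v u := lglg (N.bp u v).card

/-- A time-dependent shortest path probe: the shortest-path tree from `o` for departure time `t`. -/
def probe (o : V) (t : ℝ) : Timed (V → Label) :=
  let res := N.forward.search ∅ o t
  ⟨res.val.1.label, res.cost⟩

/-- A reverse probe: the latest departure times from all vertices for reaching `u` at time `t`. -/
def reverseProbe (u : V) (t : ℝ) : Timed (V → ℝ) :=
  let res := N.backward.search ∅ u (-t)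
  ⟨fun v => -(res.val.1.label v).key, res.cost⟩

/-! ### Preprocessing: the bisection method -/

/-- The projection of a time to the period `[0, T)`. -/
def modT (t : ℝ) : ℝ := toIcoMod N.T_pos 0 t

/-- The images in `[0, T)` of the concavity-spoiling breakpoints, as departure times from `l`. -/
def images (l : V) : Finset ℝ :=
  N.spoiling.image fun b => N.modT ((N.reverseProbe b.1.1 b.2).val l)

/-- The intervals `(x, y)` into which `[0, T]` is divided by the images. -/
def intervals (l : V) : List (ℝ × ℝ) :=
  let cuts := (insert 0 (insert N.T (N.images l))).sort (· ≤ ·)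
  cuts.zip cuts.tail

end TDNetwork

/-- The data from which the error of the approximation on an interval `[x, y]` is computed: the
travel times `dx`, `dy` at the ends, the right derivative `sx` at `x` and the left derivative `sy`
at `y`. -/
structure Ends where
  (x y dx dy sx sy : ℝ)

namespace Ends

variable (e : Ends)

/-- The abscissa of the intersection of the two tangents. -/
def m : ℝ := (e.dy - e.dx + e.x * e.sx - e.y * e.sy) / (e.sx - e.sy)

/-- The ordinate of the intersection of the two tangents. -/
def um : ℝ := e.sx * (e.m - e.x) + e.dx

/-- The maximum absolute error between the chord and the two tangents. -/
def mae : ℝ :=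
  if e.sy < e.sx then (e.sx - e.sy) * ((e.m - e.x) * (e.y - e.m) / (e.y - e.x)) else 0

/-- The desired error has not been reached yet. -/
def Active (ε : ℝ) : Prop := ε * min e.dx e.dy < e.mae

/-- The breakpoints of the upper approximation on `[x, y]`, except the one at `y`. -/
def points : List (ℝ × ℝ) :=
  if e.sy < e.sx then [(e.x, e.dx), (e.m, e.um)] else [(e.x, e.dx)]

end Ends

/-- The outcome of a bisection: the breakpoints of the upper approximation for every destination,
and the number of shortest path probes that were used. -/
structure BisectResult (V : Type*) where
  pts : V → List (ℝ × ℝ)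
  probes : ℕ

namespace TDNetwork

variable {V : Type*} [Fintype V] [DecidableEq V] (N : TDNetwork V)

/-- The data on `[x, y]` from the labels `a` for departure time `x` and `b` for `y`. -/
def ends (x y : ℝ) (a b : Label) : Ends := ⟨x, y, a.key - x, b.key - y, a.right - 1, b.left - 1⟩

open Classical in
/-- The one-to-all bisection from `l` on `[x, y]` for the destinations in `A`, with recursion depth
at most `k`; `a` and `b` are the results of the probes at `x` and at `y`. -/
def bisect (ε : ℝ) (l : V) : ℕ → Finset V → (x y : ℝ) → (a b : V → Label) →
    Timed (BisectResult V)
  | 0, A, x, y, a, b =>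
    let e := fun v => ends x y (a v) (b v)
    { val := ⟨fun v => (e v).points, 0⟩
      cost := 1 + ∑ v ∈ A, (1 + ((e v).points.length : ℝ)) }
  | k + 1, A, x, y, a, b =>
    let e := fun v => ends x y (a v) (b v)
    let A' := A.filter fun v => (e v).Active ε
    if A' = ∅ then
      { val := ⟨fun v => (e v).points, 0⟩
        cost := 1 + ∑ v ∈ A, (1 + ((e v).points.length : ℝ)) }
    else
      let z := (x + y) / 2
      let c := N.probe l z
      let r₁ := bisect ε l k A' x z a c.val
      let r₂ := bisect ε l k A' z y c.val b
      { val :=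
          ⟨fun v => if v ∈ A' then r₁.val.pts v ++ r₂.val.pts v else (e v).points,
            1 + r₁.val.probes + r₂.val.probes⟩
        cost := 1 + (A.card : ℝ) + ∑ v ∈ A \ A', ((e v).points.length : ℝ) +
          c.cost + r₁.cost + r₂.cost }

/-- The first level of the bisection of `[x, y]` at which no destination is active on any of the
`2 ^ k` parts.  The bisection has ended at this level, so that it is not a restriction to use it as
a bound for the recursion depth. -/
def depth (ε : ℝ) (l : V) (x y : ℝ) : ℕ :=
  sInf {k : ℕ | ∀ j < 2 ^ k, ∀ v,
    let x' := x + j * ((y - x) / 2 ^ k)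
    let y' := x + (j + 1) * ((y - x) / 2 ^ k)
    ¬ (ends x' y' ((N.probe l x').val v) ((N.probe l y').val v)).Active ε}

/-- The bisection on an interval, for all destinations, including the two probes at its ends. -/
def bisectInterval (ε : ℝ) (l : V) (I : ℝ × ℝ) : Timed (BisectResult V) :=
  let a := N.probe l I.1
  let b := N.probe l I.2
  let res := N.bisect ε l (N.depth ε l I.1 I.2) Finset.univ I.1 I.2 a.val b.val
  ⟨⟨res.val.pts, 2 + res.val.probes⟩, a.cost + b.cost + res.cost⟩

/-- The summaries of the landmark `l`: for every destination the list of the breakpoints, in the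
order of the departure times, of the approximate distance function on `[0, T]`.  The cost includes
that of sorting the images, but not that of computing them. -/
def summaries (ε : ℝ) (l : V) : Timed (V → List (ℝ × ℝ)) :=
  let parts := (N.intervals l).map (N.bisectInterval ε l)
  let last := N.probe l N.T
  { val := fun v =>
      (parts.map fun res => res.val.pts v).flatten ++ [(N.T, (last.val v).key - N.T)]
    cost := N.Kstar * (1 + lglg N.Kstar) + (parts.map Timed.cost).sum +
      last.cost + Fintype.card V }

/-- The preprocessing phase for the set `L` of landmarks: the images of the concavity-spoiling
breakpoints are computed for all landmarks at once by reverse probes, and then the summaries of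
every landmark by bisection. -/
def preprocess (ε : ℝ) (L : Finset V) : Timed (V → V → List (ℝ × ℝ)) :=
  { val := fun l v => if l ∈ L then (N.summaries ε l).val v else []
    cost :=
      if L = ∅ then 0
      else ∑ b ∈ N.spoiling, (N.reverseProbe b.1.1 b.2).cost + ∑ l ∈ L, (N.summaries ε l).cost }

/-- The preprocessing space: the total number of breakpoints that are stored. -/
def space (ε : ℝ) (L : Finset V) : ℕ :=
  ∑ l ∈ L, ∑ v, ((N.preprocess ε L).val l v).length

/-- The worst-case number of breakpoints for the approximation of a distance function on an
interval on which it is concave. -/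
def U (ε : ℝ) : ℕ :=
  Finset.univ.sup fun l => Finset.univ.sup fun v =>
    ((N.intervals l).map fun I =>
      ((N.bisectInterval ε l I).val.pts v).length + 1).foldr max 0

/-- The maximum number of shortest path probes used, per landmark, for the construction of the
approximations on such an interval. -/
def TDP (ε : ℝ) : ℕ :=
  Finset.univ.sup fun l =>
    ((N.intervals l).map fun I => (N.bisectInterval ε l I).val.probes).foldr max 0

/-! ### The recursive query algorithm -/

end TDNetwork

/-- The value at `t` of the piecewise linear function with the given breakpoints. -/
def interpolate : List (ℝ × ℝ) → ℝ → ℝ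
  | [], _ => 0
  | [p], _ => p.2
  | p :: q :: s, t =>
    if t ≤ q.1 then p.2 + (q.2 - p.2) / (q.1 - p.1) * (t - p.1) else interpolate (q :: s) t

namespace TDNetwork

variable {V : Type*} [Fintype V] [DecidableEq V] (N : TDNetwork V)

/-- The evaluation, for departure time `t`, of an approximate distance function, given by its
breakpoints on `[0, T]` and continued periodically. -/
def evalSummary (s : List (ℝ × ℝ)) (t : ℝ) : Timed ℝ := ⟨interpolate s (N.modT t), lglg s.length⟩

/-- The recursive query algorithm with recursion budget `r`, for a trip from `w` to `d` with
departure time `t`; `L` is the set of landmarks and `tab` the stored table of summaries.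

From a landmark the summary is used.  Otherwise a ball around `w` is grown until `d` or a landmark
has been settled.  In the first case the answer is exact; in the second case one candidate is the
travel time via this landmark, and if the budget is not exhausted there is one more candidate for
every vertex on the boundary of the ball (exhaustive search).  The best candidate is returned. -/
def query (L : Finset V) (tab : V → V → List (ℝ × ℝ)) (d : V) : ℕ → V → ℝ → Timed ℝ
  | r, w, t =>
    if w ∈ L then
      let a := N.evalSummary (tab w d) t
      ⟨a.val, 1 + a.cost⟩
    else
      let ball := N.forward.search (insert d L) w t
      let label := ball.val.1.label
      match ball.val.2 with
      | none => ⟨0, 1 + ball.cost⟩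
      | some l =>
        if l = d then ⟨(label d).key - t, 1 + ball.cost⟩
        else
          let a := N.evalSummary (tab l d) (label l).key
          let sol := (label l).key - t + a.val
          match r with
          | 0 => ⟨sol, 1 + ball.cost + a.cost⟩
          | r' + 1 =>
            let sub := fun x => query L tab d r' x (label x).key
            { val := ball.val.1.queue.fold min sol fun x => (label x).key - t + (sub x).val
              cost := 1 + ball.cost + a.cost + ∑ x ∈ ball.val.1.queue, (1 + (sub x).cost) }

/-- The answer of the oracle with landmark set `L` and recursion budget `r` to a query. -/
def oracle (ε : ℝ) (r : ℕ) (L : Finset V) (o d : V) (t : ℝ) : Timed ℝ :=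
  N.query L (N.preprocess ε L).val d r o t

end TDNetwork

/-! ### Random landmarks and the stretch -/

/-- The expectation of `f L` for the random set `L` of landmarks that contains every vertex,
independently of the other ones, with probability `ρ`. -/
def landmarkExpectation {V : Type*} [Fintype V] [DecidableEq V] (ρ : ℝ) (f : Finset V → ℝ) : ℝ :=
  ∑ L : Finset V, ρ ^ L.card * (1 - ρ) ^ (Fintype.card V - L.card) * f L

/-- The constant of the constant-factor approximation by a single ball. -/
def psi (ε lmax ζ : ℝ) : ℝ := 1 + lmax * (1 + ε) * (1 + 2 * ζ + lmax * ζ) + (1 + ε) * ζ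

/-- The stretch of the oracle with recursion budget `r`. -/
def stretch (ε ψ : ℝ) (r : ℕ) : ℝ :=
  1 + ε * ((1 + ε / ψ) ^ (r + 1) / ((1 + ε / ψ) ^ (r + 1) - 1))

end

set_option linter.unusedSectionVars false

/-! Dijkstra's algorithm is correct whenever keys are transported by monotone, strictly inflationary
functions (`Inv.settle`, `Inv.dominated`). Forward search with the arc-arrival functions and
backward search with their adjoints are both instances, so probes give earliest arrival and reverse
probes latest departure times.

Approximation. A probe carries with each key the germ of the earliest-arrival function, so the
slopes it reports are genuine one-sided slopes (`probe_describes`). Such a slope can increase only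
if some earliest arrival meets a concavity-spoiling breakpoint. As `lmin < 1`, arrival times are
strictly increasing in the departure time, so up to periods this happens for one departure time per
breakpoint, its image. Between images the travel times are therefore concave (`dist_concaveOn`). The
end tangents of a concave function lie above it and the chord below, with the largest gap at the
intersection of the tangents; an inactive destination is thus approximated within `1 + ε`
(`Ends.Describes.isUpperApprox`). The bisection ends because the gap shrinks with the interval,
while the travel times to other vertices stay away from `0` (`depth_spec`).

Stretch. Let `D` be the travel time and `R` the distance of the landmark that stops the ball. The
candidate via the landmark is at most `(1 + ε) D + ψ R` (`single_ball_bound`), which is good for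
small `R`. Recursion from the vertex where an optimal path leaves the ball errs only on the
remaining time, at most `D - R`, which is good for large `R`. Balancing the two gives the recursion
solved by `stretchFactor` (`min_le_stretchFactor_succ`).

Preprocessing. Space and time are bounded by a fixed amount per landmark, and `ρ n` landmarks are
expected.

Query time. Decisions about landmarks are deferred: each newly settled vertex is revealed only when
it is settled. Expectations are restricted to the event that the vertices of `S` are no landmarks
and those of `M` are, without normalisation. In a reveal the probability `1 - ρ` of going on
outweighs the growth of the potential `(Y + ρ |S|) ^ q` as soon as `2 q ≤ Y` (`potential_step`); so
a ball is paid for by `O(1 / ρ)` rounds even if their costs grow polynomially in `ρ |S|`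
(`expected_loopCost_le`). Sub-queries share the random set with the outer ball, hence the induction
on the budget treats all `S` and `M` at once (`expected_query_cost_le`). -/

theorem Label.merge_key (x y : Label) : (x.merge y).key = min x.key y.key := by
  unfold Label.merge
  split_ifs with h1 h2
  · exact (min_eq_left h1.le).symm
  · exact (min_eq_right h2.le).symm
  · have : x.key = y.key := le_antisymm (not_lt.1 h2) (not_lt.1 h1)
    simp [this]

/-! ### Correctness of Dijkstra's algorithm for monotone key functions -/

namespace SearchGraph

variable {V : Type*} [Fintype V] [DecidableEq V] (G : SearchGraph V)

/-- `G.Reach φ o t v a`: starting with key `t` in `o`, some walk transports the key `a` to `v`. -/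
inductive Reach (φ : V → V → ℝ → ℝ) (o : V) (t : ℝ) : V → ℝ → Prop
  | base : Reach φ o t o t
  | step {u v : V} {a : ℝ} : Reach φ o t u a → v ∈ G.nbr u → Reach φ o t v (φ u v a)

/-- The keys of the relaxed labels are given by monotone, strictly inflationary functions. -/
structure KeyLaw (φ : V → V → ℝ → ℝ) : Prop where
  key : ∀ u v x, (G.relax u v x).key = φ u v x.key
  mono : ∀ u, ∀ v ∈ G.nbr u, Monotone (φ u v)
  lt : ∀ u, ∀ v ∈ G.nbr u, ∀ a, a < φ u v a

/-- The invariant of Dijkstra's algorithm. -/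
structure Inv (φ : V → V → ℝ → ℝ) (o : V) (t : ℝ) (s : SearchState V) : Prop where
  disj : Disjoint s.settled s.queue
  source : o ∈ s.settled ∪ s.queue
  source_key : (s.label o).key ≤ t
  reach : ∀ v ∈ s.settled ∪ s.queue, G.Reach φ o t v (s.label v).key
  arc : ∀ u ∈ s.settled, ∀ v ∈ G.nbr u,
    v ∈ s.settled ∪ s.queue ∧ (s.label v).key ≤ φ u v (s.label u).key
  order : ∀ u ∈ s.settled, ∀ v ∈ s.queue, (s.label u).key ≤ (s.label v).key

theorem minVertex_mem (s : SearchState V) (h : s.queue.Nonempty) : minVertex s h ∈ s.queue :=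
  (s.queue.exists_min_image (fun v => (s.label v).key) h).choose_spec.1

theorem minVertex_le (s : SearchState V) (h : s.queue.Nonempty) {v : V} (hv : v ∈ s.queue) :
    (s.label (minVertex s h)).key ≤ (s.label v).key :=
  (s.queue.exists_min_image (fun v => (s.label v).key) h).choose_spec.2 v hv

theorem settle_settled (s : SearchState V) (u : V) :
    (G.settle s u).val.settled = insert u s.settled := rfl

theorem settle_queue (s : SearchState V) (u : V) :
    (G.settle s u).val.queue = s.queue.erase u ∪ (G.nbr u \ insert u s.settled) := rfl

theorem settle_label_of_not_fresh (s : SearchState V) {u v : V}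
    (hv : v ∉ G.nbr u \ insert u s.settled) : (G.settle s u).val.label v = s.label v :=
  if_neg hv

theorem settle_label_of_mem_queue (s : SearchState V) {u v : V}
    (hv : v ∈ G.nbr u \ insert u s.settled) (hq : v ∈ s.queue) :
    (G.settle s u).val.label v = (s.label v).merge (G.relax u v (s.label u)) :=
  (if_pos hv).trans (if_pos hq)

theorem settle_label_of_not_mem_queue (s : SearchState V) {u v : V}
    (hv : v ∈ G.nbr u \ insert u s.settled) (hq : v ∉ s.queue) :
    (G.settle s u).val.label v = G.relax u v (s.label u) :=
  (if_pos hv).trans (if_neg hq)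

theorem settle_label_of_mem_settled (s : SearchState V) {u v : V} (hv : v ∈ insert u s.settled) :
    (G.settle s u).val.label v = s.label v :=
  G.settle_label_of_not_fresh s fun h => (Finset.mem_sdiff.1 h).2 hv

theorem mem_settle_queue {s : SearchState V} {u v : V} :
    v ∈ (G.settle s u).val.queue ↔
      (v ≠ u ∧ v ∈ s.queue) ∨ (v ∈ G.nbr u ∧ v ∉ insert u s.settled) := by
  simp [settle_queue]

theorem settle_disjoint {s : SearchState V} (u : V) (h : Disjoint s.settled s.queue) :
    Disjoint (G.settle s u).val.settled (G.settle s u).val.queue := by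
  rw [Finset.disjoint_left] at h ⊢
  intro v hv hq
  rw [settle_settled] at hv
  rcases (G.mem_settle_queue).1 hq with ⟨h1, h2⟩ | ⟨_, h2⟩
  · exact h ((Finset.mem_insert.1 hv).resolve_left h1) h2
  · exact h2 hv

variable {G} {φ : V → V → ℝ → ℝ} {o : V} {t : ℝ}

/-- Every attainable key is dominated by a settled vertex or by a vertex of the queue. -/
theorem Inv.dominated (hG : G.KeyLaw φ) {s : SearchState V} (hs : G.Inv φ o t s) {v : V} {a : ℝ}
    (h : G.Reach φ o t v a) :
    (v ∈ s.settled ∧ (s.label v).key ≤ a) ∨ ∃ x ∈ s.queue, (s.label x).key ≤ a := by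
  induction h with
  | base =>
    rcases Finset.mem_union.1 hs.source with h | h
    · exact Or.inl ⟨h, hs.source_key⟩
    · exact Or.inr ⟨o, h, hs.source_key⟩
  | @step u v a _ hv ih =>
    rcases ih with ⟨hu, hk⟩ | ⟨x, hx, hk⟩
    · obtain ⟨h1, h2⟩ := hs.arc u hu v hv
      have h3 := h2.trans (hG.mono u v hv hk)
      rcases Finset.mem_union.1 h1 with h | h
      · exact Or.inl ⟨h, h3⟩
      · exact Or.inr ⟨v, h, h3⟩
    · exact Or.inr ⟨x, hx, hk.trans (hG.lt u v hv a).le⟩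

/-- The queue alternative of `Inv.dominated` is harmless, because settled keys never exceed queued
ones. -/
theorem Inv.le_of_settled (hG : G.KeyLaw φ) {s : SearchState V} (hs : G.Inv φ o t s) {v : V}
    {a : ℝ} (hv : v ∈ s.settled) (h : G.Reach φ o t v a) : (s.label v).key ≤ a := by
  rcases hs.dominated hG h with ⟨_, h⟩ | ⟨x, hx, h⟩
  · exact h
  · exact (hs.order v hv x hx).trans h

/-- For the vertex about to be settled this says that its key is final; for the other unsettled
vertices, that none of them can be reached earlier. -/
theorem Inv.minVertex_le_reach (hG : G.KeyLaw φ) {s : SearchState V} (hs : G.Inv φ o t s)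
    (hq : s.queue.Nonempty) {v : V} {a : ℝ} (hv : v ∉ s.settled) (h : G.Reach φ o t v a) :
    (s.label (minVertex s hq)).key ≤ a := by
  rcases hs.dominated hG h with ⟨h, _⟩ | ⟨x, hx, h⟩
  · exact absurd h hv
  · exact (minVertex_le s hq hx).trans h

theorem Inv.init : G.Inv φ o t ⟨∅, {o}, fun _ => ⟨t, 1, 1⟩⟩ where
  disj := by simp
  source := by simp
  source_key := le_rfl
  reach := by
    intro v hv
    have : v = o := by simpa using hv
    subst this
    exact Reach.base
  arc := by simp
  order := by simp

/-- A new key `φ u v (key u)` exceeds the key of `u`, which is at least every settled key. So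
relaxation disturbs neither the settled labels nor the order between settled and queued vertices. -/
theorem Inv.settle (hG : G.KeyLaw φ) {s : SearchState V} (hs : G.Inv φ o t s)
    (hq : s.queue.Nonempty) : G.Inv φ o t (G.settle s (minVertex s hq)).val := by
  set u := minVertex s hq with hu
  have huq : u ∈ s.queue := minVertex_mem s hq
  have hmin : ∀ v ∈ s.queue, (s.label u).key ≤ (s.label v).key := fun v hv => minVertex_le s hq hv
  have hsub : ∀ v ∈ s.settled ∪ s.queue,
      v ∈ (G.settle s u).val.settled ∪ (G.settle s u).val.queue := by
    intro v hv
    rw [Finset.mem_union, settle_settled, mem_settle_queue]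
    by_cases hvu : v = u
    · exact Or.inl (hvu ▸ Finset.mem_insert_self _ _)
    · rcases Finset.mem_union.1 hv with h | h
      · exact Or.inl (Finset.mem_insert_of_mem h)
      · exact Or.inr (Or.inl ⟨hvu, h⟩)
  have hle : ∀ v ∈ s.settled ∪ s.queue,
      ((G.settle s u).val.label v).key ≤ (s.label v).key := by
    intro v hv
    by_cases hf : v ∈ G.nbr u \ insert u s.settled
    · have hvq : v ∈ s.queue := (Finset.mem_union.1 hv).resolve_left fun h =>
        (Finset.mem_sdiff.1 hf).2 (Finset.mem_insert_of_mem h)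
      rw [settle_label_of_mem_queue G s hf hvq, Label.merge_key]
      exact min_le_left _ _
    · rw [settle_label_of_not_fresh G s hf]
  have hfresh : ∀ v ∈ G.nbr u \ insert u s.settled,
      (((G.settle s u).val.label v).key = (s.label v).key ∧ v ∈ s.queue) ∨
        ((G.settle s u).val.label v).key = φ u v (s.label u).key := by
    intro v hf
    by_cases hvq : v ∈ s.queue
    · rw [settle_label_of_mem_queue G s hf hvq, Label.merge_key, hG.key]
      rcases min_choice (s.label v).key (φ u v (s.label u).key) with h | h
      · exact Or.inl ⟨h, hvq⟩
      · exact Or.inr h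
    · rw [settle_label_of_not_mem_queue G s hf hvq, hG.key]
      exact Or.inr rfl
  have hfle : ∀ v ∈ G.nbr u \ insert u s.settled,
      ((G.settle s u).val.label v).key ≤ φ u v (s.label u).key := by
    intro v hf
    by_cases hvq : v ∈ s.queue
    · rw [settle_label_of_mem_queue G s hf hvq, Label.merge_key, hG.key]
      exact min_le_right _ _
    · rw [settle_label_of_not_mem_queue G s hf hvq, hG.key]
  have hur : G.Reach φ o t u (s.label u).key := hs.reach u (Finset.mem_union_right _ huq)
  constructor
  · exact G.settle_disjoint u hs.disj
  · exact hsub o hs.source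
  · exact (hle o hs.source).trans hs.source_key
  · intro v hv
    by_cases hf : v ∈ G.nbr u \ insert u s.settled
    · rcases hfresh v hf with ⟨h, hvq⟩ | h
      · rw [h]
        exact hs.reach v (Finset.mem_union_right _ hvq)
      · rw [h]
        exact Reach.step hur (Finset.mem_sdiff.1 hf).1
    · rw [settle_label_of_not_fresh G s hf]
      apply hs.reach
      rcases Finset.mem_union.1 hv with h | h
      · rw [settle_settled] at h
        rcases Finset.mem_insert.1 h with h | h
        · exact Finset.mem_union_right _ (h ▸ huq)
        · exact Finset.mem_union_left _ h
      · rcases (G.mem_settle_queue).1 h with ⟨_, h⟩ | ⟨h1, h2⟩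
        · exact Finset.mem_union_right _ h
        · exact absurd (Finset.mem_sdiff.2 ⟨h1, h2⟩) hf
  · intro w hw v hv
    rw [settle_settled] at hw
    rw [settle_label_of_mem_settled G s hw]
    rcases Finset.mem_insert.1 hw with rfl | hw
    · by_cases hf : v ∈ G.nbr u \ insert u s.settled
      · exact ⟨Finset.mem_union_right _ ((G.mem_settle_queue).2 (Or.inr (Finset.mem_sdiff.1 hf))),
          hfle v hf⟩
      · have hvs : v ∈ insert u s.settled := by
          by_contra h
          exact hf (Finset.mem_sdiff.2 ⟨hv, h⟩)
        refine ⟨Finset.mem_union_left _ hvs, ?_⟩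
        rw [settle_label_of_not_fresh G s hf]
        -- An arc into a settled vertex needs no relaxation: the key of its head is already at most
        -- that of `u`.
        refine le_trans ?_ (hG.lt u v hv _).le
        rcases Finset.mem_insert.1 hvs with h | h
        · rw [h]
        · exact hs.order v h u huq
    · obtain ⟨h1, h2⟩ := hs.arc w hw v hv
      exact ⟨hsub v h1, (hle v h1).trans h2⟩
  · intro w hw v hv
    rw [settle_settled] at hw
    rw [settle_label_of_mem_settled G s hw]
    have hwu : (s.label w).key ≤ (s.label u).key := by
      rcases Finset.mem_insert.1 hw with rfl | h
      · exact le_rfl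
      · exact hs.order w h u huq
    refine hwu.trans ?_
    by_cases hf : v ∈ G.nbr u \ insert u s.settled
    · rcases hfresh v hf with ⟨h, hvq⟩ | h
      · rw [h]
        exact hmin v hvq
      · rw [h]
        exact (hG.lt u v (Finset.mem_sdiff.1 hf).1 _).le
    · rw [settle_label_of_not_fresh G s hf]
      rcases (G.mem_settle_queue).1 hv with ⟨_, h⟩ | ⟨h1, h2⟩
      · exact hmin v h
      · exact absurd (Finset.mem_sdiff.2 ⟨h1, h2⟩) hf

variable (G)

theorem loop_succ_of_mem (goals : Finset V) (k : ℕ) (s : SearchState V) (h : s.queue.Nonempty)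
    (hu : minVertex s h ∈ goals) :
    G.loop goals (k + 1) s = ⟨((G.settle s (minVertex s h)).val, some (minVertex s h)),
      1 + (G.settle s (minVertex s h)).cost⟩ := by
  simp [loop, h, hu]

theorem loop_succ_of_not_mem (goals : Finset V) (k : ℕ) (s : SearchState V)
    (h : s.queue.Nonempty) (hu : minVertex s h ∉ goals) :
    G.loop goals (k + 1) s =
      ⟨(G.loop goals k (G.settle s (minVertex s h)).val).val,
        1 + (G.settle s (minVertex s h)).cost +
          (G.loop goals k (G.settle s (minVertex s h)).val).cost⟩ := by
  simp [loop, h, hu]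

theorem loop_succ_of_empty (goals : Finset V) (k : ℕ) (s : SearchState V)
    (h : ¬ s.queue.Nonempty) : G.loop goals (k + 1) s = ⟨(s, none), 1⟩ := by
  simp [loop, h]

/-- The outcome of the loop: an invariant `P` of the rounds holds in the end, and either the queue
is empty and no goal has been settled, or the last settled vertex is the only settled goal. -/
theorem loop_spec {P : SearchState V → Prop}
    (hP : ∀ s (h : s.queue.Nonempty), P s → P (G.settle s (minVertex s h)).val)
    (goals : Finset V) (k : ℕ) (s : SearchState V) (hs : P s)
    (hd : Disjoint s.settled s.queue) (hg : Disjoint s.settled goals)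
    (hk : (Finset.univ \ s.settled).card ≤ k) :
    P (G.loop goals k s).val.1 ∧
      (((G.loop goals k s).val.2 = none ∧ (G.loop goals k s).val.1.queue = ∅ ∧
          Disjoint (G.loop goals k s).val.1.settled goals) ∨
        ∃ l ∈ goals, (G.loop goals k s).val.2 = some l ∧ l ∈ (G.loop goals k s).val.1.settled ∧
          ∀ v ∈ (G.loop goals k s).val.1.settled, v ∈ goals → v = l) := by
  induction k generalizing s with
  | zero =>
    refine ⟨hs, Or.inl ⟨rfl, ?_, hg⟩⟩
    -- The number of rounds is at least the number of unsettled vertices; when it is used up,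
    -- everything is settled and the disjoint queue is empty.
    have h1 : Finset.univ \ s.settled = ∅ := Finset.card_eq_zero.1 (Nat.le_zero.1 hk)
    change s.queue = ∅
    rw [Finset.eq_empty_iff_forall_notMem]
    intro v hv
    have : v ∈ Finset.univ \ s.settled :=
      Finset.mem_sdiff.2 ⟨Finset.mem_univ _, fun h => Finset.disjoint_left.1 hd h hv⟩
    rw [h1] at this
    exact absurd this (Finset.notMem_empty v)
  | succ k ih =>
    by_cases h : s.queue.Nonempty
    · by_cases hu : minVertex s h ∈ goals
      · rw [loop_succ_of_mem G goals k s h hu]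
        refine ⟨hP s h hs, Or.inr ⟨_, hu, rfl, Finset.mem_insert_self _ _, ?_⟩⟩
        intro v hv hvg
        rcases Finset.mem_insert.1 hv with h | h
        · exact h
        · exact absurd hvg (Finset.disjoint_left.1 hg h)
      · rw [loop_succ_of_not_mem G goals k s h hu]
        have hmem := minVertex_mem s h
        refine ih _ (hP s h hs) (G.settle_disjoint _ hd) ?_ ?_
        · rw [settle_settled, Finset.disjoint_insert_left]
          exact ⟨hu, hg⟩
        · have hns : minVertex s h ∉ s.settled := fun h' => Finset.disjoint_left.1 hd h' hmem
          rw [settle_settled, Finset.sdiff_insert, Finset.card_erase_of_mem (by simp [hns])]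
          omega
    · rw [loop_succ_of_empty G goals k s h]
      exact ⟨hs, Or.inl ⟨rfl, Finset.not_nonempty_iff_eq_empty.1 h, hg⟩⟩

theorem search_spec {P : SearchState V → Prop}
    (hP : ∀ s (h : s.queue.Nonempty), P s → P (G.settle s (minVertex s h)).val)
    (goals : Finset V) (o : V) (t : ℝ) (hs : P ⟨∅, {o}, fun _ => ⟨t, 1, 1⟩⟩) :
    P (G.search goals o t).val.1 ∧
      (((G.search goals o t).val.2 = none ∧ (G.search goals o t).val.1.queue = ∅ ∧
          Disjoint (G.search goals o t).val.1.settled goals) ∨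
        ∃ l ∈ goals, (G.search goals o t).val.2 = some l ∧
          l ∈ (G.search goals o t).val.1.settled ∧
          ∀ v ∈ (G.search goals o t).val.1.settled, v ∈ goals → v = l) :=
  G.loop_spec hP goals _ _ hs (by simp) (by simp) (by simp)

end SearchGraph

/-! ### Arc-arrival functions and the two search directions -/

namespace TDNetwork

variable {V : Type*} [Fintype V] [DecidableEq V] (N : TDNetwork V)

theorem arr_mono {u v : V} (h : v ∈ N.out u) : Monotone (N.arr u v) := N.fifo u v h

theorem lt_arr {u v : V} (h : v ∈ N.out u) (t : ℝ) : t < N.arr u v t :=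
  lt_add_of_pos_right t (N.delay_pos u v h t)

theorem arr_continuous {u v : V} (h : v ∈ N.out u) : Continuous (N.arr u v) :=
  continuous_id.add (N.delay_continuous u v h)

theorem arr_add_period {u v : V} (h : v ∈ N.out u) (t : ℝ) :
    N.arr u v (t + N.T) = N.arr u v t + N.T := by
  simp only [arr, N.delay_periodic u v h t]
  ring

theorem exists_delay_le {u v : V} (h : v ∈ N.out u) : ∃ B, ∀ t, N.delay u v t ≤ B := by
  have hc := (N.delay_periodic u v h).compact_of_continuous N.T_pos.ne'
    (N.delay_continuous u v h)
  obtain ⟨B, hB⟩ := hc.bddAbove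
  exact ⟨B, fun t => hB (Set.mem_range_self t)⟩

/-- `latest` is the upper adjoint of the arc-arrival function. The supremum is attained: the set is
closed, bounded above because delays are positive, and nonempty because a periodic continuous delay
is bounded. -/
theorem le_latest_iff {u v : V} (h : v ∈ N.out u) {s τ : ℝ} :
    s ≤ N.latest u v τ ↔ N.arr u v s ≤ τ := by
  have hbdd : BddAbove {s | N.arr u v s ≤ τ} :=
    ⟨τ, fun s hs => (N.lt_arr h s).le.trans hs⟩
  have hne : {s | N.arr u v s ≤ τ}.Nonempty := by
    obtain ⟨B, hB⟩ := N.exists_delay_le h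
    refine ⟨τ - B, ?_⟩
    have := hB (τ - B)
    simp only [Set.mem_ofPred_eq, arr]
    linarith
  have hcl : IsClosed {s | N.arr u v s ≤ τ} :=
    isClosed_le (N.arr_continuous h) continuous_const
  constructor
  · intro hs
    exact (N.arr_mono h hs).trans (hcl.csSup_mem hne hbdd)
  · intro hs
    exact le_csSup hbdd hs

theorem forward_keyLaw : N.forward.KeyLaw N.arr where
  key _ _ _ := rfl
  mono _ _ h := N.arr_mono h
  lt _ _ h := N.lt_arr h

theorem mem_backward_nbr {u v : V} : u ∈ N.backward.nbr v ↔ v ∈ N.out u := by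
  simp [backward]

/-- Negating times turns latest departures into smallest keys; both laws follow from the adjunction
`le_latest_iff`. -/
theorem backward_keyLaw : N.backward.KeyLaw fun v u a => -N.latest u v (-a) where
  key _ _ _ := rfl
  mono v u h a b hab := by
    rw [mem_backward_nbr] at h
    refine neg_le_neg ((N.le_latest_iff h).2 ?_)
    exact ((N.le_latest_iff h).1 le_rfl).trans (neg_le_neg hab)
  lt v u h a := by
    rw [mem_backward_nbr] at h
    have h1 := (N.le_latest_iff h).1 (le_refl (N.latest u v (-a)))
    have h2 := N.lt_arr h (N.latest u v (-a))
    linarith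

/-! ### Paths and earliest arrival times -/

variable {N}

theorem IsPath.reach {o x d : V} {p : List V} {t a : ℝ} (hx : N.forward.Reach N.arr o t x a)
    (hp : N.IsPath x p d) : N.forward.Reach N.arr o t d (N.pathArr x p a) := by
  induction p generalizing x a with
  | nil =>
    obtain rfl : x = d := hp
    exact hx
  | cons v p ih => exact ih (SearchGraph.Reach.step hx hp.1) hp.2

theorem isPath_append_singleton {o u v : V} {p : List V} (hp : N.IsPath o p u)
    (h : v ∈ N.out u) (t : ℝ) :
    N.IsPath o (p ++ [v]) v ∧ N.pathArr o (p ++ [v]) t = N.arr u v (N.pathArr o p t) := by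
  induction p generalizing o t with
  | nil =>
    obtain rfl : o = u := hp
    exact ⟨⟨h, rfl⟩, rfl⟩
  | cons w p ih => exact ⟨⟨hp.1, (ih hp.2 t).1⟩, (ih hp.2 _).2⟩

/-- `Reach` extends a walk at its far end, as the search does; `IsPath` peels arcs off at the
origin, as the definition of `earliest` does. -/
theorem reach_iff_exists_path {o d : V} {t a : ℝ} :
    N.forward.Reach N.arr o t d a ↔ ∃ p, N.IsPath o p d ∧ a = N.pathArr o p t := by
  constructor
  · intro h
    induction h with
    | base => exact ⟨[], rfl, rfl⟩
    | @step u v a _ hv ih =>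
      obtain ⟨p, hp, rfl⟩ := ih
      obtain ⟨h1, h2⟩ := isPath_append_singleton hp hv t
      exact ⟨p ++ [v], h1, h2.symm⟩
  · rintro ⟨p, hp, rfl⟩
    exact hp.reach SearchGraph.Reach.base

/-- The outcome of a complete forward search. -/
theorem forward_search_spec (hc : N.StronglyConnected) (o : V) (t : ℝ) :
    N.forward.Inv N.arr o t (N.forward.search ∅ o t).val.1 ∧
      ∀ v, v ∈ (N.forward.search ∅ o t).val.1.settled := by
  obtain ⟨h1, h2⟩ := N.forward.search_spec (P := N.forward.Inv N.arr o t)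
    (fun s h hs => hs.settle N.forward_keyLaw h) ∅ o t SearchGraph.Inv.init
  refine ⟨h1, fun v => ?_⟩
  have hq : (N.forward.search ∅ o t).val.1.queue = ∅ := by
    rcases h2 with h | ⟨l, hl, _⟩
    · exact h.2.1
    · exact absurd hl (Finset.notMem_empty l)
  obtain ⟨p, hp⟩ := hc o v
  rcases h1.dominated N.forward_keyLaw (hp.reach SearchGraph.Reach.base) with h | ⟨x, hx, _⟩
  · exact h.1
  · rw [hq] at hx
    exact absurd hx (Finset.notMem_empty x)

theorem isLeast_probe (hc : N.StronglyConnected) (o d : V) (t : ℝ) :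
    IsLeast {a | ∃ p, N.IsPath o p d ∧ a = N.pathArr o p t} ((N.probe o t).val d).key := by
  obtain ⟨h1, h2⟩ := forward_search_spec hc o t
  refine ⟨reach_iff_exists_path.1 (h1.reach d (Finset.mem_union_left _ (h2 d))), ?_⟩
  intro a ha
  exact h1.le_of_settled N.forward_keyLaw (h2 d) (reach_iff_exists_path.2 ha)

theorem probe_key (hc : N.StronglyConnected) (o d : V) (t : ℝ) :
    ((N.probe o t).val d).key = N.earliest o d t :=
  (isLeast_probe hc o d t).csInf_eq.symm

theorem isLeast_earliest (hc : N.StronglyConnected) (o d : V) (t : ℝ) :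
    IsLeast {a | ∃ p, N.IsPath o p d ∧ a = N.pathArr o p t} (N.earliest o d t) :=
  probe_key hc o d t ▸ isLeast_probe hc o d t

theorem reach_earliest (hc : N.StronglyConnected) (o d : V) (t : ℝ) :
    N.forward.Reach N.arr o t d (N.earliest o d t) :=
  reach_iff_exists_path.2 (isLeast_earliest hc o d t).1

theorem earliest_le_of_reach (hc : N.StronglyConnected) {o d : V} {t a : ℝ}
    (h : N.forward.Reach N.arr o t d a) : N.earliest o d t ≤ a :=
  (isLeast_earliest hc o d t).2 (reach_iff_exists_path.1 h)

/-- A label with the least attainable key carries the earliest arrival time. -/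
theorem key_eq_earliest (hc : N.StronglyConnected) {o d : V} {t k : ℝ}
    (h : N.forward.Reach N.arr o t d k) (hk : ∀ a, N.forward.Reach N.arr o t d a → k ≤ a) :
    k = N.earliest o d t :=
  le_antisymm (hk _ (reach_earliest hc o d t)) (earliest_le_of_reach hc h)

theorem le_of_reach {o d : V} {t a : ℝ} (h : N.forward.Reach N.arr o t d a) :
    t ≤ a ∧ (o ≠ d → t < a) := by
  induction h with
  | base => exact ⟨le_rfl, fun h => absurd rfl h⟩
  | @step u v a _ hv ih =>
    have := ih.1.trans_lt (N.lt_arr hv a)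
    exact ⟨this.le, fun _ => this⟩

theorem le_earliest (hc : N.StronglyConnected) (o d : V) (t : ℝ) : t ≤ N.earliest o d t :=
  (le_of_reach (reach_earliest hc o d t)).1

theorem lt_earliest (hc : N.StronglyConnected) {o d : V} (h : o ≠ d) (t : ℝ) :
    t < N.earliest o d t :=
  (le_of_reach (reach_earliest hc o d t)).2 h

theorem earliest_self (hc : N.StronglyConnected) (o : V) (t : ℝ) : N.earliest o o t = t :=
  le_antisymm (earliest_le_of_reach hc SearchGraph.Reach.base) (le_earliest hc o o t)

theorem dist_nonneg (hc : N.StronglyConnected) (o d : V) (t : ℝ) : 0 ≤ N.dist o d t :=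
  sub_nonneg.2 (le_earliest hc o d t)

theorem dist_pos (hc : N.StronglyConnected) {o d : V} (h : o ≠ d) (t : ℝ) : 0 < N.dist o d t :=
  sub_pos.2 (lt_earliest hc h t)

theorem reach_trans {o x d : V} {t a b : ℝ} (h : N.forward.Reach N.arr o t x a)
    (h' : N.forward.Reach N.arr x a d b) : N.forward.Reach N.arr o t d b := by
  induction h' with
  | base => exact h
  | step _ hv ih => exact SearchGraph.Reach.step ih hv

theorem earliest_le_of_reach_of_earliest (hc : N.StronglyConnected) {o x : V} (d : V) {t a : ℝ}
    (h : N.forward.Reach N.arr o t x a) : N.earliest o d t ≤ N.earliest x d a :=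
  earliest_le_of_reach hc (reach_trans h (reach_earliest hc x d a))

theorem earliest_step (hc : N.StronglyConnected) (o : V) {u v : V} (h : v ∈ N.out u) (t : ℝ) :
    N.earliest o v t ≤ N.arr u v (N.earliest o u t) :=
  earliest_le_of_reach hc (SearchGraph.Reach.step (reach_earliest hc o u t) h)

/-- Bellman's equation. -/
theorem earliest_cases (hc : N.StronglyConnected) (o v : V) (t : ℝ) :
    v = o ∨ ∃ u, v ∈ N.out u ∧ N.earliest o v t = N.arr u v (N.earliest o u t) := by
  have h := reach_earliest hc o v t
  generalize hk : N.earliest o v t = k at h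
  cases h with
  | base => exact Or.inl rfl
  | @step u _ a ha hv =>
    refine Or.inr ⟨u, hv, le_antisymm ?_ (N.arr_mono hv (earliest_le_of_reach hc ha))⟩
    exact hk ▸ earliest_step hc o hv t

theorem reach_mono {o d : V} {t t' a : ℝ} (htt : t ≤ t') (h : N.forward.Reach N.arr o t' d a) :
    ∃ b ≤ a, N.forward.Reach N.arr o t d b := by
  induction h with
  | base => exact ⟨t, htt, SearchGraph.Reach.base⟩
  | @step u v a _ hv ih =>
    obtain ⟨b, hb, h⟩ := ih
    exact ⟨_, N.arr_mono hv hb, SearchGraph.Reach.step h hv⟩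

theorem earliest_mono (hc : N.StronglyConnected) (o d : V) : Monotone (N.earliest o d) := by
  intro t t' h
  obtain ⟨b, hb, h'⟩ := reach_mono h (reach_earliest hc o d t')
  exact (earliest_le_of_reach hc h').trans hb

theorem dist_triangle (hc : N.StronglyConnected) (o x d : V) (t : ℝ) :
    N.dist o d t ≤ N.dist o x t + N.dist x d (t + N.dist o x t) := by
  have := earliest_le_of_reach_of_earliest hc d (reach_earliest hc o x t)
  simp only [dist, add_sub_cancel]
  linarith

theorem reach_add_period {o d : V} {t a : ℝ} (h : N.forward.Reach N.arr o t d a) :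
    N.forward.Reach N.arr o (t + N.T) d (a + N.T) := by
  induction h with
  | base => exact SearchGraph.Reach.base
  | @step u v a _ hv ih =>
    rw [← N.arr_add_period hv]
    exact SearchGraph.Reach.step ih hv

theorem pathArr_add_period {o d : V} {p : List V} (hp : N.IsPath o p d) (t : ℝ) :
    N.pathArr o p (t + N.T) = N.pathArr o p t + N.T := by
  induction p generalizing o t with
  | nil => rfl
  | cons v p ih =>
    simp only [pathArr]
    rw [N.arr_add_period hp.1, ih hp.2]

theorem pathArr_mono {o d : V} {p : List V} (hp : N.IsPath o p d) : Monotone (N.pathArr o p) := by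
  induction p generalizing o with
  | nil => exact monotone_id
  | cons v p ih => exact fun a b hab => ih hp.2 (N.arr_mono hp.1 hab)

theorem dist_periodic (hc : N.StronglyConnected) (o d : V) :
    Function.Periodic (N.dist o d) N.T := by
  intro t
  have : N.earliest o d (t + N.T) = N.earliest o d t + N.T := by
    apply le_antisymm
    · exact earliest_le_of_reach hc (reach_add_period (reach_earliest hc o d t))
    · obtain ⟨p, hp, h⟩ := (isLeast_earliest hc o d (t + N.T)).1
      rw [h, pathArr_add_period hp]
      have := (isLeast_earliest hc o d t).2 ⟨p, hp, rfl⟩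
      linarith
  simp only [dist, this]
  ring

variable (N) in
theorem exists_modT (t : ℝ) :
    ∃ k : ℤ, t = N.modT t + k * N.T ∧ N.modT t ∈ Set.Ico 0 N.T := by
  have hm : N.modT t ∈ Set.Ico 0 (0 + N.T) := toIcoMod_mem_Ico N.T_pos 0 t
  rw [zero_add] at hm
  refine ⟨toIcoDiv N.T_pos 0 t, ?_, hm⟩
  have := toIcoMod_add_toIcoDiv_zsmul N.T_pos 0 t
  rw [zsmul_eq_mul] at this
  exact this.symm

theorem dist_modT (hc : N.StronglyConnected) (o d : V) (t : ℝ) :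
    N.dist o d (N.modT t) = N.dist o d t := by
  obtain ⟨k, hk, _⟩ := N.exists_modT t
  conv_rhs => rw [hk]
  exact ((dist_periodic hc o d).int_mul k _).symm

/-- The reverse search computes the latest departure times. -/
theorem le_reverseProbe_iff (hc : N.StronglyConnected) (l u : V) (s τ : ℝ) :
    s ≤ (N.reverseProbe u τ).val l ↔ N.earliest l u s ≤ τ := by
  obtain ⟨h1, h2⟩ := N.backward.search_spec (P := N.backward.Inv _ u (-τ))
    (fun s h hs => hs.settle N.backward_keyLaw h) ∅ u (-τ) SearchGraph.Inv.init
  have hq : (N.backward.search ∅ u (-τ)).val.1.queue = ∅ := by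
    rcases h2 with h | ⟨l, hl, _⟩
    · exact h.2.1
    · exact absurd hl (Finset.notMem_empty l)
  -- Each arc of a path that arrives in time becomes, by the adjunction, one backward relaxation.
  have key : ∀ (p : List V) (x : V) (s : ℝ), N.IsPath x p u → N.pathArr x p s ≤ τ →
      ∃ b ≤ -s, N.backward.Reach (fun v u a => -N.latest u v (-a)) u (-τ) x b := by
    intro p
    induction p with
    | nil =>
      intro x s hx h
      obtain rfl : x = u := hx
      exact ⟨-τ, neg_le_neg h, SearchGraph.Reach.base⟩
    | cons y p ih =>
      intro x s hx h
      obtain ⟨b, hb, hr⟩ := ih y _ hx.2 h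
      refine ⟨_, ?_, SearchGraph.Reach.step hr ((N.mem_backward_nbr).2 hx.1)⟩
      refine neg_le_neg ((N.le_latest_iff hx.1).2 ?_)
      linarith
  -- Conversely, a backward walk read in reverse is a path that still arrives by `τ`.
  have key' : ∀ (x : V) (b : ℝ),
      N.backward.Reach (fun v u a => -N.latest u v (-a)) u (-τ) x b →
        ∃ p, N.IsPath x p u ∧ N.pathArr x p (-b) ≤ τ := by
    intro x b h
    induction h with
    | base => exact ⟨[], rfl, by simp [pathArr]⟩
    | @step v x b _ hx ih =>
      obtain ⟨p, hp, h⟩ := ih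
      rw [mem_backward_nbr] at hx
      refine ⟨v :: p, ⟨hx, hp⟩, ?_⟩
      simp only [pathArr, neg_neg]
      refine le_trans ?_ h
      have hle := (N.le_latest_iff hx).1 (le_refl (N.latest x v (-b)))
      exact pathArr_mono hp hle
  -- Reachability regardless of time, needed only to see that `l` gets settled.
  have key'' : ∀ (p : List V) (x : V), N.IsPath x p u →
      ∃ b, N.backward.Reach (fun v u a => -N.latest u v (-a)) u (-τ) x b := by
    intro p
    induction p with
    | nil =>
      intro x hx
      obtain rfl : x = u := hx
      exact ⟨_, SearchGraph.Reach.base⟩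
    | cons y p ih =>
      intro x hx
      obtain ⟨b, hr⟩ := ih y hx.2
      exact ⟨_, SearchGraph.Reach.step hr ((N.mem_backward_nbr).2 hx.1)⟩
  have hset : l ∈ (N.backward.search ∅ u (-τ)).val.1.settled := by
    obtain ⟨p, hp⟩ := hc l u
    obtain ⟨b, hb⟩ := key'' p l hp
    rcases h1.dominated N.backward_keyLaw hb with h | ⟨x, hx, _⟩
    · exact h.1
    · rw [hq] at hx
      exact absurd hx (Finset.notMem_empty x)
  change s ≤ -_ ↔ _
  constructor
  · intro hs
    obtain ⟨p, hp, h⟩ := key' l _ (h1.reach l (Finset.mem_union_left _ hset))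
    refine (earliest_mono hc l u hs).trans (le_trans ?_ h)
    exact (isLeast_earliest hc l u _).2 ⟨p, hp, rfl⟩
  · intro hs
    obtain ⟨p, hp, h⟩ := (isLeast_earliest hc l u s).1
    obtain ⟨b, hb, hr⟩ := key p l s hp (h ▸ hs)
    have := h1.le_of_settled N.backward_keyLaw hset hr
    linarith

end TDNetwork

/-! ### Germs of piecewise affine functions and a local criterion for concavity -/

section

open Filter Topology

/-- The label `x` describes the function `f` in a neighbourhood of `t`: there `f` is affine on both
sides of `t`, with the slopes that the label records. -/
structure Label.Describes (x : Label) (f : ℝ → ℝ) (t : ℝ) : Prop where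
  key : f t = x.key
  left : ∀ᶠ s in 𝓝[<] t, f s = x.key + x.left * (s - t)
  right : ∀ᶠ s in 𝓝[>] t, f s = x.key + x.right * (s - t)

namespace Label.Describes

variable {x y : Label} {f g : ℝ → ℝ} {t : ℝ}

theorem congr (h : x.Describes f t) (hfg : f =ᶠ[𝓝 t] g) : x.Describes g t where
  key := hfg.self_of_nhds ▸ h.key
  left := by
    filter_upwards [h.left, hfg.filter_mono nhdsWithin_le_nhds] with s h1 h2
    rw [← h2, h1]
  right := by
    filter_upwards [h.right, hfg.filter_mono nhdsWithin_le_nhds] with s h1 h2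
    rw [← h2, h1]

theorem continuousAt (h : x.Describes f t) : ContinuousAt f t := by
  have aux : ∀ a : ℝ, Tendsto (fun s => x.key + a * (s - t)) (𝓝 t) (𝓝 (f t)) := by
    intro a
    have : Continuous fun s => x.key + a * (s - t) := by fun_prop
    have h' := this.tendsto t
    simpa [h.key] using h'
  rw [continuousAt_iff_continuous_left'_right']
  constructor
  · exact ((aux x.left).mono_left nhdsWithin_le_nhds).congr' (h.left.mono fun _ hs => hs.symm)
  · exact ((aux x.right).mono_left nhdsWithin_le_nhds).congr' (h.right.mono fun _ hs => hs.symm)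

theorem slopes_nonneg (h : x.Describes f t) (hf : Monotone f) : 0 ≤ x.left ∧ 0 ≤ x.right := by
  constructor
  · obtain ⟨s, hs, hst⟩ := (h.left.and self_mem_nhdsWithin).exists
    have hst : s < t := hst
    have := hf hst.le
    rw [hs, h.key] at this
    nlinarith
  · obtain ⟨s, hs, hst⟩ := (h.right.and self_mem_nhdsWithin).exists
    have hst : t < s := hst
    have := hf hst.le
    rw [hs, h.key] at this
    nlinarith

theorem of_id (t : ℝ) : (⟨t, 1, 1⟩ : Label).Describes (fun s => s) t where
  key := rfl
  left := Eventually.of_forall fun s => by ring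
  right := Eventually.of_forall fun s => by ring

/-- If the keys differ, continuity keeps the smaller function below nearby. If they agree, the
larger slope gives the smaller value left of `t` and the smaller slope does so right of `t`; hence
the maximum of the left and the minimum of the right slopes. -/
theorem merge (hx : x.Describes f t) (hy : y.Describes g t) :
    (x.merge y).Describes (fun s => min (f s) (g s)) t := by
  unfold Label.merge
  split_ifs with h1 h2
  · have : ∀ᶠ s in 𝓝 t, f s < g s :=
      hx.continuousAt.eventually_lt hy.continuousAt (by rw [hx.key, hy.key]; exact h1)
    exact hx.congr (this.mono fun s hs => (min_eq_left hs.le).symm)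
  · have : ∀ᶠ s in 𝓝 t, g s < f s :=
      hy.continuousAt.eventually_lt hx.continuousAt (by rw [hx.key, hy.key]; exact h2)
    exact hy.congr (this.mono fun s hs => (min_eq_right hs.le).symm)
  · have he : y.key = x.key := le_antisymm (not_lt.1 h1) (not_lt.1 h2)
    refine ⟨by simp [hx.key, hy.key, he], ?_, ?_⟩
    · filter_upwards [hx.left, hy.left, self_mem_nhdsWithin] with s h3 h4 (h5 : s < t)
      rw [h3, h4, he, min_add_add_left]
      congr 1
      have h6 : s - t ≤ 0 := sub_nonpos.2 h5.le
      rcases le_total x.left y.left with h | h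
      · rw [max_eq_right h, min_eq_right (mul_le_mul_of_nonpos_right h h6)]
      · rw [max_eq_left h, min_eq_left (mul_le_mul_of_nonpos_right h h6)]
    · filter_upwards [hx.right, hy.right, self_mem_nhdsWithin] with s h3 h4 (h5 : t < s)
      rw [h3, h4, he, min_add_add_left, min_mul_of_nonneg _ _ (sub_nonneg.2 h5.le)]

end Label.Describes

/-- A continuous function that is locally affine on both sides of every interior point, with
decreasing slopes, is above its chords. -/
theorem nonneg_of_local_slopes {g : ℝ → ℝ} {a b : ℝ} (hab : a ≤ b)
    (hg : ContinuousOn g (Set.Icc a b)) (ha : g a = 0) (hb : g b = 0)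
    (h : ∀ t ∈ Set.Ioo a b, ∃ x : Label, x.Describes g t ∧ x.right ≤ x.left) {t : ℝ}
    (ht : t ∈ Set.Icc a b) : 0 ≤ g t := by
  obtain ⟨c₀, hc₀, hmin⟩ := isCompact_Icc.exists_isMinOn (Set.nonempty_Icc.2 hab) hg
  by_contra! hneg
  have h0 : g c₀ < 0 := (hmin ht).trans_lt hneg
  -- Let `c` be the leftmost point where the negative minimum is attained; it is interior.
  -- Minimality makes the right slope at `c` non-negative, hence also the left slope, so `g` is
  -- minimal at a point left of `c` as well.
  have hZ : IsCompact (Set.Icc a b ∩ g ⁻¹' {g c₀}) :=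
    isCompact_Icc.of_isClosed_subset (hg.preimage_isClosed_of_isClosed isClosed_Icc
      isClosed_singleton) Set.inter_subset_left
  obtain ⟨c, ⟨hc, hgc⟩, hleast⟩ := hZ.exists_isLeast ⟨c₀, hc₀, rfl⟩
  have hgc : g c = g c₀ := hgc
  have hca : a < c := lt_of_le_of_ne hc.1 fun h => by rw [← h, ha] at hgc; linarith
  have hcb : c < b := lt_of_le_of_ne hc.2 fun h => by rw [h, hb] at hgc; linarith
  obtain ⟨x, hx, hle⟩ := h c ⟨hca, hcb⟩
  have hIoo : Set.Ioo a b ∈ 𝓝 c := Ioo_mem_nhds hca hcb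
  obtain ⟨s, ⟨h1, h2⟩, h3⟩ :=
    ((hx.right.and (mem_nhdsWithin_of_mem_nhds hIoo)).and self_mem_nhdsWithin).exists
  obtain ⟨s', ⟨h1', h2'⟩, h3'⟩ :=
    ((hx.left.and (mem_nhdsWithin_of_mem_nhds hIoo)).and self_mem_nhdsWithin).exists
  have h3 : c < s := h3
  have h3' : s' < c := h3'
  have h4 : g c₀ ≤ g s := hmin (Set.Ioo_subset_Icc_self h2)
  have h4' : g c₀ ≤ g s' := hmin (Set.Ioo_subset_Icc_self h2')
  have h5 : 0 ≤ x.right := by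
    by_contra! hneg
    have : x.right * (s - c) < 0 := mul_neg_of_neg_of_pos hneg (sub_pos.2 h3)
    rw [h1, ← hx.key] at h4
    linarith
  have h6 : x.left * (s' - c) ≤ 0 :=
    mul_nonpos_of_nonneg_of_nonpos (h5.trans hle) (sub_nonpos.2 h3'.le)
  rw [h1', ← hx.key] at h4'
  have h7 : g s' = g c₀ := by
    rw [h1', ← hx.key]
    linarith
  have := hleast ⟨Set.Ioo_subset_Icc_self h2', h7⟩
  linarith

/-- Subtracting the chord over `[a, b]` keeps the one-sided slopes ordered, so
`nonneg_of_local_slopes` puts the graph above every chord. -/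
theorem concaveOn_of_local_slopes {f : ℝ → ℝ} {x y : ℝ} (hf : ContinuousOn f (Set.Icc x y))
    (h : ∀ t ∈ Set.Ioo x y, ∃ z : Label, z.Describes f t ∧ z.right ≤ z.left) :
    ConcaveOn ℝ (Set.Icc x y) f := by
  apply concaveOn_of_slope_anti_adjacent (convex_Icc x y)
  intro a c b ha hb hac hcb
  have hab := hac.trans hcb
  set σ := (f b - f a) / (b - a) with hσ
  have hσ' : σ * (b - a) = f b - f a := div_mul_cancel₀ _ (sub_pos.2 hab).ne'
  have hsub : Set.Icc a b ⊆ Set.Icc x y := Set.Icc_subset_Icc ha.1 hb.2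
  have key := nonneg_of_local_slopes (g := fun s => f s - f a - σ * (s - a)) hab.le
    (((hf.mono hsub).sub continuousOn_const).sub (by fun_prop)) (by simp)
    (by simp only [hσ']; ring) (t := c) (by
      intro t ht
      obtain ⟨z, hz, hle⟩ := h t (Set.Ioo_subset_Ioo ha.1 hb.2 ht)
      refine ⟨⟨f t - f a - σ * (t - a), z.left - σ, z.right - σ⟩, ⟨rfl, ?_, ?_⟩, by
        simpa using hle⟩
      · filter_upwards [hz.left] with s hs
        simp only [hs, hz.key]
        ring
      · filter_upwards [hz.right] with s hs
        simp only [hs, hz.key]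
        ring) ⟨hac.le, hcb.le⟩
  rw [div_le_div_iff₀ (sub_pos.2 hcb) (sub_pos.2 hac)]
  have h1 : σ * (c - a) ≤ f c - f a := by linarith
  have h2 := mul_le_mul_of_nonneg_right h1 (sub_pos.2 hab).le
  have h3 : σ * (c - a) * (b - a) = (f b - f a) * (c - a) := by rw [← hσ']; ring
  rw [h3] at h2
  nlinarith

namespace TDNetwork

variable {V : Type*} [Fintype V] [DecidableEq V] {N : TDNetwork V}

/-! ### The arc-delay functions near a point -/

/-- `toIocMod` picks the first translate of a breakpoint after `t`; any `b` before all of these will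
do. -/
theorem exists_no_bp_right (N : TDNetwork V) (u v : V) (t : ℝ) :
    ∃ b > t, ∀ s ∈ Set.Ioo t b, ∀ p ∈ N.bp u v, ∀ k : ℤ, s ≠ p + k * N.T := by
  have h1 : ∀ᶠ b in 𝓝[>] t, ∀ p ∈ N.bp u v, b < toIocMod N.T_pos t p := by
    rw [Filter.eventually_all_finset]
    intro p _
    exact mem_nhdsWithin_of_mem_nhds (Iio_mem_nhds (toIocMod_mem_Ioc N.T_pos t p).1)
  obtain ⟨b, hb, htb⟩ := (h1.and self_mem_nhdsWithin).exists
  refine ⟨b, htb, ?_⟩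
  rintro s ⟨hs1, hs2⟩ p hp k rfl
  have h2 := hb p hp
  have h3 := toIocMod_mem_Ioc N.T_pos t p
  have h4 : toIocMod N.T_pos t p = p + k * N.T := by
    rw [toIocMod_eq_iff]
    refine ⟨⟨hs1, ?_⟩, -k, by simp⟩
    exact (hs2.trans h2).le.trans h3.2
  linarith

theorem exists_no_bp_left (N : TDNetwork V) (u v : V) (t : ℝ) :
    ∃ a < t, ∀ s ∈ Set.Ioo a t, ∀ p ∈ N.bp u v, ∀ k : ℤ, s ≠ p + k * N.T := by
  have h1 : ∀ᶠ a in 𝓝[<] t, ∀ p ∈ N.bp u v, toIcoMod N.T_pos (t - N.T) p < a := by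
    rw [Filter.eventually_all_finset]
    intro p _
    have := (toIcoMod_mem_Ico N.T_pos (t - N.T) p).2
    rw [sub_add_cancel] at this
    exact mem_nhdsWithin_of_mem_nhds (Ioi_mem_nhds this)
  obtain ⟨a, ha, hta⟩ := (h1.and self_mem_nhdsWithin).exists
  refine ⟨a, hta, ?_⟩
  rintro s ⟨hs1, hs2⟩ p hp k rfl
  have h2 := ha p hp
  have h3 := toIcoMod_mem_Ico N.T_pos (t - N.T) p
  have h4 : toIcoMod N.T_pos (t - N.T) p = p + k * N.T := by
    rw [toIcoMod_eq_iff]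
    refine ⟨⟨?_, by simpa using hs2⟩, -k, by simp⟩
    exact h3.1.trans (h2.trans hs1).le
  linarith

theorem leftSlope_of_affine {f : ℝ → ℝ} {a t m c : ℝ} (hat : a < t)
    (h : ∀ s ∈ Set.Icc a t, f s = m * s + c) : leftSlope f t = m := by
  have hd : HasDerivWithinAt (fun s => m * s + c) m (Set.Iio t) t := by
    simpa using (((hasDerivAt_id t).const_mul m).add_const c).hasDerivWithinAt
  refine (hd.congr_of_eventuallyEq ?_ (h t (Set.right_mem_Icc.2 hat.le))).derivWithin
    (uniqueDiffWithinAt_Iio t)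
  filter_upwards [Ioo_mem_nhdsLT hat] with s hs
  exact h s (Set.Ioo_subset_Icc_self hs)

theorem rightSlope_of_affine {f : ℝ → ℝ} {t b m c : ℝ} (htb : t < b)
    (h : ∀ s ∈ Set.Icc t b, f s = m * s + c) : rightSlope f t = m := by
  have hd : HasDerivWithinAt (fun s => m * s + c) m (Set.Ioi t) t := by
    simpa using (((hasDerivAt_id t).const_mul m).add_const c).hasDerivWithinAt
  refine (hd.congr_of_eventuallyEq ?_ (h t (Set.left_mem_Icc.2 htb.le))).derivWithin
    (uniqueDiffWithinAt_Ioi t)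
  filter_upwards [Ioo_mem_nhdsGT htb] with s hs
  exact h s (Set.Ioo_subset_Icc_self hs)

theorem arr_describes {u v : V} (h : v ∈ N.out u) (t : ℝ) :
    (⟨N.arr u v t, 1 + leftSlope (N.delay u v) t, 1 + rightSlope (N.delay u v) t⟩ :
      Label).Describes (N.arr u v) t := by
  refine ⟨rfl, ?_, ?_⟩
  · obtain ⟨a, hat, ha⟩ := exists_no_bp_left N u v t
    obtain ⟨m, c, hm⟩ := N.delay_affine u v h a t hat ha
    filter_upwards [Ioo_mem_nhdsLT hat] with s hs
    simp only [arr, leftSlope_of_affine hat hm, hm s (Set.Ioo_subset_Icc_self hs),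
      hm t (Set.right_mem_Icc.2 hat.le)]
    ring
  · obtain ⟨b, htb, hb⟩ := exists_no_bp_right N u v t
    obtain ⟨m, c, hm⟩ := N.delay_affine u v h t b htb hb
    filter_upwards [Ioo_mem_nhdsGT htb] with s hs
    simp only [arr, rightSlope_of_affine htb hm, hm s (Set.Ioo_subset_Icc_self hs),
      hm t (Set.left_mem_Icc.2 htb.le)]
    ring

/-- The slope of an arc-delay function changes at breakpoints only. -/
theorem slopes_eq_of_no_bp {u v : V} (h : v ∈ N.out u) {t : ℝ}
    (ht : ∀ p ∈ N.bp u v, ∀ k : ℤ, t ≠ p + k * N.T) :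
    rightSlope (N.delay u v) t = leftSlope (N.delay u v) t := by
  obtain ⟨a, hat, ha⟩ := exists_no_bp_left N u v t
  obtain ⟨b, htb, hb⟩ := exists_no_bp_right N u v t
  obtain ⟨m, c, hm⟩ := N.delay_affine u v h a b (hat.trans htb) (by
    intro s hs
    rcases lt_trichotomy s t with hst | rfl | hst
    · exact ha s ⟨hs.1, hst⟩
    · exact ht
    · exact hb s ⟨hst, hs.2⟩)
  rw [leftSlope_of_affine hat fun s hs => hm s ⟨hs.1, hs.2.trans htb.le⟩,
    rightSlope_of_affine htb fun s hs => hm s ⟨hat.le.trans hs.1, hs.2⟩]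

theorem leftSlope_add_period {u v : V} (h : v ∈ N.out u) (t : ℝ) (k : ℤ) :
    leftSlope (N.delay u v) (t + k * N.T) = leftSlope (N.delay u v) t := by
  have hper : ∀ s, N.delay u v (s - k * N.T) = N.delay u v s :=
    fun s => (N.delay_periodic u v h).sub_int_mul_eq k
  obtain ⟨a, hat, ha⟩ := exists_no_bp_left N u v t
  obtain ⟨m, c, hm⟩ := N.delay_affine u v h a t hat ha
  rw [leftSlope_of_affine hat hm]
  refine leftSlope_of_affine (a := a + k * N.T) (c := c - m * (k * N.T)) (by linarith) ?_
  intro s hs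
  rw [← hper, hm _ ⟨by linarith [hs.1], by linarith [hs.2]⟩]
  ring

theorem rightSlope_add_period {u v : V} (h : v ∈ N.out u) (t : ℝ) (k : ℤ) :
    rightSlope (N.delay u v) (t + k * N.T) = rightSlope (N.delay u v) t := by
  have hper : ∀ s, N.delay u v (s - k * N.T) = N.delay u v s :=
    fun s => (N.delay_periodic u v h).sub_int_mul_eq k
  obtain ⟨b, htb, hb⟩ := exists_no_bp_right N u v t
  obtain ⟨m, c, hm⟩ := N.delay_affine u v h t b htb hb
  rw [rightSlope_of_affine htb hm]
  refine rightSlope_of_affine (b := b + k * N.T) (c := c - m * (k * N.T)) (by linarith) ?_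
  intro s hs
  rw [← hper, hm _ ⟨by linarith [hs.1], by linarith [hs.2]⟩]
  ring

/-- Where the one-sided slope of `f` is positive, `f` approaches its value from the same side, and
the germ of the arc-arrival function on that side applies. Where the slope is zero, `f` is constant
on that side, and so is the composition. Monotonicity excludes negative slopes, which would exchange
the sides. -/
theorem relax_describes {u v : V} (h : v ∈ N.out u) {x : Label} {f : ℝ → ℝ} {t : ℝ}
    (hx : x.Describes f t) (hf : Monotone f) :
    (N.forward.relax u v x).Describes (fun s => N.arr u v (f s)) t := by
  have ha := arr_describes h x.key
  obtain ⟨hl, hr⟩ := hx.slopes_nonneg hf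
  have hcont : Tendsto f (𝓝 t) (𝓝 x.key) := hx.key ▸ hx.continuousAt
  refine ⟨by simp [forward, hx.key], ?_, ?_⟩
  · rcases hl.eq_or_lt with h0 | hpos
    · filter_upwards [hx.left] with s hs
      simp [forward, hs, ← h0]
    · have ht : Tendsto f (𝓝[<] t) (𝓝[<] x.key) := by
        refine tendsto_nhdsWithin_iff.2 ⟨hcont.mono_left nhdsWithin_le_nhds, ?_⟩
        filter_upwards [hx.left, self_mem_nhdsWithin] with s hs (hst : s < t)
        rw [hs]
        exact add_lt_of_neg_right _ (mul_neg_of_pos_of_neg hpos (sub_neg.2 hst))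
      filter_upwards [hx.left, ht.eventually ha.left] with s h1 h2
      simp only [forward]
      rw [h2, h1]
      ring
  · rcases hr.eq_or_lt with h0 | hpos
    · filter_upwards [hx.right] with s hs
      simp [forward, hs, ← h0]
    · have ht : Tendsto f (𝓝[>] t) (𝓝[>] x.key) := by
        refine tendsto_nhdsWithin_iff.2 ⟨hcont.mono_left nhdsWithin_le_nhds, ?_⟩
        filter_upwards [hx.right, self_mem_nhdsWithin] with s hs (hst : t < s)
        rw [hs]
        exact lt_add_of_pos_right _ (mul_pos hpos (sub_pos.2 hst))
      filter_upwards [hx.right, ht.eventually ha.right] with s h1 h2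
      simp only [forward]
      rw [h2, h1]
      ring

/-! ### The labels of a probe -/

/-- At the earliest arrival times for departure from `o` at time `t`, no slope of an arc-delay
function increases. -/
def NoSpoiling (N : TDNetwork V) (o : V) (t : ℝ) : Prop :=
  ∀ u v, v ∈ N.out u → rightSlope (N.delay u v) (N.earliest o u t) ≤
    leftSlope (N.delay u v) (N.earliest o u t)

/-- The invariant on the labels in a forward search. -/
structure LabelInv (N : TDNetwork V) (o : V) (t : ℝ) (s : SearchState V) : Prop where
  inv : N.forward.Inv N.arr o t s
  settled : ∀ v ∈ s.settled, (s.label v).Describes (N.earliest o v) t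
  queue : ∀ v ∈ s.queue, ∃ f, (s.label v).Describes f t ∧ (∀ τ, N.earliest o v τ ≤ f τ) ∧
    (∀ u ∈ s.settled, v ∈ N.out u → ∀ τ, f τ ≤ N.arr u v (N.earliest o u τ)) ∧
    (v = o → ∀ τ, f τ ≤ τ)
  slopes : NoSpoiling N o t → ∀ v ∈ s.settled ∪ s.queue, (s.label v).right ≤ (s.label v).left

theorem LabelInv.init (hc : N.StronglyConnected) (o : V) (t : ℝ) :
    LabelInv N o t ⟨∅, {o}, fun _ => ⟨t, 1, 1⟩⟩ where
  inv := SearchGraph.Inv.init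
  settled := by simp
  queue := by
    intro v hv
    obtain rfl : v = o := by simpa using hv
    exact ⟨fun s => s, Label.Describes.of_id t, fun τ => (earliest_self hc v τ).le, by simp,
      fun _ _ => le_rfl⟩
  slopes := by simp

/-- A queued label takes only settled predecessors into account. At time `t` an unsettled
predecessor `w` is reached no earlier than `u`, and its arc has positive delay; so the way via `w`
is strictly worse at `t` and, by continuity, near `t`. Locally Bellman's equation involves settled
predecessors only. -/
theorem LabelInv.minVertex_describes (hc : N.StronglyConnected)
    (hcont : ∀ o d, Continuous (N.earliest o d)) {o : V} {t : ℝ} {s : SearchState V}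
    (hs : LabelInv N o t s) (hq : s.queue.Nonempty) :
    (s.label (SearchGraph.minVertex s hq)).Describes
      (N.earliest o (SearchGraph.minVertex s hq)) t := by
  set u := SearchGraph.minVertex s hq with hu
  have huq : u ∈ s.queue := SearchGraph.minVertex_mem s hq
  have hus : u ∉ s.settled := fun h => Finset.disjoint_left.1 hs.inv.disj h huq
  have hkey : (s.label u).key = N.earliest o u t :=
    key_eq_earliest hc (hs.inv.reach u (Finset.mem_union_right _ huq))
      fun a ha => hs.inv.minVertex_le_reach N.forward_keyLaw hq hus ha
  obtain ⟨f, hf, hle, harc, hfo⟩ := hs.queue u huq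
  have hev : ∀ᶠ τ in 𝓝 t, ∀ w ∈ Finset.univ.filter fun w => w ∉ s.settled ∧ u ∈ N.out w,
      N.earliest o u τ < N.arr w u (N.earliest o w τ) := by
    rw [Filter.eventually_all_finset]
    intro w hw
    obtain ⟨hws, hwu⟩ := (Finset.mem_filter.1 hw).2
    refine (hcont o u).continuousAt.eventually_lt
      ((N.arr_continuous hwu).comp (hcont o w)).continuousAt ?_
    refine lt_of_le_of_lt ?_ (N.lt_arr hwu _)
    rw [← hkey]
    exact hs.inv.minVertex_le_reach N.forward_keyLaw hq hws (reach_earliest hc o w t)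
  refine hf.congr (hev.mono fun τ hτ => le_antisymm ?_ (hle τ))
  rcases earliest_cases hc o u τ with h | ⟨w, hwu, h⟩
  · exact (hfo h τ).trans (le_earliest hc o u τ)
  · by_cases hws : w ∈ s.settled
    · rw [h]
      exact harc w hws hwu τ
    · have := hτ w (by simp [hws, hwu])
      linarith

theorem Label.merge_slopes {x y : Label} (hx : x.right ≤ x.left) (hy : y.right ≤ y.left) :
    (x.merge y).right ≤ (x.merge y).left := by
  unfold Label.merge
  split_ifs
  · exact hx
  · exact hy
  · exact (min_le_left _ _).trans (hx.trans (le_max_left _ _))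

/-- Slopes are non-negative, so products of ordered slopes are ordered, and `merge` preserves the
order too. A vertex that newly enters the queue is not the source and has no settled predecessor
besides `u`, so its relaxed label is the whole minimum. -/
theorem LabelInv.settle (hc : N.StronglyConnected)
    (hcont : ∀ o d, Continuous (N.earliest o d)) {o : V} {t : ℝ} {s : SearchState V}
    (hs : LabelInv N o t s) (hq : s.queue.Nonempty) :
    LabelInv N o t (N.forward.settle s (SearchGraph.minVertex s hq)).val := by
  have hdesc := hs.minVertex_describes hc hcont hq
  have hinv := hs.inv.settle N.forward_keyLaw hq
  set u := SearchGraph.minVertex s hq with hu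
  have huq : u ∈ s.queue := SearchGraph.minVertex_mem s hq
  have hmono := earliest_mono hc o u
  have hrel : ∀ v ∈ N.out u, (N.forward.relax u v (s.label u)).Describes
      (fun τ => N.arr u v (N.earliest o u τ)) t := fun v hv => relax_describes hv hdesc hmono
  have hslope : NoSpoiling N o t → ∀ v ∈ N.out u,
      (N.forward.relax u v (s.label u)).right ≤ (N.forward.relax u v (s.label u)).left := by
    intro hns v hv
    obtain ⟨h1, h2⟩ := hdesc.slopes_nonneg hmono
    obtain ⟨h3, h4⟩ := (arr_describes hv (s.label u).key).slopes_nonneg (N.arr_mono hv)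
    have h5 := hns u v hv
    rw [hdesc.key] at h5
    exact mul_le_mul (hs.slopes hns u (Finset.mem_union_right _ huq)) (by linarith) h4 h1
  have hnew : ∀ v ∈ N.forward.nbr u \ insert u s.settled, v ∉ s.queue →
      v ≠ o ∧ ∀ w ∈ s.settled, v ∉ N.out w := by
    intro v hv hvq
    have hvs : v ∉ s.settled ∪ s.queue := by
      rw [Finset.mem_union, not_or]
      exact ⟨fun h => (Finset.mem_sdiff.1 hv).2 (Finset.mem_insert_of_mem h), hvq⟩
    refine ⟨fun h => hvs (h ▸ hs.inv.source), fun w hw h => hvs (hs.inv.arc w hw v h).1⟩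
  refine ⟨hinv, ?_, ?_, ?_⟩
  · intro v hv
    rw [SearchGraph.settle_settled] at hv
    rw [SearchGraph.settle_label_of_mem_settled _ _ hv]
    rcases Finset.mem_insert.1 hv with h | h
    · rw [h]
      exact hdesc
    · exact hs.settled v h
  · intro v hv
    by_cases hf : v ∈ N.forward.nbr u \ insert u s.settled
    · have hvu : v ∈ N.out u := (Finset.mem_sdiff.1 hf).1
      by_cases hvq : v ∈ s.queue
      · obtain ⟨f, h1, h2, h3, h4⟩ := hs.queue v hvq
        rw [SearchGraph.settle_label_of_mem_queue _ _ hf hvq]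
        refine ⟨_, h1.merge (hrel v hvu), ?_, ?_, ?_⟩
        · exact fun τ => le_min (h2 τ) (earliest_step hc o hvu τ)
        · intro w hw hvw τ
          rw [SearchGraph.settle_settled] at hw
          rcases Finset.mem_insert.1 hw with h | h
          · rw [h]
            exact min_le_right _ _
          · exact (min_le_left _ _).trans (h3 w h hvw τ)
        · exact fun h τ => (min_le_left _ _).trans (h4 h τ)
      · obtain ⟨h1, h2⟩ := hnew v hf hvq
        rw [SearchGraph.settle_label_of_not_mem_queue _ _ hf hvq]
        refine ⟨_, hrel v hvu, fun τ => earliest_step hc o hvu τ, ?_, fun h => absurd h h1⟩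
        intro w hw hvw τ
        rw [SearchGraph.settle_settled] at hw
        rcases Finset.mem_insert.1 hw with h | h
        · rw [h]
        · exact absurd hvw (h2 w h)
    · rw [SearchGraph.settle_label_of_not_fresh _ _ hf]
      rcases (SearchGraph.mem_settle_queue _).1 hv with ⟨h, hvq⟩ | h
      · obtain ⟨f, h1, h2, h3, h4⟩ := hs.queue v hvq
        refine ⟨f, h1, h2, ?_, h4⟩
        intro w hw hvw τ
        rw [SearchGraph.settle_settled] at hw
        rcases Finset.mem_insert.1 hw with hwu | hw
        · exfalso
          apply hf
          rw [Finset.mem_sdiff, Finset.mem_insert, not_or]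
          exact ⟨hwu ▸ hvw, h, fun h' => Finset.disjoint_left.1 hs.inv.disj h' hvq⟩
        · exact h3 w hw hvw τ
      · exact absurd (Finset.mem_sdiff.2 h) hf
  · intro hns v hv
    by_cases hf : v ∈ N.forward.nbr u \ insert u s.settled
    · have hvu : v ∈ N.out u := (Finset.mem_sdiff.1 hf).1
      by_cases hvq : v ∈ s.queue
      · rw [SearchGraph.settle_label_of_mem_queue _ _ hf hvq]
        exact Label.merge_slopes (hs.slopes hns v (Finset.mem_union_right _ hvq))
          (hslope hns v hvu)
      · rw [SearchGraph.settle_label_of_not_mem_queue _ _ hf hvq]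
        exact hslope hns v hvu
    · rw [SearchGraph.settle_label_of_not_fresh _ _ hf]
      apply hs.slopes hns
      rcases Finset.mem_union.1 hv with h | h
      · rw [SearchGraph.settle_settled] at h
        rcases Finset.mem_insert.1 h with h | h
        · exact Finset.mem_union_right _ (h ▸ huq)
        · exact Finset.mem_union_left _ h
      · rcases (SearchGraph.mem_settle_queue _).1 h with ⟨_, h⟩ | h
        · exact Finset.mem_union_right _ h
        · exact absurd (Finset.mem_sdiff.2 h) hf

/-- The labels of a probe describe the earliest arrival times. -/
theorem probe_describes (hc : N.StronglyConnected) (hcont : ∀ o d, Continuous (N.earliest o d))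
    (o v : V) (t : ℝ) : ((N.probe o t).val v).Describes (N.earliest o v) t ∧
      (NoSpoiling N o t → ((N.probe o t).val v).right ≤ ((N.probe o t).val v).left) := by
  have h1 := (N.forward.search_spec (P := LabelInv N o t)
    (fun s h hs => hs.settle hc hcont h) ∅ o t (LabelInv.init hc o t)).1
  have h2 := (forward_search_spec hc o t).2 v
  exact ⟨h1.settled v h2, fun h => h1.slopes h v (Finset.mem_union_left _ h2)⟩

/-! ### Consequences of bounded slopes -/

variable {lmin lmax : ℝ}

theorem BoundedSlopes.dist_sub_le (h : N.BoundedSlopes lmin lmax) (o d : V) {t t' : ℝ}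
    (htt : t ≤ t') : -lmin * (t' - t) ≤ N.dist o d t' - N.dist o d t ∧
      N.dist o d t' - N.dist o d t ≤ lmax * (t' - t) := by
  rcases htt.eq_or_lt with rfl | hlt
  · simp
  · obtain ⟨h1, h2⟩ := h o d t t' hlt
    have hneg : t - t' < 0 := sub_neg.2 hlt
    rw [le_div_iff_of_neg hneg] at h1
    rw [div_le_iff_of_neg hneg] at h2
    constructor <;> linarith

theorem BoundedSlopes.dist_continuous (h : N.BoundedSlopes lmin lmax) (o d : V) :
    Continuous (N.dist o d) := by
  set K : ℝ := |lmin| + |lmax|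
  have hK : 0 ≤ K := by positivity
  have key : ∀ t t', t ≤ t' → |N.dist o d t - N.dist o d t'| ≤ K * |t - t'| := by
    intro t t' htt
    obtain ⟨h1, h2⟩ := h.dist_sub_le o d htt
    have h3 : 0 ≤ t' - t := sub_nonneg.2 htt
    rw [abs_sub_comm, abs_sub_comm t, abs_of_nonneg h3, abs_le]
    have h4 : lmin * (t' - t) ≤ |lmin| * (t' - t) :=
      mul_le_mul_of_nonneg_right (le_abs_self _) h3
    have h5 : lmax * (t' - t) ≤ |lmax| * (t' - t) :=
      mul_le_mul_of_nonneg_right (le_abs_self _) h3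
    have h6 : 0 ≤ |lmin| * (t' - t) := by positivity
    have h7 : 0 ≤ |lmax| * (t' - t) := by positivity
    constructor <;> nlinarith
  have : LipschitzWith ⟨K, hK⟩ (N.dist o d) := by
    refine LipschitzWith.of_dist_le_mul fun t t' => ?_
    rw [Real.dist_eq, Real.dist_eq]
    rcases le_total t t' with htt | htt
    · exact key t t' htt
    · rw [abs_sub_comm, abs_sub_comm t]
      exact key t' t htt
  exact this.continuous

theorem BoundedSlopes.earliest_continuous (h : N.BoundedSlopes lmin lmax) (o d : V) :
    Continuous (N.earliest o d) := by
  have : N.earliest o d = fun t => N.dist o d t + t := by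
    funext t
    simp [dist]
  rw [this]
  exact (h.dist_continuous o d).add continuous_id

/-- The reason for requiring `lmin < 1`: each arrival time then belongs to at most one departure
time. -/
theorem BoundedSlopes.earliest_strictMono (h : N.BoundedSlopes lmin lmax) (hl : lmin < 1)
    (o d : V) : StrictMono (N.earliest o d) := by
  intro t t' htt
  have h1 := (h.dist_sub_le o d htt.le).1
  simp only [dist] at h1
  nlinarith

/-- Between the images of the concavity-spoiling breakpoints no slope increases. -/
theorem noSpoiling_of_not_mem_images (hc : N.StronglyConnected)
    (h : N.BoundedSlopes lmin lmax) (hl : lmin < 1) {o : V} {t : ℝ} (ht : t ∈ Set.Ioo 0 N.T)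
    (hi : t ∉ N.images o) : NoSpoiling N o t := by
  intro u v huv
  set τ := N.earliest o u t with hτ
  by_contra! hlt
  apply hi
  by_cases hbp : ∃ p ∈ N.bp u v, ∃ k : ℤ, τ = p + k * N.T
  · obtain ⟨p, hp, k, hk⟩ := hbp
    rw [hk, leftSlope_add_period huv, rightSlope_add_period huv] at hlt
    have hmem : ((u, v), p) ∈ N.spoiling := by
      simp only [spoiling, Finset.mem_biUnion, Finset.mem_univ, true_and, Finset.mem_image,
        Finset.mem_filter]
      exact ⟨u, v, huv, p, ⟨hp, hlt⟩, rfl⟩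
    -- By periodicity a departure at `t - k T` arrives exactly at `p`; by strict monotonicity no
    -- later departure does.
    have hz : (N.reverseProbe u p).val o = t - k * N.T := by
      have hE : N.earliest o u (t - k * N.T) = p := by
        have h1 : N.dist o u (t - k * N.T) = N.dist o u t :=
          (dist_periodic hc o u).sub_int_mul_eq k
        simp only [dist] at h1
        linarith
      apply le_antisymm
      · rw [← (h.earliest_strictMono hl o u).le_iff_le, hE]
        exact (le_reverseProbe_iff hc o u _ p).1 le_rfl
      · exact (le_reverseProbe_iff hc o u _ p).2 hE.le
    refine Finset.mem_image.2 ⟨_, hmem, ?_⟩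
    simp only [hz, modT]
    rw [toIcoMod_eq_iff]
    refine ⟨by simpa using Set.Ioo_subset_Ico_self ht, -k, by simp; ring⟩
  · push Not at hbp
    exact absurd (slopes_eq_of_no_bp huv hbp) hlt.ne'

/-- On an interval whose interior contains no image, the travel times are concave. -/
theorem dist_concaveOn (hc : N.StronglyConnected)
    (h : N.BoundedSlopes lmin lmax) (hl : lmin < 1) {o : V} {x y : ℝ}
    (hxy : Set.Ioo x y ⊆ Set.Ioo 0 N.T \ ↑(N.images o)) (v : V) :
    ConcaveOn ℝ (Set.Icc x y) (N.dist o v) := by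
  refine concaveOn_of_local_slopes (h.dist_continuous o v).continuousOn fun t ht => ?_
  obtain ⟨h1, h2⟩ := probe_describes hc h.earliest_continuous o v t
  have h3 := h2 (noSpoiling_of_not_mem_images hc h hl (hxy ht).1
    fun hm => (hxy ht).2 (Finset.mem_coe.2 hm))
  set z := (N.probe o t).val v
  refine ⟨⟨z.key - t, z.left - 1, z.right - 1⟩, ⟨?_, ?_, ?_⟩, by simpa using h3⟩
  · simp [dist, h1.key]
  · filter_upwards [h1.left] with s hs
    simp only [dist, hs]
    ring
  · filter_upwards [h1.right] with s hs
    simp only [dist, hs]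
    ring

end TDNetwork

end

section

open Filter Topology

/-! ### Upper approximations of concave functions -/

/-- The breakpoints `pts`, followed by one at `y`, interpolate a `(1 + ε)`-approximation from above
of `f` on `[x, y]`. -/
structure IsUpperApprox (f : ℝ → ℝ) (ε x y : ℝ) (pts : List (ℝ × ℝ)) : Prop where
  lt : x < y
  head : ∃ tail, pts = (x, f x) :: tail
  bounds : ∀ rest, ∀ t ∈ Set.Icc x y, f t ≤ interpolate (pts ++ (y, f y) :: rest) t ∧
    interpolate (pts ++ (y, f y) :: rest) t ≤ (1 + ε) * f t
  skip : ∀ rest, ∀ t, y < t →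
    interpolate (pts ++ (y, f y) :: rest) t = interpolate ((y, f y) :: rest) t

/-- The head of `q` serves as the closing breakpoint `(y, f y)` of `p`; this is why `IsUpperApprox`
quantifies over every continuation `rest`. -/
theorem IsUpperApprox.append {f : ℝ → ℝ} {ε x y z : ℝ} {p q : List (ℝ × ℝ)}
    (hp : IsUpperApprox f ε x y p) (hq : IsUpperApprox f ε y z q) :
    IsUpperApprox f ε x z (p ++ q) := by
  obtain ⟨tp, htp⟩ := hp.head
  obtain ⟨tq, htq⟩ := hq.head
  have hre : ∀ rest, p ++ q ++ (z, f z) :: rest = p ++ (y, f y) :: (tq ++ (z, f z) :: rest) := by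
    intro rest
    simp [htq]
  have hre' : ∀ rest, (y, f y) :: (tq ++ (z, f z) :: rest) = q ++ (z, f z) :: rest := by
    intro rest
    simp [htq]
  refine ⟨hp.lt.trans hq.lt, ⟨tp ++ q, by simp [htp]⟩, ?_, ?_⟩
  · intro rest t ht
    rw [hre]
    rcases le_or_gt t y with h | h
    · exact hp.bounds _ t ⟨ht.1, h⟩
    · rw [hp.skip _ t h, hre']
      exact hq.bounds rest t ⟨h.le, ht.2⟩
  · intro rest t ht
    rw [hre, hp.skip _ t (hq.lt.trans ht), hre', hq.skip rest t ht]

/-- `a b ≤ (a + b) ^ 2` for reals of any sign, applied to `m - x` and `y - m`. No concavity is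
assumed, so `m` may lie outside the interval. -/
theorem Ends.mae_le {e : Ends} (h : e.x < e.y) :
    e.mae ≤ max 0 ((e.sx - e.sy) * (e.y - e.x)) := by
  unfold mae
  split_ifs with hs
  · refine le_max_of_le_right (mul_le_mul_of_nonneg_left ?_ (sub_pos.2 hs).le)
    rw [div_le_iff₀ (sub_pos.2 h)]
    nlinarith [sq_nonneg (e.m - e.x), sq_nonneg (e.y - e.m)]
  · exact le_max_left _ _

/-- The data `e` describes `f` at the ends of an interval on which `f` is concave. -/
structure Ends.Describes (e : Ends) (f : ℝ → ℝ) : Prop where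
  lt : e.x < e.y
  dx : e.dx = f e.x
  dy : e.dy = f e.y
  right : ∀ᶠ s in 𝓝[>] e.x, f s = e.dx + e.sx * (s - e.x)
  left : ∀ᶠ s in 𝓝[<] e.y, f s = e.dy + e.sy * (s - e.y)
  concave : ConcaveOn ℝ (Set.Icc e.x e.y) f

namespace Ends.Describes

variable {e : Ends} {f : ℝ → ℝ}

theorem le_tangent_left (h : e.Describes f) {s : ℝ} (hs : s ∈ Set.Icc e.x e.y) :
    f s ≤ e.dx + e.sx * (s - e.x) := by
  rcases hs.1.eq_or_lt with rfl | hlt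
  · simp [h.dx]
  · obtain ⟨z, hz, hzx, hzs⟩ := (h.right.and (Ioo_mem_nhdsGT hlt)).exists
    have := h.concave.slope_anti_adjacent (Set.left_mem_Icc.2 h.lt.le) hs hzx hzs
    rw [div_le_div_iff₀ (sub_pos.2 hzs) (sub_pos.2 hzx), hz, h.dx] at this
    rw [h.dx]
    have h1 : 0 < z - e.x := sub_pos.2 hzx
    have h2 : (f s - (f e.x + e.sx * (s - e.x))) * (z - e.x) ≤ 0 := by nlinarith
    by_contra! hneg
    nlinarith

theorem le_tangent_right (h : e.Describes f) {s : ℝ} (hs : s ∈ Set.Icc e.x e.y) :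
    f s ≤ e.dy + e.sy * (s - e.y) := by
  rcases hs.2.eq_or_lt with rfl | hlt
  · simp [h.dy]
  · obtain ⟨z, hz, hzs, hzy⟩ := (h.left.and (Ioo_mem_nhdsLT hlt)).exists
    have := h.concave.slope_anti_adjacent hs (Set.right_mem_Icc.2 h.lt.le) hzs hzy
    rw [div_le_div_iff₀ (sub_pos.2 hzy) (sub_pos.2 hzs), hz, h.dy] at this
    rw [h.dy]
    have h1 : 0 < e.y - z := sub_pos.2 hzy
    have h2 : (f s - (f e.y + e.sy * (s - e.y))) * (e.y - z) ≤ 0 := by nlinarith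
    by_contra! hneg
    nlinarith

theorem m_spec (h : e.sy < e.sx) :
    (e.sx - e.sy) * e.m = e.dy - e.dx + e.x * e.sx - e.y * e.sy :=
  mul_div_cancel₀ _ (sub_pos.2 h).ne'

/-- Just right of `x` the function coincides with the left tangent and lies below the right one. As
the left tangent is the steeper one, the two can only meet there or later; symmetrically at `y`. -/
theorem m_mem (h : e.Describes f) (hs : e.sy < e.sx) : e.x < e.m ∧ e.m < e.y := by
  have hm := m_spec hs
  have hpos : 0 < e.sx - e.sy := sub_pos.2 hs
  constructor
  · obtain ⟨s, hs1, hsx, hsy⟩ := (h.right.and (Ioo_mem_nhdsGT h.lt)).exists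
    have h1 := h.le_tangent_right (s := s) ⟨hsx.le, hsy.le⟩
    have h2 : 0 < (e.sx - e.sy) * (s - e.x) := mul_pos hpos (sub_pos.2 hsx)
    have h3 : 0 < (e.sx - e.sy) * (e.m - e.x) := by rw [mul_sub, hm]; nlinarith
    exact sub_pos.1 (pos_of_mul_pos_right h3 hpos.le)
  · obtain ⟨s, hs1, hsx, hsy⟩ := (h.left.and (Ioo_mem_nhdsLT h.lt)).exists
    have h1 := h.le_tangent_left (s := s) ⟨hsx.le, hsy.le⟩
    have h2 : 0 < (e.sx - e.sy) * (e.y - s) := mul_pos hpos (sub_pos.2 hsy)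
    have h3 : 0 < (e.sx - e.sy) * (e.y - e.m) := by rw [mul_sub, hm]; nlinarith
    exact sub_pos.1 (pos_of_mul_pos_right h3 hpos.le)

/-- The chord is below the function. -/
theorem chord_le (h : e.Describes f) {s : ℝ} (hs : s ∈ Set.Icc e.x e.y) :
    e.dx + (e.dy - e.dx) / (e.y - e.x) * (s - e.x) ≤ f s := by
  have hpos : 0 < e.y - e.x := sub_pos.2 h.lt
  have h1 : 0 ≤ (e.y - s) / (e.y - e.x) := div_nonneg (sub_nonneg.2 hs.2) hpos.le
  have h2 : 0 ≤ (s - e.x) / (e.y - e.x) := div_nonneg (sub_nonneg.2 hs.1) hpos.le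
  have h3 : (e.y - s) / (e.y - e.x) + (s - e.x) / (e.y - e.x) = 1 := by
    field_simp
    ring
  have h4 := h.concave.2 (Set.left_mem_Icc.2 h.lt.le) (Set.right_mem_Icc.2 h.lt.le) h1 h2 h3
  have h5 : (e.y - s) / (e.y - e.x) * e.x + (s - e.x) / (e.y - e.x) * e.y = s := by
    field_simp
    ring
  simp only [smul_eq_mul] at h4
  rw [h5, ← h.dx, ← h.dy] at h4
  refine le_trans (le_of_eq ?_) h4
  field_simp
  ring

theorem min_le (h : e.Describes f) {s : ℝ} (hs : s ∈ Set.Icc e.x e.y) :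
    min e.dx e.dy ≤ f s := by
  rw [h.dx, h.dy]
  exact h.concave.min_le_of_mem_Icc (Set.left_mem_Icc.2 h.lt.le) (Set.right_mem_Icc.2 h.lt.le) hs

/-- If the desired error has been reached, then the tangents or the chord give a
`(1 + ε)`-approximation. -/
theorem isUpperApprox (h : e.Describes f) {ε : ℝ} (hε : 0 ≤ ε) (hf : ∀ s, 0 ≤ f s)
    (ha : ¬ e.Active ε) : IsUpperApprox f ε e.x e.y e.points := by
  have hpos : 0 < e.y - e.x := sub_pos.2 h.lt
  have hchord : ∀ s ∈ Set.Icc e.x e.y,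
      e.dx + (e.dy - e.dx) / (e.y - e.x) * (s - e.x) ≤ f s := fun s hs => h.chord_le hs
  set σ := (e.dy - e.dx) / (e.y - e.x) with hσ
  have hσ' : σ * (e.y - e.x) = e.dy - e.dx := div_mul_cancel₀ _ hpos.ne'
  by_cases hs : e.sy < e.sx
  · obtain ⟨hxm, hmy⟩ := h.m_mem hs
    have hm := m_spec hs
    have hp : e.points = [(e.x, f e.x), (e.m, e.um)] := by simp [points, hs, h.dx]
    have hum : e.um = e.dy + e.sy * (e.m - e.y) := by
      unfold um
      linarith
    have hmae : e.mae ≤ ε * min e.dx e.dy := not_lt.1 ha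
    have hmae' : e.mae * (e.y - e.x) = (e.sx - e.sy) * ((e.m - e.x) * (e.y - e.m)) := by
      unfold mae
      rw [if_pos hs, mul_assoc, div_mul_cancel₀ _ hpos.ne']
    have h1 : (e.sx - σ) * (e.y - e.x) = (e.sx - e.sy) * (e.y - e.m) := by
      rw [sub_mul, hσ', mul_sub (e.sx - e.sy), hm]
      ring
    have h2 : (σ - e.sy) * (e.y - e.x) = (e.sx - e.sy) * (e.m - e.x) := by
      rw [sub_mul, hσ', mul_sub (e.sx - e.sy), hm]
      ring
    -- Both tangents exceed the chord at `m` by exactly `mae`; on either side of `m` the excess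
    -- decreases linearly to zero at the end.
    have h3 : (e.sx - σ) * (e.m - e.x) = e.mae := by
      apply mul_right_cancel₀ hpos.ne'
      rw [hmae']
      linear_combination (e.m - e.x) * h1
    have h4 : (σ - e.sy) * (e.y - e.m) = e.mae := by
      apply mul_right_cancel₀ hpos.ne'
      rw [hmae']
      linear_combination (e.y - e.m) * h2
    have h5 : 0 ≤ e.sx - σ := by
      refine nonneg_of_mul_nonneg_left ?_ hpos
      rw [h1]
      exact mul_nonneg (sub_pos.2 hs).le (sub_pos.2 hmy).le
    have h6 : 0 ≤ σ - e.sy := by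
      refine nonneg_of_mul_nonneg_left ?_ hpos
      rw [h2]
      exact mul_nonneg (sub_pos.2 hs).le (sub_pos.2 hxm).le
    -- A concave function is at least the smaller of its end values, so a threshold in terms of the
    -- ends bounds the relative error everywhere.
    have herr : ∀ s ∈ Set.Icc e.x e.y, e.mae ≤ ε * f s := fun s hs =>
      hmae.trans (mul_le_mul_of_nonneg_left (h.min_le hs) hε)
    have hev1 : ∀ s, f e.x + (e.um - f e.x) / (e.m - e.x) * (s - e.x) =
        e.dx + e.sx * (s - e.x) := by
      intro s
      have : e.um - f e.x = e.sx * (e.m - e.x) := by rw [← h.dx]; unfold um; ring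
      rw [this, mul_div_cancel_right₀ _ (sub_pos.2 hxm).ne', h.dx]
    have hev2 : ∀ s, e.um + (f e.y - e.um) / (e.y - e.m) * (s - e.m) =
        e.dy + e.sy * (s - e.y) := by
      intro s
      have : f e.y - e.um = e.sy * (e.y - e.m) := by rw [← h.dy, hum]; ring
      rw [this, mul_div_cancel_right₀ _ (sub_pos.2 hmy).ne', hum]
      ring
    refine ⟨h.lt, ⟨_, hp⟩, ?_, ?_⟩
    · intro rest t ht
      rw [hp]
      have hc := hchord t ht
      have he := herr t ht
      simp only [List.cons_append, List.nil_append, interpolate]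
      split_ifs with htm hty
      · rw [hev1]
        refine ⟨h.le_tangent_left ht, ?_⟩
        have : (e.sx - σ) * (t - e.x) ≤ (e.sx - σ) * (e.m - e.x) :=
          mul_le_mul_of_nonneg_left (by linarith) h5
        nlinarith
      · rw [hev2]
        refine ⟨h.le_tangent_right ht, ?_⟩
        have : (σ - e.sy) * (e.y - t) ≤ (σ - e.sy) * (e.y - e.m) :=
          mul_le_mul_of_nonneg_left (by linarith) h6
        nlinarith
      · exact absurd ht.2 hty
    · intro rest t ht
      rw [hp]
      simp only [List.cons_append, List.nil_append, interpolate]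
      rw [if_neg (by linarith), if_neg (by linarith)]
  · have hp : e.points = [(e.x, f e.x)] := by simp [points, hs, h.dx]
    have h1 := h.le_tangent_left (Set.right_mem_Icc.2 h.lt.le)
    have h2 := h.le_tangent_right (Set.left_mem_Icc.2 h.lt.le)
    rw [← h.dy] at h1
    rw [← h.dx] at h2
    -- Here `sx ≤ sy ≤ σ`, so the left tangent lies below the chord; `f`, below the tangent and
    -- above the chord, is the chord itself.
    have h3 : e.sx ≤ σ := by
      refine le_of_mul_le_mul_right ?_ hpos
      rw [hσ']
      nlinarith
    refine ⟨h.lt, ⟨_, hp⟩, ?_, ?_⟩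
    · intro rest t ht
      rw [hp]
      simp only [List.cons_append, List.nil_append, interpolate]
      rw [if_pos ht.2, ← h.dx, ← h.dy]
      have h4 := hchord t ht
      have h5 := h.le_tangent_left ht
      have h6 : e.sx * (t - e.x) ≤ σ * (t - e.x) :=
        mul_le_mul_of_nonneg_right h3 (sub_nonneg.2 ht.1)
      refine ⟨by linarith, h4.trans ?_⟩
      have := mul_nonneg hε (hf t)
      linarith
    · intro rest t ht
      rw [hp]
      simp only [List.cons_append, List.nil_append, interpolate]
      rw [if_neg (by linarith)]

end Ends.Describes

/-! ### Consecutive elements of sorted lists -/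

theorem List.mem_zip_tail_of_pairwise {c : List ℝ} (hc : c.Pairwise (· < ·)) {p q : ℝ}
    (h : (p, q) ∈ c.zip c.tail) :
    p < q ∧ p ∈ c ∧ q ∈ c ∧ ∀ z ∈ c, ¬ (p < z ∧ z < q) := by
  induction c with
  | nil => simp at h
  | cons a l ih =>
    cases l with
    | nil => simp at h
    | cons b l =>
      rw [List.pairwise_cons] at hc
      have hbl := (List.pairwise_cons.1 hc.2).1
      simp only [List.tail_cons, List.zip_cons_cons, List.mem_cons, Prod.mk.injEq] at h
      rcases h with ⟨rfl, rfl⟩ | h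
      · refine ⟨hc.1 _ (by simp), by simp, by simp, ?_⟩
        intro z hz ⟨h1, h2⟩
        rcases List.mem_cons.1 hz with rfl | hz
        · exact lt_irrefl _ h1
        · rcases List.mem_cons.1 hz with rfl | hz
          · exact lt_irrefl _ h2
          · exact lt_asymm h2 (hbl z hz)
      · obtain ⟨h1, h2, h3, h4⟩ := ih hc.2 h
        refine ⟨h1, List.mem_cons_of_mem _ h2, List.mem_cons_of_mem _ h3, ?_⟩
        intro z hz ⟨h5, h6⟩
        rcases List.mem_cons.1 hz with rfl | hz
        · exact lt_asymm h5 (hc.1 p h2)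
        · exact h4 z hz ⟨h5, h6⟩

theorem IsUpperApprox.flatten {f : ℝ → ℝ} {ε : ℝ} (g : ℝ × ℝ → List (ℝ × ℝ)) {a b : ℝ}
    {l : List ℝ} (hc : (a :: l).Pairwise (· < ·)) (hb : b ∈ l) (hmax : ∀ z ∈ l, z ≤ b)
    (h : ∀ I ∈ (a :: l).zip l, IsUpperApprox f ε I.1 I.2 (g I)) :
    IsUpperApprox f ε a b (((a :: l).zip l).map g).flatten := by
  induction l generalizing a with
  | nil => simp at hb
  | cons a' l ih =>
    rw [List.pairwise_cons] at hc
    have ha' := (List.pairwise_cons.1 hc.2).1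
    have h0 := h (a, a') (by simp)
    cases l with
    | nil =>
      obtain rfl : b = a' := by simpa using hb
      simpa using h0
    | cons a'' l =>
      have hb' : b ∈ a'' :: l := by
        rcases List.mem_cons.1 hb with rfl | hb
        · exact absurd (hmax a'' (by simp)) (not_le.2 (ha' a'' (by simp)))
        · exact hb
      have := ih hc.2 hb' (fun z hz => hmax z (List.mem_cons_of_mem _ hz))
        (fun I hI => h I (by rw [List.zip_cons_cons]; exact List.mem_cons_of_mem _ hI))
      rw [List.zip_cons_cons, List.map_cons, List.flatten_cons]
      exact h0.append this

namespace TDNetwork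

variable {V : Type*} [Fintype V] [DecidableEq V] {N : TDNetwork V} {lmin lmax : ℝ}

theorem ends_describes (hc : N.StronglyConnected) (hb : N.BoundedSlopes lmin lmax) {l v : V}
    {x y : ℝ} (hxy : x < y) (hconc : ConcaveOn ℝ (Set.Icc x y) (N.dist l v)) :
    (ends x y ((N.probe l x).val v) ((N.probe l y).val v)).Describes (N.dist l v) := by
  have hx := (probe_describes hc hb.earliest_continuous l v x).1
  have hy := (probe_describes hc hb.earliest_continuous l v y).1
  refine ⟨hxy, ?_, ?_, ?_, ?_, hconc⟩
  · simp [ends, dist, hx.key]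
  · simp [ends, dist, hy.key]
  · filter_upwards [hx.right] with s hs
    simp only [ends, dist, hs]
    ring
  · filter_upwards [hy.left] with s hs
    simp only [ends, dist, hs]
    ring

theorem ends_slopes (hc : N.StronglyConnected) (hb : N.BoundedSlopes lmin lmax) (l v : V)
    (x y : ℝ) :
    (ends x y ((N.probe l x).val v) ((N.probe l y).val v)).sx ≤ lmax ∧
      -lmin ≤ (ends x y ((N.probe l x).val v) ((N.probe l y).val v)).sy := by
  have hx := (probe_describes hc hb.earliest_continuous l v x).1
  have hy := (probe_describes hc hb.earliest_continuous l v y).1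
  constructor
  · obtain ⟨s, hs, hlt⟩ := (hx.right.and self_mem_nhdsWithin).exists
    have hlt : x < s := hlt
    have h1 := (hb.dist_sub_le l v hlt.le).2
    simp only [dist, hs, hx.key] at h1
    simp only [ends]
    refine le_of_mul_le_mul_right ?_ (sub_pos.2 hlt)
    linarith
  · obtain ⟨s, hs, hlt⟩ := (hy.left.and self_mem_nhdsWithin).exists
    have hlt : s < y := hlt
    have h1 := (hb.dist_sub_le l v hlt.le).1
    simp only [dist, hs, hy.key] at h1
    simp only [ends]
    refine le_of_mul_le_mul_right ?_ (sub_pos.2 hlt)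
    linarith

/-- The range of a continuous periodic function is compact, so the minimum is attained, and each
single value is positive. -/
theorem exists_pos_le_dist (hc : N.StronglyConnected) (hb : N.BoundedSlopes lmin lmax) {l v : V}
    (hlv : l ≠ v) : ∃ δ > 0, ∀ t, δ ≤ N.dist l v t := by
  have hcomp := (dist_periodic hc l v).compact_of_continuous N.T_pos.ne' (hb.dist_continuous l v)
  obtain ⟨δ, ⟨t, rfl⟩, hδ⟩ := hcomp.exists_isLeast (Set.range_nonempty _)
  exact ⟨_, dist_pos hc hlv t, fun s => hδ (Set.mem_range_self s)⟩

/-- For the landmark as its own destination the threshold in `Active` is `0`, so the error has to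
vanish exactly. -/
theorem ends_self_mae (hc : N.StronglyConnected) (hb : N.BoundedSlopes lmin lmax) (l : V)
    (x y : ℝ) : (ends x y ((N.probe l x).val l) ((N.probe l y).val l)).mae = 0 := by
  have hx := (probe_describes hc hb.earliest_continuous l l x).1
  have hy := (probe_describes hc hb.earliest_continuous l l y).1
  have hr : ((N.probe l x).val l).right = 1 := by
    obtain ⟨s, hs, hlt⟩ := (hx.right.and self_mem_nhdsWithin).exists
    have hlt : x < s := hlt
    rw [← hx.key, earliest_self hc, earliest_self hc] at hs
    refine mul_right_cancel₀ (sub_pos.2 hlt).ne' ?_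
    linarith
  have hl : ((N.probe l y).val l).left = 1 := by
    obtain ⟨s, hs, hlt⟩ := (hy.left.and self_mem_nhdsWithin).exists
    have hlt : s < y := hlt
    rw [← hy.key, earliest_self hc, earliest_self hc] at hs
    refine mul_right_cancel₀ (sub_neg.2 hlt).ne ?_
    linarith
  simp [Ends.mae, ends, hr, hl]

/-- The bisection reaches a level without active destinations. -/
theorem depth_spec (hc : N.StronglyConnected) (hb : N.BoundedSlopes lmin lmax) {ε : ℝ}
    (hε : 0 < ε) {l : V} {x y : ℝ} (hxy : x < y) :
    ∀ j < 2 ^ N.depth ε l x y, ∀ v,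
      ¬ (ends (x + j * ((y - x) / 2 ^ N.depth ε l x y))
        (x + (j + 1) * ((y - x) / 2 ^ N.depth ε l x y))
        ((N.probe l (x + j * ((y - x) / 2 ^ N.depth ε l x y))).val v)
        ((N.probe l (x + (j + 1) * ((y - x) / 2 ^ N.depth ε l x y))).val v)).Active ε := by
  refine Nat.sInf_mem (s := {k : ℕ | ∀ j < 2 ^ k, ∀ v,
    ¬ (ends (x + j * ((y - x) / 2 ^ k)) (x + (j + 1) * ((y - x) / 2 ^ k))
      ((N.probe l (x + j * ((y - x) / 2 ^ k))).val v)
      ((N.probe l (x + (j + 1) * ((y - x) / 2 ^ k))).val v)).Active ε}) ?_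
  have hδ : ∀ v, ∃ δ > 0, l ≠ v → ∀ t, δ ≤ N.dist l v t := by
    intro v
    by_cases hlv : l = v
    · exact ⟨1, one_pos, fun h => absurd hlv h⟩
    · obtain ⟨δ, h1, h2⟩ := exists_pos_le_dist hc hb hlv
      exact ⟨δ, h1, fun _ => h2⟩
  choose δ hδ0 hδ using hδ
  -- At level `k` the error is at most `(|lmax| + |lmin|) (y - x) / 2 ^ k`, while the threshold for
  -- `v ≠ l` is at least `ε δ v`. There are finitely many `v`, so one level serves all.
  have hev : ∀ᶠ k : ℕ in atTop, ∀ v : V,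
      (|lmax| + |lmin|) * (y - x) / (ε * δ v) ≤ (2 : ℝ) ^ k := by
    rw [eventually_all]
    intro v
    exact (tendsto_pow_atTop_atTop_of_one_lt one_lt_two).eventually_ge_atTop _
  obtain ⟨k, hk⟩ := hev.exists
  refine ⟨k, fun j _ v => ?_⟩
  have h2 : (0 : ℝ) < 2 ^ k := by positivity
  set h := (y - x) / 2 ^ k with hh
  have hpos : 0 < h := div_pos (sub_pos.2 hxy) h2
  have hhm : h * 2 ^ k = y - x := div_mul_cancel₀ _ h2.ne'
  have hlt : x + j * h < x + (j + 1) * h := by linarith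
  have hsl := ends_slopes hc hb l v (x + j * h) (x + (j + 1) * h)
  set e := ends (x + j * h) (x + (j + 1) * h) ((N.probe l (x + j * h)).val v)
    ((N.probe l (x + (j + 1) * h)).val v) with he
  have hdx : e.dx = N.dist l v (x + j * h) := by simp [he, ends, probe_key hc, dist]
  have hdy : e.dy = N.dist l v (x + (j + 1) * h) := by simp [he, ends, probe_key hc, dist]
  unfold Ends.Active
  rw [not_lt]
  by_cases hv : l = v
  · have h0 : e.mae = 0 := by
      subst hv
      exact ends_self_mae hc hb l _ _
    rw [h0, hdx, hdy]
    exact mul_nonneg hε.le (le_min (dist_nonneg hc _ _ _) (dist_nonneg hc _ _ _))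
  · have h3 : δ v ≤ min e.dx e.dy := by
      rw [hdx, hdy]
      exact le_min (hδ v hv _) (hδ v hv _)
    have hex : e.y - e.x = h := by simp only [he, ends]; ring
    refine (Ends.mae_le (e := e) hlt).trans
      (le_trans ?_ (mul_le_mul_of_nonneg_left h3 hε.le))
    have h4 := hk v
    rw [div_le_iff₀ (mul_pos hε (hδ0 v)), ← hhm] at h4
    have h5 : (|lmax| + |lmin|) * h ≤ ε * δ v := by
      refine le_of_mul_le_mul_right ?_ h2
      linarith
    rw [hex]
    refine max_le (mul_pos hε (hδ0 v)).le
      (le_trans (mul_le_mul_of_nonneg_right ?_ hpos.le) h5)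
    have := le_abs_self lmax
    have := le_abs_self lmin
    linarith [hsl.1, hsl.2]

open Classical in
/-- The bisection gives a `(1 + ε)`-approximation if its depth is sufficient. -/
theorem bisect_isUpperApprox (hc : N.StronglyConnected) (hb : N.BoundedSlopes lmin lmax) {ε : ℝ}
    (hε : 0 < ε) {l : V} (k : ℕ) (A : Finset V) {x y : ℝ} (hxy : x < y)
    (hconc : ∀ v, ConcaveOn ℝ (Set.Icc x y) (N.dist l v))
    (hk : ∀ j < 2 ^ k, ∀ v, ¬ (ends (x + j * ((y - x) / 2 ^ k)) (x + (j + 1) * ((y - x) / 2 ^ k))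
      ((N.probe l (x + j * ((y - x) / 2 ^ k))).val v)
      ((N.probe l (x + (j + 1) * ((y - x) / 2 ^ k))).val v)).Active ε) {v : V} (hv : v ∈ A) :
    IsUpperApprox (N.dist l v) ε x y
      ((N.bisect ε l k A x y (N.probe l x).val (N.probe l y).val).val.pts v) := by
  induction k generalizing A x y with
  | zero =>
    have h := hk 0 (by simp) v
    have h1 : x + (0 + 1) * ((y - x) / 2 ^ 0) = y := by simp
    have h2 : x + 0 * ((y - x) / 2 ^ 0) = x := by simp
    rw [h1, h2] at h
    exact (ends_describes hc hb hxy (hconc v)).isUpperApprox hε.le (dist_nonneg hc l v) h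
  | succ k ih =>
    have hz1 : x < (x + y) / 2 := by linarith
    have hz2 : (x + y) / 2 < y := by linarith
    have hw1 : ((x + y) / 2 - x) / 2 ^ k = (y - x) / 2 ^ (k + 1) := by
      rw [pow_succ]
      field_simp
      ring
    have hw2 : (y - (x + y) / 2) / 2 ^ k = (y - x) / 2 ^ (k + 1) := by
      rw [pow_succ]
      field_simp
      ring
    -- The midpoint is grid point number `2 ^ k` of level `k + 1`; hence the shift of the index `j`
    -- by `2 ^ k` on the right half.
    have hz : (x + y) / 2 = x + 2 ^ k * ((y - x) / 2 ^ (k + 1)) := by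
      rw [pow_succ]
      field_simp
      ring
    have hdesc := ends_describes hc hb hxy (hconc v)
    simp only [bisect]
    split_ifs with hA
    · refine hdesc.isUpperApprox hε.le (dist_nonneg hc l v) fun hact => ?_
      have : v ∈ (∅ : Finset V) := hA ▸ Finset.mem_filter.2 ⟨hv, hact⟩
      exact absurd this (Finset.notMem_empty v)
    · dsimp only
      split_ifs with hvA
      · refine IsUpperApprox.append (y := (x + y) / 2) ?_ ?_
        · refine ih _ hz1 (fun w => (hconc w).subset
            (Set.Icc_subset_Icc le_rfl hz2.le) (convex_Icc _ _)) ?_ hvA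
          intro j hj w
          rw [hw1]
          exact hk j (hj.trans (pow_lt_pow_right₀ one_lt_two k.lt_succ_self)) w
        · refine ih _ hz2 (fun w => (hconc w).subset
            (Set.Icc_subset_Icc hz1.le le_rfl) (convex_Icc _ _)) ?_ hvA
          intro j hj w
          have h1 := hk (j + 2 ^ k) (by rw [pow_succ]; linarith) w
          have h2 : (x + y) / 2 + j * ((y - x) / 2 ^ (k + 1)) =
              x + (j + 2 ^ k) * ((y - x) / 2 ^ (k + 1)) := by
            rw [hz]
            ring
          have h3 : (x + y) / 2 + (j + 1) * ((y - x) / 2 ^ (k + 1)) =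
              x + (j + 2 ^ k + 1) * ((y - x) / 2 ^ (k + 1)) := by
            rw [hz]
            ring
          rw [hw2, h2, h3]
          exact h1
      · refine hdesc.isUpperApprox hε.le (dist_nonneg hc l v) fun hact => hvA ?_
        exact Finset.mem_filter.2 ⟨hv, hact⟩

/-! ### The summaries -/

/-- The form `(0 :: c).zip c` exposes the consecutive cuts for the induction in
`IsUpperApprox.flatten`. -/
theorem intervals_spec (N : TDNetwork V) (l : V) :
    ∃ c : List ℝ, N.intervals l = (0 :: c).zip c ∧ (0 :: c).Pairwise (· < ·) ∧ N.T ∈ c ∧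
      (∀ z ∈ c, z ≤ N.T) ∧ (∀ z ∈ N.images l, z ∈ 0 :: c) ∧ c.length ≤ N.Kstar + 1 := by
  set S := insert 0 (insert N.T (N.images l)) with hS
  have hmem : ∀ z ∈ S, 0 ≤ z ∧ z ≤ N.T := by
    intro z hz
    rcases Finset.mem_insert.1 hz with rfl | hz
    · exact ⟨le_rfl, N.T_pos.le⟩
    · rcases Finset.mem_insert.1 hz with rfl | hz
      · exact ⟨N.T_pos.le, le_rfl⟩
      · obtain ⟨b, _, rfl⟩ := Finset.mem_image.1 hz
        obtain ⟨_, _, h⟩ := N.exists_modT ((N.reverseProbe b.1.1 b.2).val l)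
        exact ⟨h.1, h.2.le⟩
  have hpw : (S.sort (· ≤ ·)).Pairwise (· < ·) := (Finset.sortedLT_sort S).pairwise
  have hcard : (S.sort (· ≤ ·)).length ≤ N.Kstar + 2 := by
    rw [Finset.length_sort]
    refine (Finset.card_insert_le _ _).trans ?_
    have h1 := Finset.card_insert_le N.T (N.images l)
    have h2 : (N.images l).card ≤ N.Kstar := Finset.card_image_le
    omega
  have hin : ∀ z, z ∈ S.sort (· ≤ ·) ↔ z ∈ S := fun z => Finset.mem_sort _
  have hdef : N.intervals l = (S.sort (· ≤ ·)).zip (S.sort (· ≤ ·)).tail := rfl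
  rw [hdef]
  generalize S.sort (· ≤ ·) = L at hpw hcard hin
  cases L with
  | nil => exact absurd ((hin 0).2 (Finset.mem_insert_self _ _)) (by simp)
  | cons a c =>
    have hc := List.pairwise_cons.1 hpw
    obtain rfl : a = 0 := by
      rcases List.mem_cons.1 ((hin 0).2 (Finset.mem_insert_self _ _)) with h | h
      · exact h.symm
      · exact absurd (hmem a ((hin a).1 (by simp))).1 (not_le.2 (hc.1 0 h))
    refine ⟨c, rfl, hpw, ?_, ?_, ?_, ?_⟩
    · rcases List.mem_cons.1 ((hin N.T).2 (by simp [hS])) with h | h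
      · exact absurd h N.T_pos.ne'
      · exact h
    · exact fun z hz => (hmem z ((hin z).1 (List.mem_cons_of_mem _ hz))).2
    · intro z hz
      exact (hin z).2 (by simp [hS, hz])
    · simpa using hcard

theorem summaries_val (N : TDNetwork V) (ε : ℝ) (l v : V) :
    (N.summaries ε l).val v =
      ((N.intervals l).map fun I => (N.bisectInterval ε l I).val.pts v).flatten ++
        [(N.T, ((N.probe l N.T).val v).key - N.T)] := by
  simp [summaries, Function.comp_def]

theorem summaries_approx (hc : N.StronglyConnected) (hb : N.BoundedSlopes lmin lmax)
    (hl : lmin < 1) {ε : ℝ} (hε : 0 < ε) (l v : V) {t : ℝ} (ht : t ∈ Set.Icc 0 N.T) :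
    N.dist l v t ≤ interpolate ((N.summaries ε l).val v) t ∧
      interpolate ((N.summaries ε l).val v) t ≤ (1 + ε) * N.dist l v t := by
  obtain ⟨c, hint, hpw, hT, hmax, himg, _⟩ := N.intervals_spec l
  rw [summaries_val, probe_key hc, hint]
  have key := IsUpperApprox.flatten (f := N.dist l v) (ε := ε)
    (fun I => (N.bisectInterval ε l I).val.pts v) hpw hT hmax (by
      rintro ⟨x, y⟩ hI
      obtain ⟨hxy, hx, hy, hno⟩ := List.mem_zip_tail_of_pairwise hpw hI
      have hx0 : 0 ≤ x := by
        rcases List.mem_cons.1 hx with h | h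
        · exact h.ge
        · exact ((List.pairwise_cons.1 hpw).1 x h).le
      have hyT : y ≤ N.T := by
        rcases List.mem_cons.1 hy with h | h
        · exact h.le.trans N.T_pos.le
        · exact hmax y h
      -- All images are cuts, so none lies strictly between two consecutive cuts.
      have hconc : ∀ w, ConcaveOn ℝ (Set.Icc x y) (N.dist l w) := fun w =>
        dist_concaveOn hc hb hl (fun s hs => ⟨⟨hx0.trans_lt hs.1, hs.2.trans_le hyT⟩,
          fun hm => hno s (himg s (Finset.mem_coe.1 hm)) hs⟩) w
      exact bisect_isUpperApprox hc hb hε _ _ hxy hconc (depth_spec hc hb hε hxy)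
        (Finset.mem_univ v))
  exact key.bounds [] t ht

/-- Every summary of a landmark is a `(1 + ε)`-approximation of the travel time. -/
theorem evalSummary_approx (hc : N.StronglyConnected) (hb : N.BoundedSlopes lmin lmax)
    (hl : lmin < 1) {ε : ℝ} (hε : 0 < ε) {L : Finset V} {l : V} (hL : l ∈ L) (v : V) (t : ℝ) :
    N.dist l v t ≤ (N.evalSummary ((N.preprocess ε L).val l v) t).val ∧
      (N.evalSummary ((N.preprocess ε L).val l v) t).val ≤ (1 + ε) * N.dist l v t := by
  obtain ⟨_, _, hm⟩ := N.exists_modT t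
  have h := summaries_approx hc hb hl hε l v (Set.Ico_subset_Icc_self hm)
  rw [dist_modT hc] at h
  simpa only [evalSummary, preprocess, if_pos hL] using h

end TDNetwork

end

/-! ### The recursion of the stretch -/

/-- The factor of `ε` in the stretch. -/
noncomputable def stretchFactor (ε ψ : ℝ) (r : ℕ) : ℝ :=
  (1 + ε / ψ) ^ (r + 1) / ((1 + ε / ψ) ^ (r + 1) - 1)

theorem one_lt_one_add_div_pow {ε ψ : ℝ} (hε : 0 < ε) (hψ : 0 < ψ) (r : ℕ) :
    1 < (1 + ε / ψ) ^ (r + 1) :=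
  one_lt_pow₀ (by have := div_pos hε hψ; linarith) (Nat.succ_ne_zero r)

theorem one_le_stretchFactor {ε ψ : ℝ} (hε : 0 < ε) (hψ : 0 < ψ) (r : ℕ) :
    1 ≤ stretchFactor ε ψ r := by
  have h := one_lt_one_add_div_pow hε hψ r
  unfold stretchFactor
  rw [one_le_div (by linarith)]
  linarith

/-- With `q = 1 + ε / ψ` one has `q / (q - 1) = (ε + ψ) / ε`, the value for a single ball. -/
theorem stretchFactor_zero {ε ψ : ℝ} (hε : 0 < ε) (hψ : 0 < ψ) :
    ε * stretchFactor ε ψ 0 = ε + ψ := by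
  unfold stretchFactor
  simp only [zero_add, pow_one, add_sub_cancel_left]
  field_simp
  ring

/-- For `β = stretchFactor ε ψ r` the quantity `1 - 1 / β` is `(1 + ε / ψ) ^ (-(r + 1))`. One more
level divides it by `1 + ε / ψ`; this is that recursion without denominators. -/
theorem stretchFactor_succ {ε ψ : ℝ} (hε : 0 < ε) (hψ : 0 < ψ) (r : ℕ) :
    stretchFactor ε ψ (r + 1) * (ψ + ε * stretchFactor ε ψ r) =
      stretchFactor ε ψ r * (ε + ψ) := by
  have h1 := one_lt_one_add_div_pow hε hψ r
  have h2 := one_lt_one_add_div_pow hε hψ (r + 1)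
  unfold stretchFactor
  rw [pow_succ _ (r + 1)] at h2 ⊢
  set q := (1 + ε / ψ) ^ (r + 1)
  have h3 : (1 + ε / ψ) * ψ = ψ + ε := by field_simp
  set e := 1 + ε / ψ
  have h4 : q - 1 ≠ 0 := by linarith
  have h5 : q * e - 1 ≠ 0 := by linarith
  have hε' : ε = e * ψ - ψ := by linarith
  rw [hε']
  field_simp
  ring

/-- The better one of a candidate via a landmark at distance `R` and of a candidate obtained by
recursion from a point at distance at least `R`. -/
theorem min_le_stretchFactor_succ {ε ψ D R : ℝ} (hε : 0 < ε) (hψ : 0 < ψ) (r : ℕ) {a b : ℝ}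
    (ha : a ≤ (1 + ε) * D + ψ * R) (hb : b ≤ D + ε * stretchFactor ε ψ r * (D - R)) :
    min a b ≤ (1 + ε * stretchFactor ε ψ (r + 1)) * D := by
  by_contra! h
  obtain ⟨h1, h2⟩ := lt_min_iff.1 h
  have hβ := one_le_stretchFactor hε hψ r
  have hrec := stretchFactor_succ hε hψ r
  set β := stretchFactor ε ψ r
  set β' := stretchFactor ε ψ (r + 1)
  have h3 : ε * β' * D < ε * D + ψ * R := by linarith
  have h4 : β' * D < β * (D - R) := by
    have : ε * (β' * D) < ε * (β * (D - R)) := by linarith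
    exact lt_of_mul_lt_mul_left this hε.le
  -- With the weights `β` and `ψ` the terms in `R` cancel from the sum of the two strict
  -- inequalities; what remains contradicts `stretchFactor_succ`.
  have h5 := mul_lt_mul_of_pos_left h3 (by linarith : 0 < β)
  have h6 := mul_lt_mul_of_pos_left h4 hψ
  have h7 : β' * (ψ + ε * β) * D = β * (ε + ψ) * D := by rw [hrec]
  linarith

theorem one_le_psi {ε lmax ζ : ℝ} (hε : 0 < ε) (hl : 0 ≤ lmax) (hζ : 1 ≤ ζ) :
    1 ≤ psi ε lmax ζ := by
  unfold psi
  have h1 : 0 ≤ lmax * (1 + ε) * (1 + 2 * ζ + lmax * ζ) := by positivity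
  have h2 : 0 ≤ (1 + ε) * ζ := by positivity
  linarith

/-! ### Stretch of the recursive query -/

namespace TDNetwork

variable {V : Type*} [Fintype V] [DecidableEq V] {N : TDNetwork V} {lmin lmax ζ ε : ℝ}

theorem BoundedOppositeTrips.dist_le (hc : N.StronglyConnected) (h : N.BoundedOppositeTrips ζ)
    (o d : V) (t : ℝ) : N.dist o d t ≤ ζ * N.dist d o t := by
  obtain ⟨_, _, hm⟩ := N.exists_modT t
  rw [← dist_modT hc o d, ← dist_modT hc d o]
  exact h o d _ hm

/-- The constant-factor approximation by a single ball. -/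
theorem single_ball_bound (hc : N.StronglyConnected) (hb : N.BoundedSlopes lmin lmax)
    (hl : 0 ≤ lmax) (ho : N.BoundedOppositeTrips ζ) (hζ : 1 ≤ ζ) (hε : 0 < ε) (w l d : V) (t : ℝ) :
    N.dist w l t + (1 + ε) * N.dist l d (t + N.dist w l t) ≤
      (1 + ε) * N.dist w d t + psi ε lmax ζ * N.dist w l t := by
  set R := N.dist w l t with hR
  have hR0 : 0 ≤ R := dist_nonneg hc w l t
  -- The detour from `l`: back to `w`, an opposite trip, and then to `d`, departing from `w` by `R +
  -- B` later than `t`.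
  have h1 := dist_triangle hc l w d (t + R)
  have h2 := ho.dist_le hc l w (t + R)
  have h3 := (hb.dist_sub_le w l (le_add_of_nonneg_right hR0 : t ≤ t + R)).2
  have hR1 : N.dist w l (t + R) ≤ (1 + lmax) * R := by
    rw [← hR] at h3
    linarith
  set B := N.dist l w (t + R) with hB
  have hB0 : 0 ≤ B := dist_nonneg hc l w _
  have hB1 : B ≤ ζ * ((1 + lmax) * R) :=
    h2.trans (mul_le_mul_of_nonneg_left hR1 (by linarith))
  have h4 := (hb.dist_sub_le w d (t := t) (t' := t + R + B) (by linarith)).2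
  have h5 : lmax * (t + R + B - t) ≤ lmax * (R + ζ * ((1 + lmax) * R)) :=
    mul_le_mul_of_nonneg_left (by linarith) hl
  have h6 : N.dist l d (t + R) ≤
      ζ * ((1 + lmax) * R) + N.dist w d t + lmax * (R + ζ * ((1 + lmax) * R)) := by linarith
  have h7 := mul_le_mul_of_nonneg_left h6 (by linarith : (0 : ℝ) ≤ 1 + ε)
  refine (add_le_add_right h7 R).trans (le_of_eq ?_)
  -- `psi` is exactly the resulting coefficient of `R`.
  unfold psi
  ring

/-- Along the path the keys of settled vertices keep pace with the path; as its end is not settled,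
it meets the queue. The tentative key there need not be final, since FIFO makes an arrival no later
than along the path sufficient. -/
theorem exists_boundary (hc : N.StronglyConnected) {o : V} {t : ℝ} {s : SearchState V}
    (hs : N.forward.Inv N.arr o t s) {x d : V} {p : List V} {a : ℝ}
    (hx : x ∈ s.settled ∪ s.queue) (hk : (s.label x).key ≤ a) (hp : N.IsPath x p d)
    (hd : d ∉ s.settled) :
    ∃ y ∈ s.queue, N.earliest y d (s.label y).key ≤ N.pathArr x p a := by
  induction p generalizing x a with
  | nil =>
    obtain rfl : x = d := hp
    refine ⟨x, (Finset.mem_union.1 hx).resolve_left hd, ?_⟩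
    rw [earliest_self hc]
    exact hk
  | cons v p ih =>
    rcases Finset.mem_union.1 hx with h | h
    · obtain ⟨h1, h2⟩ := hs.arc x h v hp.1
      exact ih h1 (h2.trans (N.arr_mono hp.1 hk)) hp.2
    · exact ⟨x, h, ((isLeast_earliest hc x d _).2 ⟨_, hp, rfl⟩).trans (pathArr_mono hp hk)⟩

/-- The outcome of growing a ball until `d` or an element of `L` has been settled. -/
theorem ball_spec (hc : N.StronglyConnected) (L : Finset V) (w d : V) (t : ℝ) :
    let ball := (N.forward.search (insert d L) w t).val
    ∃ l ∈ insert d L, ball.2 = some l ∧ (ball.1.label l).key = N.earliest w l t ∧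
      (∀ x ∈ ball.1.queue, N.earliest w d t ≤ N.earliest x d (ball.1.label x).key) ∧
      (l ≠ d → ∃ x ∈ ball.1.queue,
        N.earliest x d (ball.1.label x).key = N.earliest w d t ∧
        N.earliest w l t ≤ (ball.1.label x).key) := by
  intro ball
  obtain ⟨hinv, h2⟩ := N.forward.search_spec (P := N.forward.Inv N.arr w t)
    (fun s h hs => hs.settle N.forward_keyLaw h) (insert d L) w t SearchGraph.Inv.init
  rcases h2 with ⟨_, hq, hdisj⟩ | ⟨l, hl, hsome, hls, honly⟩
  · exfalso
    rcases hinv.dominated N.forward_keyLaw (reach_earliest hc w d t) with ⟨h, _⟩ | ⟨x, hx, _⟩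
    · exact Finset.disjoint_left.1 hdisj h (Finset.mem_insert_self d L)
    · rw [hq] at hx
      exact Finset.notMem_empty x hx
  · have hkey : (ball.1.label l).key = N.earliest w l t :=
      key_eq_earliest hc (hinv.reach l (Finset.mem_union_left _ hls))
        fun a ha => hinv.le_of_settled N.forward_keyLaw hls ha
    have hbd : ∀ x ∈ ball.1.queue, N.earliest w d t ≤ N.earliest x d (ball.1.label x).key :=
      fun x hx => earliest_le_of_reach_of_earliest hc d
        (hinv.reach x (Finset.mem_union_right _ hx))
    refine ⟨l, hl, hsome, hkey, hbd, fun hld => ?_⟩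
    have hds : d ∉ ball.1.settled := fun h =>
      hld (honly d h (Finset.mem_insert_self d L)).symm
    -- At the vertex where an optimal path meets the queue the tentative key is attainable and no
    -- later than along the path, so going on from there is still optimal.
    obtain ⟨p, hp, hpe⟩ := (isLeast_earliest hc w d t).1
    obtain ⟨x, hx, hle⟩ := exists_boundary hc hinv hinv.source hinv.source_key hp hds
    refine ⟨x, hx, le_antisymm (hpe ▸ hle) (hbd x hx), ?_⟩
    rw [← hkey]
    exact hinv.order l hls x hx

theorem query_of_mem (L : Finset V) (tab : V → V → List (ℝ × ℝ)) (d : V) (r : ℕ) {w : V}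
    (hw : w ∈ L) (t : ℝ) : N.query L tab d r w t =
      ⟨(N.evalSummary (tab w d) t).val, 1 + (N.evalSummary (tab w d) t).cost⟩ := by
  cases r <;> rw [query, if_pos hw]

theorem query_val_of_goal (L : Finset V) (tab : V → V → List (ℝ × ℝ)) (d : V) (r : ℕ) {w : V}
    (hw : w ∉ L) (t : ℝ) (h : (N.forward.search (insert d L) w t).val.2 = some d) :
    (N.query L tab d r w t).val =
      ((N.forward.search (insert d L) w t).val.1.label d).key - t := by
  cases r <;> rw [query, if_neg hw] <;> simp only [h, if_true]

theorem query_val_zero (L : Finset V) (tab : V → V → List (ℝ × ℝ)) (d : V) {w l : V}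
    (hw : w ∉ L) (t : ℝ) (h : (N.forward.search (insert d L) w t).val.2 = some l) (hl : l ≠ d) :
    (N.query L tab d 0 w t).val =
      ((N.forward.search (insert d L) w t).val.1.label l).key - t +
        (N.evalSummary (tab l d) ((N.forward.search (insert d L) w t).val.1.label l).key).val := by
  rw [query, if_neg hw]
  simp only [h, if_neg hl]

theorem query_val_succ (L : Finset V) (tab : V → V → List (ℝ × ℝ)) (d : V) (r : ℕ) {w l : V}
    (hw : w ∉ L) (t : ℝ) (h : (N.forward.search (insert d L) w t).val.2 = some l) (hl : l ≠ d) :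
    (N.query L tab d (r + 1) w t).val =
      (N.forward.search (insert d L) w t).val.1.queue.fold min
        (((N.forward.search (insert d L) w t).val.1.label l).key - t +
          (N.evalSummary (tab l d)
            ((N.forward.search (insert d L) w t).val.1.label l).key).val)
        fun x => ((N.forward.search (insert d L) w t).val.1.label x).key - t +
          (N.query L tab d r x ((N.forward.search (insert d L) w t).val.1.label x).key).val := by
  rw [query, if_neg hw]
  simp only [h, if_neg hl]

/-- The answers of the query algorithm. -/
theorem query_bounds (hc : N.StronglyConnected) (hb : N.BoundedSlopes lmin lmax)
    (hlmin : lmin < 1) (hl : 0 ≤ lmax) (ho : N.BoundedOppositeTrips ζ) (hζ : 1 ≤ ζ) (hε : 0 < ε)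
    (L : Finset V) (d : V) (r : ℕ) (w : V) (t : ℝ) :
    N.dist w d t ≤ (N.query L (N.preprocess ε L).val d r w t).val ∧
      (N.query L (N.preprocess ε L).val d r w t).val ≤
        (1 + ε * stretchFactor ε (psi ε lmax ζ) r) * N.dist w d t := by
  have hψ : 0 < psi ε lmax ζ := lt_of_lt_of_le one_pos (one_le_psi hε hl hζ)
  induction r generalizing w t with
  | zero =>
    have hD := dist_nonneg hc w d t
    by_cases hw : w ∈ L
    · rw [query_of_mem _ _ _ _ hw]
      obtain ⟨h1, h2⟩ := evalSummary_approx hc hb hlmin hε hw d t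
      refine ⟨h1, h2.trans (mul_le_mul_of_nonneg_right ?_ hD)⟩
      rw [stretchFactor_zero hε hψ]
      linarith
    · obtain ⟨l, hlL, hsome, hkey, hbd, hex⟩ := ball_spec hc L w d t
      by_cases hld : l = d
      · subst hld
        rw [query_val_of_goal _ _ _ _ hw _ hsome, hkey]
        refine ⟨le_rfl, le_mul_of_one_le_left hD ?_⟩
        rw [stretchFactor_zero hε hψ]
        linarith
      · rw [query_val_zero _ _ _ hw _ hsome hld, hkey]
        obtain ⟨h1, h2⟩ := evalSummary_approx hc hb hlmin hε
          ((Finset.mem_insert.1 hlL).resolve_left hld) d (N.earliest w l t)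
        have he : t + N.dist w l t = N.earliest w l t := by simp [dist]
        constructor
        · have := dist_triangle hc w l d t
          rw [he] at this
          have h3 : N.dist w l t = N.earliest w l t - t := rfl
          linarith
        · have h3 := single_ball_bound hc hb hl ho hζ hε w l d t
          rw [he] at h3
          obtain ⟨x, hx, hx1, hx2⟩ := hex hld
          have h4 := le_earliest hc x d
            ((N.forward.search (insert d L) w t).val.1.label x).key
          -- The landmark is settled no later than the key of a boundary vertex `x` through which
          -- `d` is optimally reached; so `R ≤ D`.
          have h5 : N.dist w l t ≤ N.dist w d t := by
            simp only [dist]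
            linarith
          have h6 := mul_le_mul_of_nonneg_left h5 hψ.le
          have h7 : N.dist w l t = N.earliest w l t - t := rfl
          rw [stretchFactor_zero hε hψ]
          linarith
  | succ r ih =>
    have hD := dist_nonneg hc w d t
    have hβ := one_le_stretchFactor hε hψ (r + 1)
    have hβ' : ε ≤ ε * stretchFactor ε (psi ε lmax ζ) (r + 1) := le_mul_of_one_le_right hε.le hβ
    by_cases hw : w ∈ L
    · rw [query_of_mem _ _ _ _ hw]
      obtain ⟨h1, h2⟩ := evalSummary_approx hc hb hlmin hε hw d t
      exact ⟨h1, h2.trans (mul_le_mul_of_nonneg_right (by linarith) hD)⟩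
    · obtain ⟨l, hlL, hsome, hkey, hbd, hex⟩ := ball_spec hc L w d t
      by_cases hld : l = d
      · subst hld
        rw [query_val_of_goal _ _ _ _ hw _ hsome, hkey]
        exact ⟨le_rfl, le_mul_of_one_le_left hD (by linarith)⟩
      · rw [query_val_succ _ _ _ _ hw _ hsome hld, hkey]
        set s := (N.forward.search (insert d L) w t).val.1 with hs
        obtain ⟨h1, h2⟩ := evalSummary_approx hc hb hlmin hε
          ((Finset.mem_insert.1 hlL).resolve_left hld) d (N.earliest w l t)
        have he : t + N.dist w l t = N.earliest w l t := by simp [dist]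
        have h7 : N.dist w l t = N.earliest w l t - t := rfl
        constructor
        · rw [Finset.le_fold_min]
          constructor
          · have := dist_triangle hc w l d t
            rw [he] at this
            linarith
          · intro x hx
            have h3 := (ih x (s.label x).key).1
            have h4 := hbd x hx
            simp only [dist] at h3 ⊢
            linarith
        · have h3 := single_ball_bound hc hb hl ho hζ hε w l d t
          rw [he] at h3
          obtain ⟨x, hx, hx1, hx2⟩ := hex hld
          have h4 := (ih x (s.label x).key).2
          have hfold : ∀ a : ℝ, (∀ b, (s.queue.fold min a fun x => (s.label x).key - t +
              (N.query L (N.preprocess ε L).val d r x (s.label x).key).val) ≤ b ↔ _) :=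
            fun a b => Finset.fold_min_le b
          refine le_trans (le_min ((hfold _ _).2 (Or.inl le_rfl))
            ((hfold _ _).2 (Or.inr ⟨x, hx, le_rfl⟩))) ?_
          refine min_le_stretchFactor_succ hε hψ r (R := N.dist w l t) (by linarith) ?_
          -- The time already spent is exact, so the factor of the recursive answer applies to the
          -- remainder only, which is at most `D - R`.
          have hdx : N.dist x d (s.label x).key = N.dist w d t - ((s.label x).key - t) := by
            simp only [dist, hx1]
            ring
          have h5 : 0 ≤ ε * stretchFactor ε (psi ε lmax ζ) r :=
            mul_nonneg hε.le (zero_le_one.trans (one_le_stretchFactor hε hψ r))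
          have h6 : N.dist x d (s.label x).key ≤ N.dist w d t - N.dist w l t := by
            rw [hdx]
            linarith
          have h8 := mul_le_mul_of_nonneg_left h6 h5
          rw [add_mul, one_mul] at h4
          linarith

end TDNetwork

/-! ### Logarithms -/

theorem one_le_lg (x : ℝ) : 1 ≤ lg x := le_max_left _ _

theorem logb_le_lg (x : ℝ) : Real.logb 2 x ≤ lg x := le_max_right _ _

theorem one_le_lglg (k : ℕ) : 1 ≤ lglg k := le_max_left _ _

theorem logb_two_le_self {x : ℝ} (hx : 0 < x) : Real.logb 2 x ≤ x := by
  have h2 : (1 : ℝ) / 2 < Real.log 2 := by linarith [Real.log_two_gt_d9]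
  have h1 : Real.log 2 < 1 := by linarith [Real.log_two_lt_d9]
  unfold Real.logb
  rw [div_le_iff₀ (by linarith)]
  -- `log x ≤ x / 2 - 1 + log 2` suffices, because `1 / 2 < log 2 < 1`.
  have h3 := Real.log_le_sub_one_of_pos (half_pos hx)
  rw [Real.log_div hx.ne' two_ne_zero] at h3
  nlinarith

theorem lglg_mono : Monotone lglg := by
  intro a b hab
  unfold lglg
  rcases le_or_gt a 1 with ha | ha
  · have : Real.logb 2 (Real.logb 2 a) = 0 := by
      interval_cases a <;> simp
    rw [this, max_eq_left zero_le_one]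
    exact le_max_left _ _
  · have ha' : (1 : ℝ) < a := by exact_mod_cast ha
    have hab' : (a : ℝ) ≤ b := by exact_mod_cast hab
    refine max_le_max le_rfl (Real.logb_le_logb_of_le one_lt_two (Real.logb_pos one_lt_two ha') ?_)
    exact Real.logb_le_logb_of_le one_lt_two (by linarith) hab'

/-- A sum of three numbers that are at least `1` is at most four times their product; the `2` is the
logarithm of this `4`. -/
theorem lglg_mul_le {a b c : ℕ} (ha : 0 < a) (hb : 0 < b) (hc : 0 < c) :
    lglg (a * b * c) ≤ 2 + lg a + lg b + lglg c := by
  have ha' : (0 : ℝ) < a := by exact_mod_cast ha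
  have hb' : (0 : ℝ) < b := by exact_mod_cast hb
  have hc' : (0 : ℝ) < c := by exact_mod_cast hc
  have hA := one_le_lg a
  have hB := one_le_lg b
  have hC := one_le_lg c
  have hR := one_le_lglg c
  refine max_le (by linarith) ?_
  push_cast
  have hsum : Real.logb 2 (a * b * c) ≤ lg a + lg b + lg c := by
    rw [Real.logb_mul (by positivity) hc'.ne', Real.logb_mul ha'.ne' hb'.ne']
    exact add_le_add_three (logb_le_lg _) (logb_le_lg _) (logb_le_lg _)
  have hprod : lg a + lg b + lg c ≤ 4 * lg a * lg b * lg c := by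
    have h1 : 1 ≤ lg a * lg b := one_le_mul_of_one_le_of_one_le hA hB
    have h2 : lg a + lg b ≤ 2 * (lg a * lg b) := by nlinarith
    nlinarith
  have hnn : 0 ≤ Real.logb 2 (a * b * c) := by
    apply Real.logb_nonneg one_lt_two
    have : 1 ≤ a * b * c := Nat.mul_pos (Nat.mul_pos ha hb) hc
    exact_mod_cast this
  rcases hnn.eq_or_lt with h0 | hpos
  · rw [← h0, Real.logb_zero]
    linarith
  · have h4 := Real.logb_le_logb_of_le one_lt_two hpos (hsum.trans hprod)
    have h9 : Real.logb 2 (4 * lg a * lg b * lg c) =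
        Real.logb 2 4 + Real.logb 2 (lg a) + Real.logb 2 (lg b) + Real.logb 2 (lg c) := by
      rw [Real.logb_mul (by positivity) (by positivity),
        Real.logb_mul (by positivity) (by positivity),
        Real.logb_mul (by positivity) (by positivity)]
    rw [h9] at h4
    have h5 : Real.logb 2 4 = 2 := by
      rw [show (4 : ℝ) = 2 ^ (2 : ℕ) by norm_num, Real.logb_pow, Real.logb_self_eq_one one_lt_two]
      norm_num
    have h6 : Real.logb 2 (lg c) ≤ lglg c := by
      unfold lg
      rcases max_choice 1 (Real.logb 2 (c : ℝ)) with h | h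
      · rw [h, Real.logb_one]
        linarith
      · rw [h]
        exact le_max_right _ _
    have h7 := logb_two_le_self (zero_lt_one.trans_le hA)
    have h8 := logb_two_le_self (zero_lt_one.trans_le hB)
    linarith

theorem pqCost_le (k : ℕ) : pqCost k ≤ 1 + lg k :=
  add_le_add_right ((Real.natLog_le_logb k 2).trans (logb_le_lg _)) 1

theorem pqCost_mono : Monotone pqCost := by
  intro a b h
  unfold pqCost
  have := Nat.log_mono_right (b := 2) h
  have h' : (Nat.log 2 a : ℝ) ≤ Nat.log 2 b := by exact_mod_cast this
  linarith

theorem pqCost_nonneg (k : ℕ) : 0 ≤ pqCost k := by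
  unfold pqCost
  positivity

/-! ### Random landmarks -/

section Expectation

variable {V : Type*} [Fintype V] [DecidableEq V]

/-- The expectation of `f L` on the event that `L` contains `M` and is disjoint from `S`. -/
noncomputable def restrictedExpectation (ρ : ℝ) (S M : Finset V) (f : Finset V → ℝ) : ℝ :=
  ∑ L : Finset V, ρ ^ L.card * (1 - ρ) ^ (Fintype.card V - L.card) *
    if Disjoint S L ∧ M ⊆ L then f L else 0

theorem landmarkExpectation_eq (ρ : ℝ) (f : Finset V → ℝ) :
    landmarkExpectation ρ f = restrictedExpectation ρ ∅ ∅ f := by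
  simp [landmarkExpectation, restrictedExpectation]

variable {ρ : ℝ} {S M : Finset V} {f g : Finset V → ℝ}

theorem restrictedExpectation_mono (hρ : ρ ∈ Set.Ioo (0 : ℝ) 1)
    (h : ∀ L, Disjoint S L → M ⊆ L → f L ≤ g L) :
    restrictedExpectation ρ S M f ≤ restrictedExpectation ρ S M g := by
  refine Finset.sum_le_sum fun L _ => mul_le_mul_of_nonneg_left ?_ ?_
  · split_ifs with hL
    · exact h L hL.1 hL.2
    · exact le_rfl
  · exact mul_nonneg (pow_nonneg hρ.1.le _) (pow_nonneg (sub_nonneg.2 hρ.2.le) _)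

theorem restrictedExpectation_add :
    restrictedExpectation ρ S M (fun L => f L + g L) =
      restrictedExpectation ρ S M f + restrictedExpectation ρ S M g := by
  simp only [restrictedExpectation, ← Finset.sum_add_distrib, ← mul_add]
  refine Finset.sum_congr rfl fun L _ => ?_
  split_ifs <;> simp

theorem restrictedExpectation_sum {ι : Type*} (s : Finset ι) (F : ι → Finset V → ℝ) :
    restrictedExpectation ρ S M (fun L => ∑ i ∈ s, F i L) =
      ∑ i ∈ s, restrictedExpectation ρ S M (F i) := by
  simp only [restrictedExpectation]
  rw [Finset.sum_comm]
  refine Finset.sum_congr rfl fun L _ => ?_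
  split_ifs
  · rw [Finset.mul_sum]
  · simp

/-- Expand `∏ (a i + b i)` over the subsets `L`. Setting `a` to `0` on `S` and `b` to `0` on `M`
deletes exactly the sets outside the event; the factors are `1 - ρ` on `S`, `ρ` on `M` and `1`
elsewhere. -/
theorem restrictedExpectation_const (ρ : ℝ) (h : Disjoint S M) (c : ℝ) :
    restrictedExpectation ρ S M (fun _ => c) = ρ ^ M.card * (1 - ρ) ^ S.card * c := by
  have key := Finset.prod_add (fun i : V => if i ∈ S then 0 else ρ)
    (fun i => if i ∈ M then 0 else 1 - ρ) Finset.univ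
  have hl : ∏ i : V, ((if i ∈ S then 0 else ρ) + (if i ∈ M then 0 else 1 - ρ)) =
      ρ ^ M.card * (1 - ρ) ^ S.card := by
    have : ∀ i : V, ((if i ∈ S then 0 else ρ) + (if i ∈ M then 0 else 1 - ρ)) =
        (if i ∈ M then ρ else 1) * (if i ∈ S then 1 - ρ else 1) := by
      intro i
      by_cases hS : i ∈ S
      · have hM : i ∉ M := fun hM => Finset.disjoint_left.1 h hS hM
        simp [hS, hM]
      · by_cases hM : i ∈ M <;> simp [hS, hM]
    rw [Finset.prod_congr rfl fun i _ => this i, Finset.prod_mul_distrib]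
    simp [Finset.prod_ite_mem]
  rw [hl, Finset.powerset_univ] at key
  rw [key, Finset.sum_mul]
  refine Finset.sum_congr rfl fun L _ => ?_
  have h1 : ∏ i ∈ L, (if i ∈ S then 0 else ρ) = if Disjoint S L then ρ ^ L.card else 0 := by
    split_ifs with hd
    · rw [Finset.prod_congr rfl fun i hi => if_neg fun hS => Finset.disjoint_left.1 hd hS hi,
        Finset.prod_const]
    · obtain ⟨i, hS, hi⟩ := Finset.not_disjoint_iff.1 hd
      exact Finset.prod_eq_zero hi (if_pos hS)
  have h2 : ∏ i ∈ Finset.univ \ L, (if i ∈ M then 0 else 1 - ρ) =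
      if M ⊆ L then (1 - ρ) ^ (Fintype.card V - L.card) else 0 := by
    split_ifs with hd
    · rw [Finset.prod_congr rfl fun i hi => if_neg fun hM => (Finset.mem_sdiff.1 hi).2 (hd hM),
        Finset.prod_const, Finset.card_univ_sdiff]
    · obtain ⟨i, hM, hi⟩ := Finset.not_subset.1 hd
      exact Finset.prod_eq_zero (Finset.mem_sdiff.2 ⟨Finset.mem_univ i, hi⟩) (if_pos hM)
  rw [h1, h2]
  by_cases hd1 : Disjoint S L <;> by_cases hd2 : M ⊆ L <;> simp [hd1, hd2]

/-- The status of `u` is revealed. If `u` already belongs to `S` or `M`, one of the two events is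
empty, so nothing need be assumed. -/
theorem restrictedExpectation_split (u : V) :
    restrictedExpectation ρ S M f =
      restrictedExpectation ρ (insert u S) M f + restrictedExpectation ρ S (insert u M) f := by
  simp only [restrictedExpectation, ← Finset.sum_add_distrib, ← mul_add]
  refine Finset.sum_congr rfl fun L _ => ?_
  by_cases hu : u ∈ L <;>
    simp [hu, Finset.disjoint_insert_left, Finset.insert_subset_iff]

/-- The expectation of a sum over the random landmarks. -/
theorem landmarkExpectation_sum (ρ : ℝ) (a : V → ℝ) :
    landmarkExpectation ρ (fun L => ∑ l ∈ L, a l) = ρ * ∑ l, a l := by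
  have h1 : (fun L : Finset V => ∑ l ∈ L, a l) =
      fun L => ∑ l, if l ∈ L then a l else 0 := by
    funext L
    simp
  rw [landmarkExpectation_eq, h1, restrictedExpectation_sum, Finset.mul_sum]
  refine Finset.sum_congr rfl fun l _ => ?_
  have h2 := restrictedExpectation_const (S := ∅) (M := {l}) ρ (by simp) (a l)
  rw [Finset.card_singleton, Finset.card_empty, pow_one, pow_zero, mul_one] at h2
  rw [← h2]
  simp only [restrictedExpectation]
  refine Finset.sum_congr rfl fun L _ => ?_
  simp

/-- The bounds on preprocessing space and time have this form: an amount charged to each landmark,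
of which `ρ n` are expected. -/
theorem landmarkExpectation_le_of_le_sum (hρ : ρ ∈ Set.Ioo (0 : ℝ) 1) {c : ℝ}
    (h : ∀ L : Finset V, f L ≤ ∑ _l ∈ L, c) :
    landmarkExpectation ρ f ≤ ρ * (Fintype.card V * c) := by
  have h1 := landmarkExpectation_sum (V := V) ρ fun _ => c
  rw [Finset.sum_const, Finset.card_univ, nsmul_eq_mul] at h1
  rw [← h1, landmarkExpectation_eq, landmarkExpectation_eq]
  exact restrictedExpectation_mono hρ fun L _ _ => h L

end Expectation

/-! ### The cost of a search -/

namespace SearchGraph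

variable {V : Type*} [Fintype V] [DecidableEq V] (G : SearchGraph V)

/-- A bound on the cost of a round in which `u` is settled. -/
noncomputable def roundCost (u : V) : ℝ :=
  1 + pqCost (Fintype.card V) + ∑ v ∈ G.nbr u, (1 + G.evalCost u v + pqCost (Fintype.card V))

variable {G}

theorem settle_cost_le (s : SearchState V) (u : V) : 1 + (G.settle s u).cost ≤ G.roundCost u := by
  have h : ∀ A : Finset V, pqCost A.card ≤ pqCost (Fintype.card V) :=
    fun A => pqCost_mono (Finset.card_le_univ A)
  have h1 : (G.settle s u).cost = pqCost s.queue.card + ∑ v ∈ G.nbr u,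
      (1 + G.evalCost u v + pqCost (G.settle s u).val.queue.card) := rfl
  have h2 : ∑ v ∈ G.nbr u, (1 + G.evalCost u v + pqCost (G.settle s u).val.queue.card) ≤
      ∑ v ∈ G.nbr u, (1 + G.evalCost u v + pqCost (Fintype.card V)) :=
    Finset.sum_le_sum fun v _ => add_le_add_right (h _) _
  rw [h1]
  unfold roundCost
  linarith [h s.queue]

/-- Each round is charged to the vertex it settles, and no vertex is settled twice; the `1` pays for
the final test. -/
theorem loop_cost_le (he : ∀ u v, 0 ≤ G.evalCost u v) (goals : Finset V) (k : ℕ)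
    (s : SearchState V) (hd : Disjoint s.settled s.queue) :
    (G.loop goals k s).cost ≤ 1 + ∑ u ∈ Finset.univ \ s.settled, G.roundCost u := by
  have h0 : ∀ u, 0 ≤ G.roundCost u := fun u => by
    have := pqCost_nonneg (Fintype.card V)
    have h' : 0 ≤ ∑ v ∈ G.nbr u, (1 + G.evalCost u v + pqCost (Fintype.card V)) :=
      Finset.sum_nonneg fun v _ => by linarith [he u v]
    unfold roundCost
    linarith
  have hsum : ∀ A : Finset V, 0 ≤ ∑ u ∈ A, G.roundCost u :=
    fun A => Finset.sum_nonneg fun u _ => h0 u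
  induction k generalizing s with
  | zero =>
    have h1 : (G.loop goals 0 s).cost = 1 := rfl
    linarith [hsum (Finset.univ \ s.settled)]
  | succ k ih =>
    by_cases h : s.queue.Nonempty
    · have hmem := minVertex_mem s h
      have hns : minVertex s h ∉ s.settled := fun h' => Finset.disjoint_left.1 hd h' hmem
      have h1 := settle_cost_le (G := G) s (minVertex s h)
      have h2 : ∑ u ∈ Finset.univ \ s.settled, G.roundCost u = G.roundCost (minVertex s h) +
          ∑ u ∈ Finset.univ \ insert (minVertex s h) s.settled, G.roundCost u := by
        rw [Finset.sdiff_insert, Finset.add_sum_erase _ _ (by simp [hns])]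
      by_cases hu : minVertex s h ∈ goals
      · rw [loop_succ_of_mem G goals k s h hu]
        simp only
        linarith [hsum (Finset.univ \ insert (minVertex s h) s.settled)]
      · rw [loop_succ_of_not_mem G goals k s h hu]
        have h3 := ih _ (G.settle_disjoint (minVertex s h) hd)
        rw [settle_settled] at h3
        simp only
        linarith
    · rw [loop_succ_of_empty G goals k s h]
      simp only
      linarith [hsum (Finset.univ \ s.settled)]

theorem search_cost_le (he : ∀ u v, 0 ≤ G.evalCost u v) (goals : Finset V) (o : V) (t : ℝ) :
    (G.search goals o t).cost ≤ 1 + ∑ u, G.roundCost u := by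
  have h := G.loop_cost_le he goals (Fintype.card V) ⟨∅, {o}, fun _ => ⟨t, 1, 1⟩⟩ (by simp)
  simpa [search] using h

end SearchGraph

namespace TDNetwork

variable {V : Type*} [Fintype V] [DecidableEq V] {N : TDNetwork V} {Δ : ℕ}

theorem card_bp_le (N : TDNetwork V) {u v : V} (h : v ∈ N.out u) : (N.bp u v).card ≤ N.Kmax :=
  (Finset.le_sup (f := fun v => (N.bp u v).card) h).trans
    (Finset.le_sup (f := fun u => (N.out u).sup fun v => (N.bp u v).card) (Finset.mem_univ u))

/-- The order of magnitude of the cost of a search. -/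
noncomputable def searchScale (N : TDNetwork V) : ℝ :=
  Fintype.card V * lg (Fintype.card V) * lglg N.Kmax

theorem card_le_searchScale (N : TDNetwork V) : (Fintype.card V : ℝ) ≤ N.searchScale := by
  have h : (0 : ℝ) ≤ Fintype.card V := Nat.cast_nonneg _
  unfold searchScale
  rw [mul_assoc]
  exact le_mul_of_one_le_right h
    (one_le_mul_of_one_le_of_one_le (one_le_lg _) (one_le_lglg _))

/-- Only the total number of arcs enters. This matters for the backward search: single in-degrees
need not be bounded by `Δ`, but their sum is that of the out-degrees. -/
theorem sum_roundCost_le (G : SearchGraph V) (N : TDNetwork V) [Nonempty V]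
    (hcard : ∑ u, (G.nbr u).card ≤ Fintype.card V * Δ)
    (he : ∀ u, ∀ v ∈ G.nbr u, G.evalCost u v ≤ lglg N.Kmax) :
    1 + ∑ u, G.roundCost u ≤ (4 + 4 * Δ) * N.searchScale := by
  set n : ℝ := (Fintype.card V : ℝ) with hn
  have hn1 : 1 ≤ n := by
    rw [hn]
    exact_mod_cast Fintype.card_pos (α := V)
  set q := pqCost (Fintype.card V) with hq
  have hq1 : q ≤ 1 + lg n := pqCost_le _
  have hlg := one_le_lg n
  have hK := one_le_lglg N.Kmax
  have h1 : ∀ u, G.roundCost u ≤ 1 + q + (G.nbr u).card * (1 + lglg N.Kmax + q) := by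
    intro u
    unfold SearchGraph.roundCost
    refine add_le_add_right ?_ _
    rw [← nsmul_eq_mul]
    refine Finset.sum_le_card_nsmul _ _ _ fun v hv => ?_
    linarith [he u v hv]
  have h2 : ∑ u, G.roundCost u ≤ n * (1 + q) + n * Δ * (1 + lglg N.Kmax + q) := by
    refine (Finset.sum_le_sum fun u _ => h1 u).trans ?_
    rw [Finset.sum_add_distrib, Finset.sum_const, ← Finset.sum_mul, Finset.card_univ,
      nsmul_eq_mul]
    have : ((∑ u, (G.nbr u).card : ℕ) : ℝ) ≤ ((Fintype.card V * Δ : ℕ) : ℝ) := by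
      exact_mod_cast hcard
    push_cast at this
    have h0 : 0 ≤ 1 + lglg N.Kmax + q := by
      have := pqCost_nonneg (Fintype.card V)
      linarith
    exact add_le_add_right (mul_le_mul_of_nonneg_right this h0) _
  have hΔ : (0 : ℝ) ≤ Δ := Nat.cast_nonneg _
  have h3 : lg n * lglg N.Kmax ≥ lg n := le_mul_of_one_le_right (by linarith) hK
  have h4 : lg n * lglg N.Kmax ≥ lglg N.Kmax := le_mul_of_one_le_left (by linarith) hlg
  set Y := lg n * lglg N.Kmax with hY
  have hscale : N.searchScale = n * Y := by
    unfold searchScale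
    rw [hY, hn, mul_assoc]
  rw [hscale]
  have h5 : n * (1 + q) ≤ n * (3 * Y) := mul_le_mul_of_nonneg_left (by linarith) (by linarith)
  have h6 : n * Δ * (1 + lglg N.Kmax + q) ≤ n * Δ * (4 * Y) :=
    mul_le_mul_of_nonneg_left (by linarith) (by positivity)
  have h7 : 1 ≤ n * Y := one_le_mul_of_one_le_of_one_le hn1 (by linarith)
  linarith

theorem probe_cost_le [Nonempty V] (hΔ : ∀ u, (N.out u).card ≤ Δ) (o : V) (t : ℝ) :
    (N.probe o t).cost ≤ (4 + 4 * Δ) * N.searchScale := by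
  refine (SearchGraph.search_cost_le (fun _ _ => zero_le_one.trans (one_le_lglg _)) _ _ _).trans
    (sum_roundCost_le _ N ?_ fun u v hv => lglg_mono (N.card_bp_le hv))
  rw [← smul_eq_mul]
  exact Finset.sum_le_card_nsmul _ _ _ fun u _ => hΔ u

theorem reverseProbe_cost_le [Nonempty V] (hΔ : ∀ u, (N.out u).card ≤ Δ) (o : V) (t : ℝ) :
    (N.reverseProbe o t).cost ≤ (4 + 4 * Δ) * N.searchScale := by
  refine (SearchGraph.search_cost_le (fun _ _ => zero_le_one.trans (one_le_lglg _)) _ _ _).trans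
    (sum_roundCost_le _ N ?_ fun u v hv =>
      lglg_mono (N.card_bp_le ((N.mem_backward_nbr).1 hv)))
  have : ∑ u, (N.backward.nbr u).card = ∑ u, (N.out u).card := by
    have h := Finset.sum_card_bipartiteAbove_eq_sum_card_bipartiteBelow
      (s := (Finset.univ : Finset V)) (t := (Finset.univ : Finset V)) fun v u => v ∈ N.out u
    simpa [Finset.bipartiteAbove, Finset.bipartiteBelow, backward] using h
  rw [this, ← smul_eq_mul]
  exact Finset.sum_le_card_nsmul _ _ _ fun u _ => hΔ u

/-! ### Space and time of the preprocessing -/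

theorem length_points_le (e : Ends) : e.points.length ≤ 2 := by
  unfold Ends.points
  split_ifs <;> simp

theorem sum_points_le (A : Finset V) (e : V → Ends) :
    ∑ v ∈ A, ((e v).points.length : ℝ) ≤ 2 * A.card := by
  rw [mul_comm, ← nsmul_eq_mul]
  exact Finset.sum_le_card_nsmul _ _ _ fun v _ => by exact_mod_cast length_points_le (e v)

/-- Every branching node uses one probe and, like every leaf, at most `4 n` further steps. A binary
tree has one leaf more than it has branching nodes, so each probe is charged `8 n` and one `4 n` is
left over. -/
theorem bisect_cost_le {P : ℝ} (hP : ∀ o t, (N.probe o t).cost ≤ P) [Nonempty V] (ε : ℝ) (l : V)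
    (k : ℕ) (A : Finset V) (x y : ℝ) (a b : V → Label) :
    (N.bisect ε l k A x y a b).cost ≤
      (N.bisect ε l k A x y a b).val.probes * (P + 8 * Fintype.card V) + 4 * Fintype.card V := by
  classical
  have hn1 : (1 : ℝ) ≤ Fintype.card V := by exact_mod_cast Fintype.card_pos (α := V)
  have hcard : ∀ A : Finset V, (A.card : ℝ) ≤ Fintype.card V := fun A => by
    exact_mod_cast Finset.card_le_univ A
  have hleaf : ∀ (A : Finset V) (e : V → Ends),
      1 + ∑ v ∈ A, (1 + ((e v).points.length : ℝ)) ≤ 4 * Fintype.card V := by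
    intro A e
    rw [Finset.sum_add_distrib, Finset.sum_const, nsmul_eq_mul, mul_one]
    linarith [sum_points_le A e, hcard A]
  induction k generalizing A x y a b with
  | zero => simpa [bisect] using hleaf A fun v => ends x y (a v) (b v)
  | succ k ih =>
    simp only [bisect]
    split_ifs with hA
    · simpa using hleaf A fun v => ends x y (a v) (b v)
    · dsimp only
      set A' := A.filter fun v => (ends x y (a v) (b v)).Active ε
      have h1 := ih A' x ((x + y) / 2) a (N.probe l ((x + y) / 2)).val
      have h2 := ih A' ((x + y) / 2) y (N.probe l ((x + y) / 2)).val b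
      have h3 := hP l ((x + y) / 2)
      have h4 : ∑ v ∈ A \ A', ((ends x y (a v) (b v)).points.length : ℝ) ≤
          2 * Fintype.card V :=
        (sum_points_le _ _).trans (mul_le_mul_of_nonneg_left (hcard _) zero_le_two)
      push_cast
      linarith [hcard A]

/-- The two probes at the ends, charged `8 n` each, absorb the remaining `4 n`. -/
theorem bisectInterval_cost_le {P : ℝ} (hP : ∀ o t, (N.probe o t).cost ≤ P) [Nonempty V]
    (ε : ℝ) (l : V) (I : ℝ × ℝ) :
    (N.bisectInterval ε l I).cost ≤
      (N.bisectInterval ε l I).val.probes * (P + 8 * Fintype.card V) := by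
  have h1 := bisect_cost_le hP ε l (N.depth ε l I.1 I.2) Finset.univ I.1 I.2
    (N.probe l I.1).val (N.probe l I.2).val
  have h2 := hP l I.1
  have h3 := hP l I.2
  have hn : (0 : ℝ) ≤ Fintype.card V := Nat.cast_nonneg _
  simp only [bisectInterval]
  push_cast
  linarith

theorem List.le_foldr_max {α : Type*} (g : α → ℕ) {l : List α} {a : α} (h : a ∈ l) :
    g a ≤ (l.map g).foldr max 0 := by
  induction l with
  | nil => simp at h
  | cons b l ih =>
    rcases List.mem_cons.1 h with rfl | h
    · exact le_max_left _ _
    · exact (ih h).trans (le_max_right _ _)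

theorem length_pts_le_U (N : TDNetwork V) (ε : ℝ) (l v : V) {I : ℝ × ℝ}
    (hI : I ∈ N.intervals l) : ((N.bisectInterval ε l I).val.pts v).length + 1 ≤ N.U ε :=
  (List.le_foldr_max (fun I => ((N.bisectInterval ε l I).val.pts v).length + 1) hI).trans
    ((Finset.le_sup (f := fun v => ((N.intervals l).map fun I =>
      ((N.bisectInterval ε l I).val.pts v).length + 1).foldr max 0) (Finset.mem_univ v)).trans
    (Finset.le_sup (f := fun l => Finset.univ.sup fun v => ((N.intervals l).map fun I =>
      ((N.bisectInterval ε l I).val.pts v).length + 1).foldr max 0) (Finset.mem_univ l)))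

theorem probes_le_TDP (N : TDNetwork V) (ε : ℝ) (l : V) {I : ℝ × ℝ} (hI : I ∈ N.intervals l) :
    (N.bisectInterval ε l I).val.probes ≤ N.TDP ε :=
  (List.le_foldr_max (fun I => (N.bisectInterval ε l I).val.probes) hI).trans
    (Finset.le_sup (f := fun l => ((N.intervals l).map fun I =>
      (N.bisectInterval ε l I).val.probes).foldr max 0) (Finset.mem_univ l))

theorem intervals_length (N : TDNetwork V) (l : V) :
    N.intervals l ≠ [] ∧ (N.intervals l).length ≤ N.Kstar + 1 := by
  obtain ⟨c, h1, _, h3, _, _, h6⟩ := N.intervals_spec l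
  rw [h1]
  constructor
  · cases c with
    | nil => simp at h3
    | cons a c => simp
  · simpa [List.length_zip] using h6

/-- `U` allows each interval one breakpoint more than is stored for it; one of these spare places is
used for the closing breakpoint at `T`. -/
theorem length_summaries_le (N : TDNetwork V) (ε : ℝ) (l v : V) :
    ((N.summaries ε l).val v).length ≤ (N.Kstar + 1) * N.U ε := by
  obtain ⟨hne, hlen⟩ := N.intervals_length l
  rw [summaries_val, List.length_append, List.length_flatten, List.map_map, List.length_singleton]
  refine le_trans ?_ (Nat.mul_le_mul_right _ hlen)
  have key : ∀ L : List (ℝ × ℝ), L ≠ [] → (∀ I ∈ L, I ∈ N.intervals l) →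
      (L.map (List.length ∘ fun I => (N.bisectInterval ε l I).val.pts v)).sum + 1 ≤
        L.length * N.U ε := by
    intro L
    induction L with
    | nil => simp
    | cons I L ih =>
      intro _ hL
      have h1 := N.length_pts_le_U ε l v (hL I (by simp))
      rw [List.map_cons, List.sum_cons, List.length_cons, add_mul, one_mul]
      simp only [Function.comp_apply]
      by_cases hL0 : L = []
      · subst hL0
        simpa using h1
      · have h2 := ih hL0 fun J hJ => hL J (List.mem_cons_of_mem _ hJ)
        omega
  exact key _ hne fun _ h => h

theorem two_le_TDP (N : TDNetwork V) [Nonempty V] (ε : ℝ) : 2 ≤ N.TDP ε := by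
  obtain ⟨l⟩ := ‹Nonempty V›
  obtain ⟨I, hI⟩ := List.exists_mem_of_ne_nil _ (N.intervals_length l).1
  exact (Nat.le_add_right 2 _).trans (N.probes_le_TDP ε l hI)

theorem Kstar_le (hΔ : ∀ u, (N.out u).card ≤ Δ) : N.Kstar ≤ Fintype.card V * Δ * N.Kmax := by
  rw [mul_assoc]
  refine Finset.card_biUnion_le_card_mul _ _ _ fun u _ => ?_
  refine (Finset.card_biUnion_le_card_mul _ _ N.Kmax fun v hv => ?_).trans
    (Nat.mul_le_mul_right _ (hΔ u))
  exact Finset.card_image_le.trans ((Finset.card_filter_le _ _).trans (N.card_bp_le hv))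

/-- Sorting costs `lglg K*` per image; `Kstar_le` converts this into the factors `lg n` and `lglg
Kmax` of the claimed time. -/
theorem lglg_Kstar_le (hΔ : ∀ u, (N.out u).card ≤ Δ) (h : 0 < N.Kstar) :
    lglg N.Kstar ≤ (4 + lg Δ) * (lg (Fintype.card V) * lglg N.Kmax) := by
  have h1 := Kstar_le hΔ
  have h2 : 0 < Fintype.card V * Δ * N.Kmax := h.trans_le h1
  have hK : 0 < N.Kmax := Nat.pos_of_mul_pos_left h2
  have h3 : 0 < Fintype.card V * Δ := Nat.pos_of_mul_pos_right h2
  have hD : 0 < Δ := Nat.pos_of_mul_pos_left h3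
  have hn : 0 < Fintype.card V := Nat.pos_of_mul_pos_right h3
  refine (lglg_mono h1).trans ((lglg_mul_le hn hD hK).trans ?_)
  have h4 := one_le_lg (Fintype.card V)
  have h5 := one_le_lg Δ
  have h6 := one_le_lglg N.Kmax
  have h7 : lg (Fintype.card V) * lglg N.Kmax ≥ lg (Fintype.card V) :=
    le_mul_of_one_le_right (by linarith) h6
  have h8 : lg (Fintype.card V) * lglg N.Kmax ≥ lglg N.Kmax :=
    le_mul_of_one_le_left (by linarith) h4
  nlinarith

/-- The constant consists of `5 + lg Δ` for sorting, `12 + 4 Δ` for the bisections, `4 + 4 Δ` for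
the probe at `T` and `1` for the closing breakpoints. -/
theorem summaries_cost_le [Nonempty V] (hΔ : ∀ u, (N.out u).card ≤ Δ) (ε : ℝ) (l : V) :
    (N.summaries ε l).cost ≤
      (22 + 8 * Δ + lg Δ) * ((1 + N.Kstar) * N.searchScale * N.TDP ε) := by
  set X := N.searchScale with hX
  set n : ℝ := (Fintype.card V : ℝ) with hn
  have hn1 : 1 ≤ n := by
    rw [hn]
    exact_mod_cast Fintype.card_pos (α := V)
  have hnX : n ≤ X := N.card_le_searchScale
  have hX0 : 0 ≤ X := by linarith
  have hT : (2 : ℝ) ≤ N.TDP ε := by exact_mod_cast N.two_le_TDP ε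
  have hKs : (0 : ℝ) ≤ N.Kstar := Nat.cast_nonneg _
  have hD : (0 : ℝ) ≤ Δ := Nat.cast_nonneg _
  have hlD := one_le_lg Δ
  have hP : ∀ o t, (N.probe o t).cost ≤ (4 + 4 * Δ) * X := fun o t => probe_cost_le hΔ o t
  have h1 : N.Kstar * (1 + lglg N.Kstar) ≤ (5 + lg Δ) * (N.Kstar * X) := by
    rcases Nat.eq_zero_or_pos N.Kstar with h0 | hpos
    · simp [h0]
    · have h2 := lglg_Kstar_le hΔ hpos
      have h3 : lg n * lglg N.Kmax ≤ X := by
        rw [hX]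
        unfold searchScale
        rw [mul_assoc]
        refine le_mul_of_one_le_left ?_ hn1
        have := one_le_lg n
        have := one_le_lglg N.Kmax
        positivity
      have h4 : lglg N.Kstar ≤ (4 + lg Δ) * X :=
        h2.trans (mul_le_mul_of_nonneg_left h3 (by linarith))
      have h5 : 1 + lglg N.Kstar ≤ (5 + lg Δ) * X := by linarith
      have h6 := mul_le_mul_of_nonneg_left h5 hKs
      linarith
  have h2 : (((N.intervals l).map (N.bisectInterval ε l)).map Timed.cost).sum ≤
      (1 + N.Kstar) * (N.TDP ε * ((12 + 4 * Δ) * X)) := by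
    rw [List.map_map]
    have h3 : ∀ c ∈ (N.intervals l).map (Timed.cost ∘ N.bisectInterval ε l),
        c ≤ N.TDP ε * ((12 + 4 * Δ) * X) := by
      intro c hcm
      obtain ⟨I, hI, rfl⟩ := List.mem_map.1 hcm
      refine (bisectInterval_cost_le hP ε l I).trans ?_
      refine mul_le_mul ?_ ?_ (by positivity) (by positivity)
      · exact_mod_cast N.probes_le_TDP ε l hI
      · linarith
    have h4 := List.sum_le_card_nsmul _ _ h3
    rw [List.length_map, nsmul_eq_mul] at h4
    refine h4.trans (mul_le_mul_of_nonneg_right ?_ (by positivity))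
    have := (N.intervals_length l).2
    have h5 : ((N.intervals l).length : ℝ) ≤ N.Kstar + 1 := by exact_mod_cast this
    linarith
  have h3 := hP l N.T
  simp only [summaries]
  rw [← hn]
  have h4 : N.Kstar * X ≤ (1 + N.Kstar) * X * N.TDP ε := by
    have : (1 + N.Kstar) * X * 1 ≤ (1 + N.Kstar) * X * N.TDP ε :=
      mul_le_mul_of_nonneg_left (by linarith) (by positivity)
    linarith
  have h5 : X ≤ (1 + N.Kstar) * X * N.TDP ε := by
    have : (1 + N.Kstar) * X * 1 ≤ (1 + N.Kstar) * X * N.TDP ε :=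
      mul_le_mul_of_nonneg_left (by linarith) (by positivity)
    have h6 : 0 ≤ N.Kstar * X := by positivity
    linarith
  have h6 := mul_le_mul_of_nonneg_left h4 (by linarith : 0 ≤ 5 + lg Δ)
  have h7 := mul_le_mul_of_nonneg_left h5 (by linarith : (0 : ℝ) ≤ 4 + 4 * Δ)
  linarith

/-- The reverse probes are run once for all landmarks. If there is a landmark, it can bear their
cost, which adds `4 + 4 Δ`; for `L = ∅` nothing is done, which is what makes a bound proportional to
`|L|` possible. -/
theorem preprocess_cost_le [Nonempty V] (hΔ : ∀ u, (N.out u).card ≤ Δ) (ε : ℝ) (L : Finset V) :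
    (N.preprocess ε L).cost ≤
      ∑ _l ∈ L, (26 + 12 * Δ + lg Δ) * ((1 + N.Kstar) * N.searchScale * N.TDP ε) := by
  have hT : (2 : ℝ) ≤ N.TDP ε := by exact_mod_cast N.two_le_TDP ε
  have hX0 : 0 ≤ N.searchScale := (Nat.cast_nonneg _).trans N.card_le_searchScale
  have hKs : (0 : ℝ) ≤ N.Kstar := Nat.cast_nonneg _
  by_cases hL : L = ∅
  · simp [preprocess, hL]
  · simp only [preprocess, if_neg hL]
    have h1 : ∑ b ∈ N.spoiling, (N.reverseProbe b.1.1 b.2).cost ≤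
        N.Kstar * ((4 + 4 * Δ) * N.searchScale) := by
      unfold Kstar
      rw [← nsmul_eq_mul]
      exact Finset.sum_le_card_nsmul _ _ _ fun b _ => reverseProbe_cost_le hΔ _ _
    have h2 : N.Kstar * ((4 + 4 * Δ) * N.searchScale) ≤
        (4 + 4 * Δ) * ((1 + N.Kstar) * N.searchScale * N.TDP ε) := by
      have : (1 + N.Kstar) * N.searchScale * 1 ≤ (1 + N.Kstar) * N.searchScale * N.TDP ε :=
        mul_le_mul_of_nonneg_left (by linarith) (by positivity)
      have h3 : N.Kstar * N.searchScale ≤ (1 + N.Kstar) * N.searchScale * N.TDP ε := by linarith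
      have := mul_le_mul_of_nonneg_left h3 (by positivity : (0 : ℝ) ≤ 4 + 4 * Δ)
      linarith
    have h3 : ∑ l ∈ L, (N.summaries ε l).cost ≤
        ∑ _l ∈ L, (22 + 8 * Δ + lg Δ) * ((1 + N.Kstar) * N.searchScale * N.TDP ε) :=
      Finset.sum_le_sum fun l _ => summaries_cost_le hΔ ε l
    have h4 : (1 : ℝ) ≤ L.card := by
      exact_mod_cast Finset.card_pos.2 (Finset.nonempty_iff_ne_empty.2 hL)
    have h5 : (4 + 4 * Δ) * ((1 + N.Kstar) * N.searchScale * N.TDP ε) ≤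
        ∑ _l ∈ L, (4 + 4 * Δ : ℝ) * ((1 + N.Kstar) * N.searchScale * N.TDP ε) := by
      rw [Finset.sum_const, nsmul_eq_mul]
      exact le_mul_of_one_le_left (by positivity) h4
    have h6 := add_le_add (h1.trans (h2.trans h5)) h3
    rw [← Finset.sum_add_distrib] at h6
    refine h6.trans (le_of_eq (Finset.sum_congr rfl fun _ _ => ?_))
    ring

theorem expected_time_le {ρ : ℝ} (hρ : ρ ∈ Set.Ioo (0 : ℝ) 1) (hΔ : ∀ u, (N.out u).card ≤ Δ)
    (ε : ℝ) : landmarkExpectation ρ (fun L : Finset V => (N.preprocess ε L).cost) ≤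
      (26 + 12 * Δ + lg Δ) * (ρ * (Fintype.card V : ℝ) ^ 2 * (1 + N.Kstar) *
        lg (Fintype.card V) * lglg N.Kmax * N.TDP ε) := by
  rcases isEmpty_or_nonempty V with hV | hV
  · have h1 : ∀ L : Finset V, (N.preprocess ε L).cost ≤ ∑ _l ∈ L, 0 := fun L => by
      simp [preprocess, L.eq_empty_of_isEmpty]
    refine (landmarkExpectation_le_of_le_sum hρ h1).trans (le_of_eq ?_)
    simp
  · refine (landmarkExpectation_le_of_le_sum hρ fun L => preprocess_cost_le hΔ ε L).trans
      (le_of_eq ?_)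
    unfold searchScale
    ring

theorem space_le (N : TDNetwork V) (ε : ℝ) (L : Finset V) :
    (N.space ε L : ℝ) ≤ ∑ _l ∈ L, Fintype.card V * ((1 + N.Kstar) * N.U ε : ℝ) := by
  have h : N.space ε L ≤ ∑ _l ∈ L, Fintype.card V * ((1 + N.Kstar) * N.U ε) := by
    refine Finset.sum_le_sum fun l hl => ?_
    rw [← smul_eq_mul, ← Finset.card_univ]
    refine Finset.sum_le_card_nsmul _ _ _ fun v _ => ?_
    simp only [preprocess, if_pos hl]
    rw [add_comm 1]
    exact N.length_summaries_le ε l v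
  exact_mod_cast h

theorem expected_space_le {ρ : ℝ} (hρ : ρ ∈ Set.Ioo (0 : ℝ) 1) (N : TDNetwork V) (ε : ℝ) :
    landmarkExpectation ρ (fun L : Finset V => (N.space ε L : ℝ)) ≤
      ρ * (Fintype.card V : ℝ) ^ 2 * (1 + N.Kstar) * N.U ε := by
  refine (landmarkExpectation_le_of_le_sum hρ (N.space_le ε)).trans (le_of_eq ?_)
  ring

end TDNetwork

/-- The potential of a state of a ball decreases in expectation. -/
theorem potential_step {ρ y : ℝ} (hρ : ρ ∈ Set.Ioo (0 : ℝ) 1) (q : ℕ) (hy : 2 * q ≤ y)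
    (hy0 : 0 < y) : (1 - ρ) * (y + ρ) ^ q ≤ (1 - ρ / 2) * y ^ q := by
  have hρ0 := hρ.1
  have hρ1 := hρ.2
  set x := ρ / y with hx
  have hxy : x * y = ρ := div_mul_cancel₀ _ hy0.ne'
  have hx0 : 0 < x := div_pos hρ0 hy0
  have h1 : q * x ≤ ρ / 2 := by
    have := mul_le_mul_of_nonneg_right hy hx0.le
    linarith
  rcases Nat.eq_zero_or_pos q with rfl | hq
  · simp
    linarith
  have hq1 : (1 : ℝ) ≤ q := by exact_mod_cast hq
  have hx1 : x ≤ 1 := by nlinarith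
  -- Bernoulli's inequality bounds `(1 - x) ^ q` from below and thereby, as `(1 + x) (1 - x) ≤ 1`,
  -- the growth factor `(1 + x) ^ q` from above.
  have h2 : 1 - ρ / 2 ≤ (1 - x) ^ q := by
    have := one_add_mul_le_pow (a := -x) (by linarith) q
    rw [← sub_eq_add_neg] at this
    linarith
  have h3 : (1 + x) ^ q * (1 - x) ^ q ≤ 1 := by
    rw [← mul_pow]
    refine pow_le_one₀ ?_ ?_ <;> nlinarith
  have h4 : (y + ρ) ^ q = y ^ q * (1 + x) ^ q := by
    rw [← mul_pow, mul_add, mul_one, mul_comm y, hxy]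
  have h5 : 0 ≤ (1 + x) ^ q := by positivity
  have h6 : (1 + x) ^ q * (1 - ρ / 2) ≤ 1 := (mul_le_mul_of_nonneg_left h2 h5).trans h3
  -- Of the two factors `1 - ρ / 2`, one pays for the growth of the potential and the other is the
  -- gain.
  have h7 : (1 - ρ) ≤ (1 - ρ / 2) * (1 - ρ / 2) := by nlinarith
  have h8 : (1 - ρ) * (1 + x) ^ q ≤ 1 - ρ / 2 := by
    calc (1 - ρ) * (1 + x) ^ q ≤ (1 - ρ / 2) * (1 - ρ / 2) * (1 + x) ^ q :=
          mul_le_mul_of_nonneg_right h7 h5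
      _ = (1 - ρ / 2) * ((1 + x) ^ q * (1 - ρ / 2)) := by ring
      _ ≤ (1 - ρ / 2) * 1 := mul_le_mul_of_nonneg_left h6 (by linarith)
      _ = 1 - ρ / 2 := mul_one _
  rw [h4]
  have := mul_le_mul_of_nonneg_right h8 (pow_nonneg hy0.le q)
  linarith

/-! ### Expected cost of growing a ball -/

namespace SearchGraph

variable {V : Type*} [Fintype V] [DecidableEq V] (G : SearchGraph V)

theorem settle_cost_nonneg (he : ∀ u v, 0 ≤ G.evalCost u v) (s : SearchState V) (u : V) :
    0 ≤ (G.settle s u).cost := by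
  refine add_nonneg (pqCost_nonneg _) (Finset.sum_nonneg fun v _ => ?_)
  have := pqCost_nonneg (s.queue.erase u ∪ (G.nbr u \ insert u s.settled)).card
  linarith [he u v]

theorem loop_cost_nonneg (he : ∀ u v, 0 ≤ G.evalCost u v) (goals : Finset V) (k : ℕ)
    (s : SearchState V) : 0 ≤ (G.loop goals k s).cost := by
  induction k generalizing s with
  | zero => exact zero_le_one
  | succ k ih =>
    by_cases h : s.queue.Nonempty
    · have h1 := G.settle_cost_nonneg he s (minVertex s h)
      by_cases hu : minVertex s h ∈ goals
      · rw [loop_succ_of_mem G goals k s h hu]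
        simp only
        linarith
      · rw [loop_succ_of_not_mem G goals k s h hu]
        simp only
        linarith [ih (G.settle s (minVertex s h)).val]
    · rw [loop_succ_of_empty G goals k s h]
      exact zero_le_one

theorem settle_queue_card_le {Δ : ℕ} (hΔ : ∀ u, (G.nbr u).card ≤ Δ) {s : SearchState V} {u : V}
    (hu : u ∈ s.queue) : (G.settle s u).val.queue.card + 1 ≤ s.queue.card + Δ := by
  rw [settle_queue]
  have h1 := Finset.card_union_le (s.queue.erase u) (G.nbr u \ insert u s.settled)
  have h2 := Finset.card_le_card (Finset.sdiff_subset (s := G.nbr u) (t := insert u s.settled))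
  have h3 := Finset.card_erase_add_one hu
  have h4 := hΔ u
  omega

/-- The cost of growing a ball until a goal is settled, and of what is done then. -/
noncomputable def loopCost (post : SearchState V → V → ℝ) (goals : Finset V) (k : ℕ)
    (s : SearchState V) : ℝ :=
  (G.loop goals k s).cost + (G.loop goals k s).val.2.elim 0 (post (G.loop goals k s).val.1)

/-- The expected cost of growing a ball, on the event that the random set `L` contains `M` and is
disjoint from `S`. -/
theorem expected_loopCost_le {Δ : ℕ} (hΔ : ∀ u, (G.nbr u).card ≤ Δ) {ρ A P Y : ℝ} {q : ℕ}
    (hρ : ρ ∈ Set.Ioo (0 : ℝ) 1) (hA : 1 ≤ A) (hP : 0 ≤ P) (hY : 2 * q ≤ Y) (hY1 : 1 ≤ Y)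
    (post : Finset V → SearchState V → V → ℝ) (d : V) (hd : ∀ L s, post L s d = 0)
    (hround : ∀ (s : SearchState V) (u : V), u ∈ s.queue →
      s.queue.card ≤ Δ * s.settled.card + 1 →
      1 + (G.settle s u).cost ≤ A * (Y + ρ * s.settled.card) ^ q)
    (hpost : ∀ (S M : Finset V) (s : SearchState V) (l : V), Disjoint S M → l ∈ M →
      s.queue.card ≤ Δ * (S.card + 1) + 1 →
      restrictedExpectation ρ S M (fun L => post L s l) ≤
        ρ ^ M.card * (1 - ρ) ^ S.card * (P * (Y + ρ * S.card) ^ q))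
    (k : ℕ) (s : SearchState V) (S M : Finset V) (hSM : Disjoint S M) (hS : s.settled ⊆ S)
    (hsq : Disjoint s.settled s.queue) (hq : s.queue.card ≤ Δ * s.settled.card + 1) :
    restrictedExpectation ρ S M (fun L => G.loopCost (post L) (insert d L) k s) ≤
      ρ ^ M.card * (1 - ρ) ^ S.card *
        (((S \ s.settled).card * A + 2 / ρ * (A + ρ * P)) * (Y + ρ * S.card) ^ q) := by
  have hρ0 := hρ.1
  have hρ1 : 0 < 1 - ρ := sub_pos.2 hρ.2
  have hw : ∀ S M : Finset V, 0 ≤ ρ ^ M.card * (1 - ρ) ^ S.card := fun S M => by positivity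
  have hg1 : ∀ n : ℕ, 1 ≤ (Y + ρ * n) ^ q := fun n =>
    one_le_pow₀ (by have : 0 ≤ ρ * n := by positivity
                    linarith)
  have h2A : 2 / ρ * (A + ρ * P) = 2 / ρ * A + 2 * P := by
    field_simp
  have hρA : 2 * A ≤ 2 / ρ * A := by
    refine mul_le_mul_of_nonneg_right ?_ (by linarith)
    rw [le_div_iff₀ hρ0]
    linarith [hρ.2]
  -- For the cases in which the ball stops for certain: one round and one `post` are covered by `2 /
  -- ρ * A + 2 * P`.
  have hconst : ∀ (s : SearchState V) (S M : Finset V) {c : ℝ}, c ≤ (A + P) * (Y + ρ * S.card) ^ q →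
      ρ ^ M.card * (1 - ρ) ^ S.card * c ≤ ρ ^ M.card * (1 - ρ) ^ S.card *
        (((S \ s.settled).card * A + 2 / ρ * (A + ρ * P)) * (Y + ρ * S.card) ^ q) := by
    intro s S M c hc
    refine mul_le_mul_of_nonneg_left (hc.trans (mul_le_mul_of_nonneg_right ?_
      (zero_le_one.trans (hg1 _)))) (hw S M)
    have : 0 ≤ ((S \ s.settled).card : ℝ) * A := by positivity
    rw [h2A]
    linarith
  have hA1 : ∀ n, 1 ≤ A * (Y + ρ * (n : ℕ)) ^ q := fun n =>
    one_le_mul_of_one_le_of_one_le hA (hg1 n)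
  have hP0 : ∀ n, 0 ≤ P * (Y + ρ * (n : ℕ)) ^ q := fun n =>
    mul_nonneg hP (zero_le_one.trans (hg1 n))
  induction k generalizing s S M with
  | zero =>
    have h1 : (fun L => G.loopCost (post L) (insert d L) 0 s) = fun _ => 1 := by
      funext L
      simp [loopCost, loop]
    rw [h1, restrictedExpectation_const ρ hSM]
    exact hconst s S M (by linarith [hA1 S.card, hP0 S.card])
  | succ k ih =>
    by_cases h : s.queue.Nonempty
    swap
    · have h1 : (fun L => G.loopCost (post L) (insert d L) (k + 1) s) = fun _ => 1 := by
        funext L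
        rw [loopCost, loop_succ_of_empty G _ k s h]
        simp
      rw [h1, restrictedExpectation_const ρ hSM]
      exact hconst s S M (by linarith [hA1 S.card, hP0 S.card])
    set u := minVertex s h with hu
    have huq : u ∈ s.queue := minVertex_mem s h
    have hus : u ∉ s.settled := fun h' => Finset.disjoint_left.1 hsq h' huq
    set s' := (G.settle s u).val with hs'
    obtain ⟨c₀, hc₀⟩ : ∃ c, c = 1 + (G.settle s u).cost := ⟨_, rfl⟩
    have hset : s'.settled = insert u s.settled := rfl
    have hcard' : s'.settled.card = s.settled.card + 1 := by
      rw [hset, Finset.card_insert_of_notMem hus]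
    have hq' : s'.queue.card + 1 ≤ s.queue.card + Δ := G.settle_queue_card_le hΔ huq
    have hq'' : s'.queue.card ≤ Δ * s'.settled.card + 1 := by
      rw [hcard', mul_add]
      omega
    have hsS : s.settled.card ≤ S.card := Finset.card_le_card hS
    have hqS : s'.queue.card ≤ Δ * (S.card + 1) + 1 := by
      refine hq''.trans ?_
      rw [hcard']
      gcongr
    have hc₀le : c₀ ≤ A * (Y + ρ * S.card) ^ q := by
      refine (hc₀.le.trans (hround s u huq hq)).trans (mul_le_mul_of_nonneg_left ?_ (by linarith))
      have : (s.settled.card : ℝ) ≤ S.card := by exact_mod_cast hsS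
      have h0 : 0 ≤ ρ * (s.settled.card : ℝ) := by positivity
      gcongr
    have hgoal : ∀ L : Finset V, u ∈ insert d L →
        G.loopCost (post L) (insert d L) (k + 1) s = c₀ + post L s' u := by
      intro L hL
      rw [loopCost, loop_succ_of_mem G _ k s h hL, hc₀]
      rfl
    have hcont : ∀ L : Finset V, u ∉ insert d L →
        G.loopCost (post L) (insert d L) (k + 1) s =
          c₀ + G.loopCost (post L) (insert d L) k s' := by
      intro L hL
      rw [loopCost, loop_succ_of_not_mem G _ k s h hL]
      simp only [loopCost, hc₀]
      ring
    have hleave : ∀ M', Disjoint S M' → u ∈ M' →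
        restrictedExpectation ρ S M' (fun L => G.loopCost (post L) (insert d L) (k + 1) s) ≤
          ρ ^ M'.card * (1 - ρ) ^ S.card * (c₀ + P * (Y + ρ * S.card) ^ q) := by
      intro M' hd' hM'
      refine (restrictedExpectation_mono hρ
        fun L _ hL => (hgoal L (Finset.mem_insert_of_mem (hL hM'))).le).trans ?_
      rw [restrictedExpectation_add, restrictedExpectation_const ρ hd', mul_add]
      exact add_le_add_right (hpost S M' s' u hd' hM' hqS) _
    by_cases hud : u = d
    · have h1 : (fun L => G.loopCost (post L) (insert d L) (k + 1) s) = fun _ => c₀ := by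
        funext L
        rw [hgoal L (hud ▸ Finset.mem_insert_self _ _), hud, hd, add_zero]
      rw [h1, restrictedExpectation_const ρ hSM]
      exact hconst s S M (by linarith [hP0 S.card])
    have hgo : ∀ S', Disjoint S' M → insert u s.settled ⊆ S' →
        restrictedExpectation ρ S' M (fun L => G.loopCost (post L) (insert d L) (k + 1) s) ≤
          ρ ^ M.card * (1 - ρ) ^ S'.card * (c₀ + ((S' \ insert u s.settled).card * A +
            2 / ρ * (A + ρ * P)) * (Y + ρ * S'.card) ^ q) := by
      intro S' hd' hS'
      have huS' : u ∈ S' := hS' (Finset.mem_insert_self _ _)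
      refine (restrictedExpectation_mono hρ fun L hL _ => (hcont L ?_).le).trans ?_
      · rw [Finset.mem_insert, not_or]
        exact ⟨hud, Finset.disjoint_left.1 hL huS'⟩
      · rw [restrictedExpectation_add, restrictedExpectation_const ρ hd', mul_add]
        exact add_le_add_right (ih s' S' M hd' hS' (G.settle_disjoint u hsq) hq'') _
    -- A vertex already known to be no landmark is passed without a random decision; the summand
    -- with `S \ s.settled` pays for these rounds one by one.
    by_cases huS : u ∈ S
    · refine (hgo S hSM (Finset.insert_subset huS hS)).trans
        (mul_le_mul_of_nonneg_left ?_ (hw S M))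
      have h1 : ((S \ s.settled).card : ℝ) = (S \ insert u s.settled).card + 1 := by
        have : (S \ insert u s.settled).card + 1 = (S \ s.settled).card := by
          rw [Finset.sdiff_insert]
          exact Finset.card_erase_add_one (Finset.mem_sdiff.2 ⟨huS, hus⟩)
        exact_mod_cast this.symm
      rw [h1]
      linarith
    by_cases huM : u ∈ M
    · exact (hleave M hSM huM).trans (hconst s S M (by linarith))
    -- An undecided vertex. By `potential_step` the weighted potential loses the fraction `ρ / 2`;
    -- multiplied by `2 / ρ * (A + ρ * P)` this releases `A + ρ * P`, the cost of this round plus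
    -- the expected cost of stopping here.
    · rw [restrictedExpectation_split u]
      have h1 := hgo (insert u S) (Finset.disjoint_insert_left.2 ⟨huM, hSM⟩)
        (Finset.insert_subset_insert u hS)
      have h2 := hleave (insert u M) (Finset.disjoint_insert_right.2 ⟨huS, hSM⟩)
        (Finset.mem_insert_self _ _)
      have h3 : (insert u S \ insert u s.settled) = S \ s.settled := by
        ext z
        simp only [Finset.mem_sdiff, Finset.mem_insert, not_or]
        constructor
        · rintro ⟨h4 | h4, h5, h6⟩
          · exact absurd h4 h5
          · exact ⟨h4, h6⟩
        · rintro ⟨h4, h5⟩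
          exact ⟨Or.inr h4, fun h6 => huS (h6 ▸ h4), h5⟩
      rw [h3, Finset.card_insert_of_notMem huS, pow_succ] at h1
      rw [Finset.card_insert_of_notMem huM, pow_succ] at h2
      refine (add_le_add h1 h2).trans ?_
      set W := ρ ^ M.card * (1 - ρ) ^ S.card with hW
      have hW0 : 0 ≤ W := hw S M
      have hy0 : 0 ≤ ρ * (S.card : ℝ) := by positivity
      have hstep := potential_step hρ q (y := Y + ρ * S.card) (by linarith) (by linarith)
      have he : Y + ρ * S.card + ρ = Y + ρ * ((S.card + 1 : ℕ) : ℝ) := by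
        push_cast
        ring
      rw [he] at hstep
      set b : ℝ := ((S \ s.settled).card : ℝ) * A with hb
      have hb0 : 0 ≤ b := by positivity
      set g := (Y + ρ * S.card) ^ q
      set g' := (Y + ρ * ((S.card + 1 : ℕ) : ℝ)) ^ q
      have hg : 1 ≤ g := hg1 _
      have hA0 : 0 ≤ 2 / ρ * (A + ρ * P) := by positivity
      have h4 : (1 - ρ) * g' ≤ g - ρ / 2 * g := by linarith
      have h5 := mul_le_mul_of_nonneg_left h4 (add_nonneg hb0 hA0)
      have h6 : 2 / ρ * (A + ρ * P) * (ρ / 2 * g) = (A + ρ * P) * g := by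
        field_simp
      have h7 : 0 ≤ b * (ρ / 2 * g) := by positivity
      have h8 : (1 - ρ) * (c₀ + (b + 2 / ρ * (A + ρ * P)) * g') + ρ * (c₀ + P * g) ≤
          (b + 2 / ρ * (A + ρ * P)) * g := by linarith
      have h9 := mul_le_mul_of_nonneg_left h8 hW0
      refine le_trans (le_of_eq ?_) h9
      rw [hW]
      ring

end SearchGraph

/-! ### Expected query time -/

namespace TDNetwork

variable {V : Type*} [Fintype V] [DecidableEq V] {N : TDNetwork V} {Δ : ℕ}

/-- The cost of the part of a query that follows the growing of the ball, if `l` has been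
settled last. -/
noncomputable def postCost (N : TDNetwork V) (L : Finset V) (tab : V → V → List (ℝ × ℝ)) (d : V)
    (r : ℕ) (s : SearchState V) (l : V) : ℝ :=
  if l = d then 0
  else lglg (tab l d).length +
    match r with
    | 0 => 0
    | r' + 1 => ∑ x ∈ s.queue, (1 + (N.query L tab d r' x (s.label x).key).cost)

theorem query_cost_of_not_mem (L : Finset V) (tab : V → V → List (ℝ × ℝ)) (d : V) (r : ℕ) {w : V}
    (hw : w ∉ L) (t : ℝ) : (N.query L tab d r w t).cost =
      1 + N.forward.loopCost (N.postCost L tab d r) (insert d L) (Fintype.card V)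
        ⟨∅, {w}, fun _ => ⟨t, 1, 1⟩⟩ := by
  cases r <;>
  · rw [query, if_neg hw]
    simp only [SearchGraph.search, SearchGraph.loopCost]
    cases h : (N.forward.loop (insert d L) (Fintype.card V)
      ⟨∅, {w}, fun _ => ⟨t, 1, 1⟩⟩).val.2 with
    | none => simp
    | some l =>
      by_cases hl : l = d
      · simp [hl, postCost]
      · simp [hl, postCost, evalSummary]
        ring

theorem forward_evalCost_nonneg (N : TDNetwork V) (u v : V) : 0 ≤ N.forward.evalCost u v :=
  zero_le_one.trans (one_le_lglg _)

theorem query_cost_nonneg (L : Finset V) (tab : V → V → List (ℝ × ℝ)) (d : V) (r : ℕ) (w : V)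
    (t : ℝ) : 0 ≤ (N.query L tab d r w t).cost := by
  have hpos : ∀ k, 0 ≤ lglg k := fun k => zero_le_one.trans (one_le_lglg k)
  have hloop := N.forward.loop_cost_nonneg N.forward_evalCost_nonneg (insert d L)
    (Fintype.card V)
  induction r generalizing w t with
  | zero =>
    by_cases hw : w ∈ L
    · rw [query_of_mem _ _ _ _ hw]
      exact add_nonneg zero_le_one (hpos _)
    · rw [query_cost_of_not_mem _ _ _ _ hw, SearchGraph.loopCost]
      refine add_nonneg zero_le_one (add_nonneg (hloop _) ?_)
      rcases (N.forward.loop (insert d L) (Fintype.card V)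
        ⟨∅, {w}, fun _ => ⟨t, 1, 1⟩⟩).val.2 with _ | l
      · exact le_rfl
      · simp only [Option.elim, postCost]
        split_ifs
        · exact le_rfl
        · exact add_nonneg (hpos _) le_rfl
  | succ r ih =>
    by_cases hw : w ∈ L
    · rw [query_of_mem _ _ _ _ hw]
      exact add_nonneg zero_le_one (hpos _)
    · rw [query_cost_of_not_mem _ _ _ _ hw, SearchGraph.loopCost]
      refine add_nonneg zero_le_one (add_nonneg (hloop _) ?_)
      rcases (N.forward.loop (insert d L) (Fintype.card V)
        ⟨∅, {w}, fun _ => ⟨t, 1, 1⟩⟩).val.2 with _ | l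
      · exact le_rfl
      · simp only [Option.elim, postCost]
        split_ifs
        · exact le_rfl
        · exact add_nonneg (hpos _) (Finset.sum_nonneg fun x _ =>
            add_nonneg zero_le_one (ih x _))

theorem loopCost_query_nonneg (L : Finset V) (tab : V → V → List (ℝ × ℝ)) (d : V) (r : ℕ)
    (s : SearchState V) (k : ℕ) :
    0 ≤ N.forward.loopCost (N.postCost L tab d r) (insert d L) k s := by
  refine add_nonneg (N.forward.loop_cost_nonneg N.forward_evalCost_nonneg _ _ _) ?_
  rcases (N.forward.loop (insert d L) k s).val.2 with _ | l
  · exact le_rfl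
  · simp only [Option.elim, postCost]
    split_ifs
    · exact le_rfl
    · refine add_nonneg (zero_le_one.trans (one_le_lglg _)) ?_
      cases r with
      | zero => exact le_rfl
      | succ r =>
        exact Finset.sum_nonneg fun x _ => add_nonneg zero_le_one (query_cost_nonneg _ _ _ _ _ _)

theorem succ_le_inv_mul {ρ Y : ℝ} (hρ : ρ ∈ Set.Ioo (0 : ℝ) 1) (hY : 2 ≤ Y) (j : ℕ) :
    ρ * ((j : ℝ) + 1) ≤ Y + ρ * j ∧ ((j : ℝ) + 1) ≤ 1 / ρ * (Y + ρ * j) := by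
  have h1 : ρ * ((j : ℝ) + 1) ≤ Y + ρ * j := by linarith [hρ.2]
  refine ⟨h1, ?_⟩
  rw [one_div, ← div_eq_inv_mul, le_div_iff₀ hρ.1]
  linarith

/-- Write `(Δ + 1) (j + 1)` as `(Δ + 1) * (1 / ρ) * (ρ (j + 1))` and bound the logarithms of the
outer factors by the factors themselves. So `lg (1 / ρ)` appears instead of `lg n`, and `j` enters
through the potential only. -/
theorem pqCost_le_of_le {ρ Y : ℝ} (hρ : ρ ∈ Set.Ioo (0 : ℝ) 1) (hY : 2 ≤ Y) {j m : ℕ}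
    (hm : m ≤ (Δ + 1) * (j + 1)) :
    pqCost m ≤ (4 + Δ) * (lg (1 / ρ) * (Y + ρ * j)) := by
  have hρ0 := hρ.1
  have hlg := one_le_lg (1 / ρ)
  obtain ⟨h1, _⟩ := succ_le_inv_mul hρ hY j
  have hj : (0 : ℝ) < ρ * (j + 1) := by positivity
  have hD : (0 : ℝ) < Δ + 1 := by positivity
  have h2 : (((Δ + 1) * (j + 1) : ℕ) : ℝ) = (Δ + 1) * (1 / ρ) * (ρ * (j + 1)) := by
    push_cast
    field_simp
  have h3 : Real.logb 2 (((Δ + 1) * (j + 1) : ℕ) : ℝ) ≤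
      (Δ + 1) + lg (1 / ρ) + ρ * (j + 1) := by
    rw [h2, Real.logb_mul (by positivity) hj.ne', Real.logb_mul hD.ne' (by positivity)]
    exact add_le_add_three (logb_two_le_self hD) (logb_le_lg _) (logb_two_le_self hj)
  set y := Y + ρ * j with hy
  have hy1 : 1 ≤ y := by
    have : 0 ≤ ρ * (j : ℝ) := by positivity
    linarith
  have h4 : lg (1 / ρ) ≤ lg (1 / ρ) * y := le_mul_of_one_le_right (by linarith) hy1
  have h5 : y ≤ lg (1 / ρ) * y := le_mul_of_one_le_left (by linarith) hlg
  have h6 : (Δ : ℝ) ≤ Δ * (lg (1 / ρ) * y) :=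
    le_mul_of_one_le_right (Nat.cast_nonneg _) (by linarith)
  have h7 : lg (((Δ + 1) * (j + 1) : ℕ) : ℝ) ≤ (3 + Δ) * (lg (1 / ρ) * y) :=
    max_le (by linarith) (by linarith)
  refine (pqCost_mono hm).trans ((pqCost_le _).trans ?_)
  linarith

theorem round_cost_le (hΔ : ∀ u, (N.out u).card ≤ Δ) {ρ Y : ℝ} (hρ : ρ ∈ Set.Ioo (0 : ℝ) 1)
    (hY : 2 ≤ Y) {q : ℕ} (hq : q ≠ 0) {s : SearchState V} {u : V} (hu : u ∈ s.queue)
    (hs : s.queue.card ≤ Δ * s.settled.card + 1) :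
    1 + (N.forward.settle s u).cost ≤
      (5 + Δ + Δ * (6 + Δ)) * (lg (1 / ρ) * lglg N.Kmax) * (Y + ρ * s.settled.card) ^ q := by
  set j := s.settled.card
  have hρ0 := hρ.1
  have hlg := one_le_lg (1 / ρ)
  have hK := one_le_lglg N.Kmax
  set y := Y + ρ * j with hy
  have hy1 : 1 ≤ y := by
    have : 0 ≤ ρ * (j : ℝ) := by positivity
    linarith
  have h1 : pqCost s.queue.card ≤ (4 + Δ) * (lg (1 / ρ) * y) := by
    refine pqCost_le_of_le hρ hY (hs.trans ?_)
    nlinarith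
  have h2 : pqCost (N.forward.settle s u).val.queue.card ≤ (4 + Δ) * (lg (1 / ρ) * y) := by
    have h3 := N.forward.settle_queue_card_le hΔ hu
    refine pqCost_le_of_le hρ hY ?_
    nlinarith
  set Z := lg (1 / ρ) * y with hZ
  have hZ1 : 1 ≤ Z := one_le_mul_of_one_le_of_one_le hlg hy1
  have hΔ0 : (0 : ℝ) ≤ Δ := Nat.cast_nonneg _
  have hZK : Z ≤ Z * lglg N.Kmax := le_mul_of_one_le_right (by linarith) hK
  have hKZ : lglg N.Kmax ≤ Z * lglg N.Kmax := le_mul_of_one_le_left (by linarith) hZ1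
  have h4 : ∑ v ∈ N.out u, (1 + lglg (N.bp u v).card +
      pqCost (N.forward.settle s u).val.queue.card) ≤ Δ * ((6 + Δ) * (Z * lglg N.Kmax)) := by
    refine (Finset.sum_le_card_nsmul _ _ ((6 + Δ) * (Z * lglg N.Kmax)) fun v hv => ?_).trans ?_
    · have h5 := lglg_mono (N.card_bp_le hv)
      have h6 := mul_le_mul_of_nonneg_left hZK hΔ0
      linarith
    · rw [nsmul_eq_mul]
      refine mul_le_mul_of_nonneg_right (by exact_mod_cast hΔ u) ?_
      exact mul_nonneg (by linarith) (by linarith)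
  have h5 : (N.forward.settle s u).cost = pqCost s.queue.card + ∑ v ∈ N.out u,
      (1 + lglg (N.bp u v).card + pqCost (N.forward.settle s u).val.queue.card) := rfl
  have h6 := mul_le_mul_of_nonneg_left hZK hΔ0
  have h7 : 1 + (N.forward.settle s u).cost ≤
      (5 + Δ + Δ * (6 + Δ)) * (lg (1 / ρ) * lglg N.Kmax) * y := by
    rw [h5]
    have h8 : (5 + Δ + Δ * (6 + Δ)) * (lg (1 / ρ) * lglg N.Kmax) * y =
        (5 + Δ + Δ * (6 + Δ)) * (Z * lglg N.Kmax) := by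
      rw [hZ]
      ring
    rw [h8]
    linarith
  refine h7.trans (mul_le_mul_of_nonneg_left (le_self_pow₀ hy1 hq) ?_)
  have : 0 ≤ lg (1 / ρ) * lglg N.Kmax := mul_nonneg (by linarith) (by linarith)
  positivity

/-- The constant in the bound on the expected query time. -/
noncomputable def queryConst (Δ : ℕ) (c : ℝ) : ℕ → ℝ
  | 0 => 6 + Δ + Δ * (6 + Δ) + 2 * c
  | r + 1 => 6 + Δ + Δ * (6 + Δ) + 2 * c + (Δ + 1) * (1 + queryConst Δ c r)

theorem queryConst_nonneg (Δ : ℕ) {c : ℝ} (hc : 0 ≤ c) (r : ℕ) : 0 ≤ queryConst Δ c r := by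
  induction r with
  | zero =>
    unfold queryConst
    positivity
  | succ r ih =>
    unfold queryConst
    positivity

theorem length_tab_le (N : TDNetwork V) (ε : ℝ) {L : Finset V} {l : V} (hl : l ∈ L) (v : V) :
    lglg ((N.preprocess ε L).val l v).length ≤ lglg ((N.Kstar + 1) * N.U ε) := by
  simp only [preprocess, if_pos hl]
  exact lglg_mono (N.length_summaries_le ε l v)

/-- The bound on the expected query time for the recursion budget `r`, if the expected cost of what
follows the growing of the ball is known. -/
theorem expected_query_cost_le_of_postCost (hΔ : ∀ u, (N.out u).card ≤ Δ) {ρ Y ε c p : ℝ}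
    (hρ : ρ ∈ Set.Ioo (0 : ℝ) 1) (hc : 0 ≤ c) (hp : 0 ≤ p)
    (hU : lglg ((N.Kstar + 1) * N.U ε) ≤ c * (1 / ρ * lg (1 / ρ))) (d : V) (r : ℕ)
    (hY : 4 * r + 2 ≤ Y)
    (hpost : ∀ (S M : Finset V) (s : SearchState V) (l : V), Disjoint S M → l ∈ M →
      s.queue.card ≤ Δ * (S.card + 1) + 1 →
      restrictedExpectation ρ S M (fun L => N.postCost L (N.preprocess ε L).val d r s l) ≤
        ρ ^ M.card * (1 - ρ) ^ S.card * (p * ((1 / ρ) ^ (r + 1) * (lg (1 / ρ) * lglg N.Kmax)) *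
          (Y + ρ * S.card) ^ (2 * r + 1)))
    (w : V) (t : ℝ) (S M : Finset V) (hSM : Disjoint S M) :
    restrictedExpectation ρ S M (fun L => (N.query L (N.preprocess ε L).val d r w t).cost) ≤
      ρ ^ M.card * (1 - ρ) ^ S.card * ((6 + Δ + Δ * (6 + Δ) + c + p) *
        ((1 / ρ) ^ (r + 1) * (lg (1 / ρ) * lglg N.Kmax)) * (Y + ρ * S.card) ^ (2 * r + 2)) := by
  have hρ0 := hρ.1
  have hρ1 : 0 < 1 - ρ := sub_pos.2 hρ.2
  have ha : 1 ≤ 1 / ρ := by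
    rw [le_div_iff₀ hρ0]
    linarith [hρ.2]
  set a := 1 / ρ with hadef
  have hρa : ρ * a = 1 := mul_one_div_cancel hρ0.ne'
  have hlg := one_le_lg a
  have hK := one_le_lglg N.Kmax
  set Z := lg a * lglg N.Kmax with hZ
  have hZ1 : 1 ≤ Z := one_le_mul_of_one_le_of_one_le hlg hK
  have hr : (0 : ℝ) ≤ r := Nat.cast_nonneg _
  have hD : (0 : ℝ) ≤ Δ := Nat.cast_nonneg _
  have hs0 : 0 ≤ ρ * (S.card : ℝ) := by positivity
  set A := (5 + Δ + Δ * (6 + Δ)) * Z with hA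
  have hA1 : 1 ≤ A := one_le_mul_of_one_le_of_one_le (by nlinarith) hZ1
  have hP0 : 0 ≤ p * (a ^ (r + 1) * Z) := by positivity
  have key := N.forward.expected_loopCost_le hΔ hρ hA1 hP0 (q := 2 * r + 1) (Y := Y)
    (by push_cast; linarith) (by linarith) (fun L => N.postCost L (N.preprocess ε L).val d r) d
    (fun L s => if_pos rfl)
    (fun s u hu hs => round_cost_le hΔ hρ (by linarith) (Nat.succ_ne_zero _) hu hs) hpost
    (Fintype.card V) ⟨∅, {w}, fun _ => ⟨t, 1, 1⟩⟩ S M hSM (Finset.empty_subset _)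
    (Finset.disjoint_empty_left _) ((Finset.card_singleton w).le.trans (Nat.le_add_left _ _))
  -- One bound for both kinds of origin: the summand with `c` pays for the evaluation if `w` is a
  -- landmark, the ball for the other case.
  have hquery : ∀ L : Finset V, (N.query L (N.preprocess ε L).val d r w t).cost ≤
      (1 + c * (a * lg a)) + N.forward.loopCost (N.postCost L (N.preprocess ε L).val d r)
        (insert d L) (Fintype.card V) ⟨∅, {w}, fun _ => ⟨t, 1, 1⟩⟩ := by
    intro L
    by_cases hw : w ∈ L
    · rw [query_of_mem _ _ _ _ hw]
      have h1 := (N.length_tab_le ε hw d).trans hU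
      have h2 := N.loopCost_query_nonneg L (N.preprocess ε L).val d r
        ⟨∅, {w}, fun _ => ⟨t, 1, 1⟩⟩ (Fintype.card V)
      simp only [evalSummary]
      linarith
    · rw [query_cost_of_not_mem _ _ _ _ hw]
      have : 0 ≤ c * (a * lg a) := by positivity
      linarith
  refine (restrictedExpectation_mono hρ fun L _ _ => hquery L).trans ?_
  rw [restrictedExpectation_add (f := fun _ => 1 + c * (a * lg a)),
    restrictedExpectation_const ρ hSM]
  refine (add_le_add_right key _).trans ?_
  rw [← mul_add]
  refine mul_le_mul_of_nonneg_left ?_ (by positivity)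
  rw [Finset.sdiff_empty]
  set y := Y + ρ * S.card with hy
  have hy2 : 2 + ρ * S.card ≤ y := by linarith
  have hy1 : 1 ≤ y := by linarith
  set g := y ^ (2 * r + 1) with hg
  have hg1 : 1 ≤ g := one_le_pow₀ hy1
  have hpow : y ^ (2 * r + 2) = y * g := by
    rw [hg]
    ring
  have har : 1 ≤ a ^ r := one_le_pow₀ ha
  have harr : a ^ (r + 1) = a * a ^ r := pow_succ' a r
  have h2ρ : 2 / ρ = 2 * a := by
    rw [hadef]
    ring
  have hcard : (S.card : ℝ) = a * (ρ * S.card) := by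
    rw [← mul_assoc, mul_comm a, hρa, one_mul]
  -- As `|S| + 2 / ρ = (ρ |S| + 2) / ρ`, the ball costs a factor `1 / ρ` and one power of `y`. In
  -- the cost of what follows the `ρ` cancels, so it is only doubled, and `2 ≤ y` absorbs this.
  have h1 : ((S.card : ℝ) * A + 2 / ρ * (A + ρ * (p * (a ^ (r + 1) * Z)))) * g =
      a * A * ((ρ * S.card + 2) * g) + 2 * (p * (a ^ (r + 1) * Z)) * g := by
    rw [h2ρ]
    calc _ = ((S.card : ℝ) * A + 2 * (a * A) + 2 * (ρ * a) * (p * (a ^ (r + 1) * Z))) * g := by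
          ring
      _ = (a * (ρ * S.card) * A + 2 * (a * A) + 2 * (p * (a ^ (r + 1) * Z))) * g := by
          rw [hρa, ← hcard]
          ring
      _ = _ := by ring
  rw [h1, hpow]
  set W := a ^ (r + 1) * Z with hW
  have hyg : 1 ≤ y * g := one_le_mul_of_one_le_of_one_le hy1 hg1
  have haZ : a * Z ≤ W := by
    rw [hW, harr]
    refine mul_le_mul_of_nonneg_right ?_ (by linarith)
    exact le_mul_of_one_le_right (by linarith) har
  have haZ1 : 1 ≤ a * Z := one_le_mul_of_one_le_of_one_le ha hZ1
  have h2 : (ρ * S.card + 2) * g ≤ y * g :=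
    mul_le_mul_of_nonneg_right (by linarith) (by linarith)
  have h3 : a * A * ((ρ * S.card + 2) * g) ≤ (5 + Δ + Δ * (6 + Δ)) * W * (y * g) := by
    have h4 : a * A ≤ (5 + Δ + Δ * (6 + Δ)) * W := by
      have := mul_le_mul_of_nonneg_left haZ (by positivity : (0 : ℝ) ≤ 5 + Δ + Δ * (6 + Δ))
      rw [hA]
      linarith
    have hD2 : (0 : ℝ) ≤ 5 + Δ + Δ * (6 + Δ) := by nlinarith
    have hW0 : 0 ≤ W := by linarith
    exact mul_le_mul h4 h2 (mul_nonneg (by linarith) (by linarith)) (mul_nonneg hD2 hW0)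
  have h5 : 2 * (p * W) * g ≤ p * W * (y * g) := by
    have h6 : 2 * g ≤ y * g := mul_le_mul_of_nonneg_right (by linarith) (by linarith)
    have := mul_le_mul_of_nonneg_left h6 (by positivity : 0 ≤ p * W)
    linarith
  have h6 : W ≤ W * (y * g) := le_mul_of_one_le_right (by linarith) hyg
  have h7 : a * lg a ≤ W * (y * g) := by
    refine le_trans ?_ (haZ.trans h6)
    exact mul_le_mul_of_nonneg_left (le_mul_of_one_le_right (by linarith) hK) (by linarith)
  have h8 := mul_le_mul_of_nonneg_left h7 hc
  linarith

/-- A sub-query meets the same random set, partly revealed, so the induction is over all `S`, `M`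
and origins. The boundary has at most `(Δ + 1) (|S| + 1) ≤ (Δ + 1) y / ρ` vertices: each level gains
one factor `1 / ρ` and one power of `y` from it. A second power comes from the ball, which explains
the exponent `2 r + 2`. -/
theorem expected_query_cost_le (hΔ : ∀ u, (N.out u).card ≤ Δ) {ρ Y ε c : ℝ}
    (hρ : ρ ∈ Set.Ioo (0 : ℝ) 1) (hc : 0 ≤ c)
    (hU : lglg ((N.Kstar + 1) * N.U ε) ≤ c * (1 / ρ * lg (1 / ρ))) (d : V) (r : ℕ)
    (hY : 4 * r + 2 ≤ Y) (w : V) (t : ℝ) (S M : Finset V) (hSM : Disjoint S M) :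
    restrictedExpectation ρ S M (fun L => (N.query L (N.preprocess ε L).val d r w t).cost) ≤
      ρ ^ M.card * (1 - ρ) ^ S.card * (queryConst Δ c r *
        ((1 / ρ) ^ (r + 1) * (lg (1 / ρ) * lglg N.Kmax)) * (Y + ρ * S.card) ^ (2 * r + 2)) := by
  have hρ0 := hρ.1
  have hρ1 : 0 < 1 - ρ := sub_pos.2 hρ.2
  have ha : 1 ≤ 1 / ρ := by
    rw [le_div_iff₀ hρ0]
    linarith [hρ.2]
  have hlg := one_le_lg (1 / ρ)
  have hK := one_le_lglg N.Kmax
  have hZ1 : 1 ≤ lg (1 / ρ) * lglg N.Kmax := one_le_mul_of_one_le_of_one_le hlg hK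
  have hclg : c * (1 / ρ * lg (1 / ρ)) ≤ c * (1 / ρ * (lg (1 / ρ) * lglg N.Kmax)) := by
    gcongr
    exact le_mul_of_one_le_right (by linarith) hK
  induction r generalizing w t S M with
  | zero =>
    have h := expected_query_cost_le_of_postCost (Y := Y) hΔ hρ hc hc hU d 0 hY ?_ w t S M hSM
    · refine h.trans (le_of_eq ?_)
      simp only [queryConst]
      ring
    · intro S M s l hSM hl _
      refine (restrictedExpectation_mono (g := fun _ => c * (1 / ρ * lg (1 / ρ))) hρ
        fun L _ hL => ?_).trans ?_
      · unfold postCost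
        split_ifs
        · positivity
        · rw [add_zero]
          exact (N.length_tab_le ε (hL hl) d).trans hU
      · rw [restrictedExpectation_const ρ hSM]
        refine mul_le_mul_of_nonneg_left ?_ (by positivity)
        have hs0 : 0 ≤ ρ * (S.card : ℝ) := by positivity
        have hg1 : 1 ≤ (Y + ρ * S.card) ^ (2 * 0 + 1) := one_le_pow₀ (by push_cast at hY; linarith)
        rw [zero_add, pow_one]
        refine hclg.trans (le_mul_of_one_le_right ?_ hg1)
        positivity
  | succ r ih =>
    push_cast at hY
    have hr : (0 : ℝ) ≤ r := Nat.cast_nonneg _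
    have hB := queryConst_nonneg Δ hc r
    have hD : (0 : ℝ) ≤ Δ := Nat.cast_nonneg _
    -- In `p`, `c` stands for the evaluation at the landmark, and `Δ + 1` for the boundary, with one
    -- step and one sub-query per vertex.
    have h := expected_query_cost_le_of_postCost (Y := Y) hΔ hρ hc
      (p := c + (Δ + 1) * (1 + queryConst Δ c r)) (by positivity) hU d (r + 1)
      (by push_cast; linarith) ?_ w t S M hSM
    · refine h.trans (le_of_eq ?_)
      simp only [queryConst]
      ring
    · intro S M s l hSM hl hs
      by_cases hld : l = d
      · have h0 : (fun L => N.postCost L (N.preprocess ε L).val d (r + 1) s l) = fun _ => 0 := by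
          funext L
          exact if_pos hld
        rw [h0, restrictedExpectation_const ρ hSM]
        have hs0 : 0 ≤ ρ * (S.card : ℝ) := by positivity
        have : 0 ≤ Y + ρ * S.card := by linarith
        rw [mul_zero]
        positivity
      · refine (restrictedExpectation_mono (g := fun L => c * (1 / ρ * lg (1 / ρ)) +
          ∑ x ∈ s.queue, (1 + (N.query L (N.preprocess ε L).val d r x (s.label x).key).cost)) hρ
          fun L _ hL => ?_).trans ?_
        · unfold postCost
          rw [if_neg hld]
          exact add_le_add_left ((N.length_tab_le ε (hL hl) d).trans hU) _
        · rw [restrictedExpectation_add (f := fun _ => c * (1 / ρ * lg (1 / ρ))),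
            restrictedExpectation_const ρ hSM, restrictedExpectation_sum]
          have hs0 : 0 ≤ ρ * (S.card : ℝ) := by positivity
          have hsucc := (succ_le_inv_mul hρ (by linarith : 2 ≤ Y) S.card).2
          set y := Y + ρ * S.card with hy
          have hy1 : 1 ≤ y := by linarith
          set a := 1 / ρ with hadef
          set Z := lg a * lglg N.Kmax with hZ
          set w₀ := ρ ^ M.card * (1 - ρ) ^ S.card with hw₀
          have hw₀0 : 0 ≤ w₀ := by positivity
          set F := a ^ (r + 1) * Z * y ^ (2 * r + 2) with hF
          have hF1 : 1 ≤ F := one_le_mul_of_one_le_of_one_le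
            (one_le_mul_of_one_le_of_one_le (one_le_pow₀ ha) hZ1) (one_le_pow₀ hy1)
          have hx : ∀ x ∈ s.queue, restrictedExpectation ρ S M
              (fun L => 1 + (N.query L (N.preprocess ε L).val d r x (s.label x).key).cost) ≤
                w₀ * ((1 + queryConst Δ c r) * F) := by
            intro x _
            rw [restrictedExpectation_add (f := fun _ => 1), restrictedExpectation_const ρ hSM]
            have h1 := ih (by linarith) x (s.label x).key S M hSM
            refine (add_le_add_right h1 _).trans ?_
            rw [← mul_add]
            refine mul_le_mul_of_nonneg_left ?_ hw₀0
            have h2 : queryConst Δ c r * (a ^ (r + 1) * Z) * y ^ (2 * r + 2) =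
                queryConst Δ c r * F := by
              rw [hF]
              ring
            rw [h2]
            linarith
          have hq : (s.queue.card : ℝ) ≤ (Δ + 1) * (a * y) := by
            have h1 : (s.queue.card : ℝ) ≤ Δ * (S.card + 1) + 1 := by exact_mod_cast hs
            have h2 : (Δ : ℝ) * (S.card + 1) + 1 ≤ (Δ + 1) * (S.card + 1) := by
              have : (0 : ℝ) ≤ S.card := Nat.cast_nonneg _
              linarith
            exact h1.trans (h2.trans (mul_le_mul_of_nonneg_left hsucc (by linarith)))
          have hsum := Finset.sum_le_card_nsmul _ _ _ hx
          rw [nsmul_eq_mul] at hsum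
          have h3 : (s.queue.card : ℝ) * (w₀ * ((1 + queryConst Δ c r) * F)) ≤
              (Δ + 1) * (a * y) * (w₀ * ((1 + queryConst Δ c r) * F)) :=
            mul_le_mul_of_nonneg_right hq (by positivity)
          refine (add_le_add_right (hsum.trans h3) _).trans ?_
          have h4 : c * (a * lg a) ≤ c * (a * y * F) := by
            refine hclg.trans (mul_le_mul_of_nonneg_left ?_ hc)
            have h5 : Z ≤ F := by
              rw [hF]
              calc Z ≤ a ^ (r + 1) * Z := le_mul_of_one_le_left (by linarith) (one_le_pow₀ ha)
                _ ≤ _ := le_mul_of_one_le_right (by positivity) (one_le_pow₀ hy1)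
            have h6 : a ≤ a * y := le_mul_of_one_le_right (by linarith) hy1
            exact mul_le_mul h6 h5 (by linarith) (by positivity)
          have h5 := mul_le_mul_of_nonneg_left h4 hw₀0
          refine (add_le_add_left h5 _).trans (le_of_eq ?_)
          rw [hF]
          ring

/-- The expected query time. -/
theorem expected_oracle_cost_le (hΔ : ∀ u, (N.out u).card ≤ Δ) {ρ ε c : ℝ}
    (hρ : ρ ∈ Set.Ioo (0 : ℝ) 1)
    (hU : lglg ((N.Kstar + 1) * N.U ε) ≤ c * (1 / ρ * lg (1 / ρ))) (r : ℕ) (o d : V) (t : ℝ) :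
    landmarkExpectation ρ (fun L => (N.oracle ε r L o d t).cost) ≤
      queryConst Δ c r * (4 * r + 2) ^ (2 * r + 2) *
        ((1 / ρ) ^ (r + 1) * lg (1 / ρ) * lglg N.Kmax) := by
  -- The sign of `c` is not assumed, but `1 ≤ lglg` forces it.
  have hc : 0 ≤ c := by
    have h1 := (one_le_lglg _).trans hU
    have h2 : 0 < 1 / ρ * lg (1 / ρ) :=
      mul_pos (one_div_pos.2 hρ.1) (zero_lt_one.trans_le (one_le_lg _))
    by_contra! h
    have := mul_neg_of_neg_of_pos h h2
    linarith
  -- `le_rfl` chooses `Y = 4 r + 2`, twice the exponent `2 r + 1` of the potential, as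
  -- `potential_step` requires. With `S` empty, `y` is this constant.
  have h := expected_query_cost_le hΔ hρ hc hU d r le_rfl o t ∅ ∅ (Finset.disjoint_empty_left _)
  rw [landmarkExpectation_eq]
  refine h.trans (le_of_eq ?_)
  simp only [Finset.card_empty, pow_zero, Nat.cast_zero, mul_zero, add_zero, one_mul]
  ring

end TDNetwork

/-! ### The main theorem -/

theorem mainTheorem1 (Δ : ℕ) :
    ∃ (C : ℝ) (Cq : ℕ → ℝ → ℝ),
      ∀ (V : Type*) [Fintype V] [DecidableEq V] (N : TDNetwork V) (lmin lmax ζ ε ρ : ℝ) (r : ℕ),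
        (∀ u, (N.out u).card ≤ Δ) →
        N.StronglyConnected →
        lmin ∈ Set.Ico 0 1 → 0 ≤ lmax → N.BoundedSlopes lmin lmax →
        1 ≤ ζ → N.BoundedOppositeTrips ζ →
        0 < ε → ρ ∈ Set.Ioo 0 1 →
        -- every stored summary is a `(1 + ε)`-approximation of the distance function
        (∀ (L : Finset V), ∀ l ∈ L, ∀ v, ∀ t ∈ Set.Ico 0 N.T,
          N.dist l v t ≤ (N.evalSummary ((N.preprocess ε L).val l v) t).val ∧
          (N.evalSummary ((N.preprocess ε L).val l v) t).val ≤ (1 + ε) * N.dist l v t) ∧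
        -- expected preprocessing space
        landmarkExpectation ρ (fun L : Finset V => (N.space ε L : ℝ)) ≤
          C * (ρ * (Fintype.card V : ℝ) ^ 2 * (1 + N.Kstar) * N.U ε) ∧
        -- expected preprocessing time
        landmarkExpectation ρ (fun L : Finset V => (N.preprocess ε L).cost) ≤
          C * (ρ * (Fintype.card V : ℝ) ^ 2 * (1 + N.Kstar) * lg (Fintype.card V) *
            lglg N.Kmax * N.TDP ε) ∧
        -- expected query time
        (∀ c : ℝ, lglg ((N.Kstar + 1) * N.U ε) ≤ c * (1 / ρ * lg (1 / ρ)) →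
          ∀ o d : V, ∀ t ∈ Set.Ico 0 N.T,
            landmarkExpectation ρ (fun L => (N.oracle ε r L o d t).cost) ≤
              Cq r c * ((1 / ρ) ^ (r + 1) * lg (1 / ρ) * lglg N.Kmax)) ∧
        -- stretch
        (∀ (L : Finset V) (o d : V), ∀ t ∈ Set.Ico 0 N.T,
          N.dist o d t ≤ (N.oracle ε r L o d t).val ∧
          (N.oracle ε r L o d t).val ≤ stretch ε (psi ε lmax ζ) r * N.dist o d t) := by
  refine ⟨26 + 12 * Δ + lg Δ, fun r c => TDNetwork.queryConst Δ c r * (4 * r + 2) ^ (2 * r + 2), ?_⟩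
  intro V _ _ N lmin lmax ζ ε ρ r hΔ hc hlmin hlmax hb hζ ho hε hρ
  refine ⟨fun L l hL v t _ => N.evalSummary_approx hc hb hlmin.2 hε hL v t, ?_,
    N.expected_time_le hρ hΔ ε, fun c hU o d t _ => N.expected_oracle_cost_le hΔ hρ hU r o d t,
    fun L o d t _ => N.query_bounds hc hb hlmin.2 hlmax ho hζ hε L d r o t⟩
  -- The space bound holds with constant `1`, and the constant chosen for the time is larger.
  refine (TDNetwork.expected_space_le hρ N ε).trans (le_mul_of_one_le_left ?_ ?_)
  · have hρ0 := hρ.1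
    positivity
  · have := one_le_lg Δ
    have : (0 : ℝ) ≤ Δ := Nat.cast_nonneg _
    linarith
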